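/- **Notation.** All parameters $p,q,\alpha,\lambda_1,\lambda_2,d,\Delta_1,\Delta_2$ are complex; $\mathbb N=\{0,1,2,\dots\}$, $(a)_n=a(a+1)\cdots(a+n-1)$, $h=d/2$, $\Delta_-=(\Delta_1-\Delta_2)/2$, $A=\tfrac12(1+p+q)$, and ${}_3F_2(a,b,c;e,f;1)=\sum_{k\ge0}\frac{(a)_k(b)_k(c)_k}{(e)_k(f)_k\,k!}$. ${}_2F_1$ is the Gauss function (analytically continued to negative real arguments), and $\Gamma(x\pm\alpha)=\Gamma(x+\alpha)\Gamma(x-\alpha)$. For $0<x<1$ put $$w_{p,q}(x)=\frac{(1-x)^p}{x^{2+p+q}},\qquad \vartheta^{(p,q)}_\alpha(x)={}_2F_1\!\Big(A+\alpha,A-\alpha;1+p;\frac{x-1}{x}\Big),$$ $$Q_{p,q}(\alpha)=\frac{2\Gamma(1+p)\Gamma(-2\alpha)}{\Gamma(\frac12(1+p+q)-\alpha)\,\Gamma(\frac12(1+p-q)-\alpha)},$$ $$Y_n^{p,q}(\lambda_1,\lambda_2)=\frac{(-1)^n}{n!}\frac{(\lambda_1)_n(\lambda_1-q)_n}{(2\lambda_1-1-p-q+n)_n}\;{}_3F_2(-n,\,2\lambda_1-1-p-q+n,\,\lambda_2;\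 \lambda_1,\,\lambda_1-q;\ 1).$$ Call $(p,q,\alpha,\lambda_1,\lambda_2)$ *generic* if none of $1+p$, $\lambda_1$, $\lambda_1-q$, $\lambda_1-A\pm\alpha$, $1+p-\lambda_2$ lies in $-\mathbb N$. **Theorem.** **(I) Jacobi transform of a power law.** There is a function $\mathcal Y_{p,q}(\alpha;\lambda_1,\lambda_2)$ with the following properties. 1. If $1+p\notin-\mathbb N$ and $\operatorname{Re}(\lambda_1-A\pm\alpha)>0$, then $w_{p,q}(x)\,\frac{x^{\lambda_1}}{(1-x)^{\lambda_2}}\,\vartheta_\alpha^{(p,q)}(x)$ is integrable on $(0,1)$ if and only if $\operatorname{Re}(1+p-\lambda_2)>0$, and in that case $$\mathcal Y_{p,q}(\alpha;\lambda_1,\lambda_2)=\int_0^1dx\,w_{p,q}(x)\,\frac{x^{\lambda_1}}{(1-x)^{\lambda_2}}\,\vartheta_\alpha^{(p,q)}(x).$$ 2. For generic parameters with $\operatorname{Re}(1+p-\lambda_2)>0$ the following series converges absolutely, and $$\mathcal Y_{p,q}(\alpha;\lambda_1,\lambda_2)=\frac{\Gamma(1+p)\,\Gamma(\lambda_1-A\pm\alpha)}{\Gamma(\lambda_1)\Gamma(\lambda_1-q)}\;{}_3F_2(\lambda_1-A+\alpha,\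 \lambda_1-A-\alpha,\ \lambda_2;\ \lambda_1,\ \lambda_1-q;\ 1).$$ 3. For fixed $p,q$, $\mathcal Y_{p,q}$ is holomorphic in each of the variables $\alpha,\lambda_1,\lambda_2$ at every generic point (so it continues the formula analytically to generic $\lambda_2$), and $\mathcal Y_{p,q}(\alpha;\lambda_1,\lambda_2)=\mathcal Y_{p,-q}(\alpha;\lambda_1-q,\lambda_2)$ there. 4. If $n\in\mathbb N$ and none of $1+p$, $\lambda_1$, $\lambda_1-q$, $1+p-\lambda_2$, $2\lambda_1-1-p-q+n$ lies in $-\mathbb N$, then $\alpha\mapsto\frac{2}{Q_{p,q}(-\alpha)}\mathcal Y_{p,q}(\alpha;\lambda_1,\lambda_2)$ is meromorphic at $\alpha=\lambda_1-A+n$ and $$-\operatorname{Res}_{\alpha=\lambda_1-A+n}\ \frac{2}{Q_{p,q}(-\alpha)}\,\mathcal Y_{p,q}(\alpha;\lambda_1,\lambda_2)=Y_n^{p,q}(\lambda_1,\lambda_2).$$ 5. (Bulk) With $w_{\rm bulk}(\rho)=\rho^{-h-1}$ and $\Psi^{\rm bulk}_\alpha(\rho)=\big(\tfrac{1-\rho}{\rho}\big)^{\Delta_-}\vartheta_\alpha^{(2\Delta_-,h-1)}(\rho)$: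 if $1+2\Delta_-\notin-\mathbb N$, $\operatorname{Re}(\lambda_1-\tfrac h2\pm\alpha)>0$ and $\operatorname{Re}(1+\Delta_--\lambda_2)>0$, the following integral converges absolutely and $$\int_0^1d\rho\,w_{\rm bulk}(\rho)\frac{\rho^{\lambda_1}}{(1-\rho)^{\lambda_2}}\Psi^{\rm bulk}_\alpha(\rho)=\mathcal Y_{2\Delta_-,\,h-1}(\alpha;\lambda_1+\Delta_-,\lambda_2+\Delta_-).$$ 6. (Boundary) With $w_{\rm bdy}(\rho)=\rho^{h-1}(1-\rho)^{-2h}$ and $\Psi^{\rm bdy}_\nu(\rho)=\vartheta_\nu^{(h-1,h-1)}(1-\rho)$: if $h\notin-\mathbb N$, $\operatorname{Re}(-\lambda_2+\tfrac12-h\pm\nu)>0$ and $\operatorname{Re}(h+\lambda_1)>0$, the following integral converges absolutely and $$\int_0^1d\rho\,w_{\rm bdy}(\rho)\frac{\rho^{\lambda_1}}{(1-\rho)^{\lambda_2}}\Psi^{\rm bdy}_\nu(\rho)=\mathcal Y_{h-1,\,h-1}(\nu;-\lambda_2,-\lambda_1).$$ 7. (Crosscap) With $w_{\rm proj}(\eta)=(1-\eta)^{h-1}\eta^{-h-1}$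 and $\Phi_\alpha(\eta)=\eta^{-\Delta_-}\vartheta_\alpha^{(h-1,2\Delta_-)}(\eta)$: if $h\notin-\mathbb N$, $\operatorname{Re}(\lambda_1-\tfrac h2\pm\alpha)>0$ and $\operatorname{Re}(h-\lambda_2)>0$, the following integral converges absolutely and $$\int_0^1d\eta\,w_{\rm proj}(\eta)\frac{\eta^{\lambda_1}}{(1-\eta)^{\lambda_2}}\Phi_\alpha(\eta)=\mathcal Y_{h-1,\,2\Delta_-}(\alpha;\lambda_1+\Delta_-,\lambda_2).$$ **(II) Conformal block expansions.** Define the blocks $$G^{\rm bulk}_\Delta(\rho)=\rho^{\Delta/2}(1-\rho)^{\Delta_-}{}_2F_1\big(\tfrac\Delta2+\Delta_-,\tfrac\Delta2+1-h+\Delta_-;\Delta+1-h;\rho\big),$$ $$G^{\rm bdy}_\Delta(\rho)=(1-\rho)^\Delta{}_2F_1(\Delta,\Delta+1-h;2\Delta+2-2h;1-\rho),$$ $$G^{\rm proj}_\Delta(\eta)=\eta^{\Delta/2}{}_2F_1\big(\tfrac\Delta2+\Delta_-,\tfrac\Delta2-\Delta_-;\Delta+1-h;\eta\big).$$ For all $\rho,\eta\in(0,1)$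 the following series converge absolutely to the stated values: $$\frac{\rho^{\lambda_1}}{(1-\rho)^{\lambda_2}}=\sum_{n=0}^\infty Y_n^{2\Delta_-,h-1}(\lambda_1+\Delta_-,\lambda_2+\Delta_-)\,G^{\rm bulk}_{2\lambda_1+2n}(\rho)$$ if $\lambda_1+\Delta_-,\ \lambda_1+\Delta_-+1-h,\ 2\lambda_1+1-h\notin-\mathbb N$; $$\frac{\rho^{\lambda_1}}{(1-\rho)^{\lambda_2}}=\sum_{n=0}^\infty Y_n^{h-1,h-1}(-\lambda_2,-\lambda_1)\,G^{\rm bdy}_{-\lambda_2+n}(\rho)$$ if $-\lambda_2,\ -\lambda_2+1-h,\ -2\lambda_2+2-2h\notin-\mathbb N$; $$\frac{\eta^{\lambda_1}}{(1-\eta)^{\lambda_2}}=\sum_{n=0}^\infty Y_n^{h-1,2\Delta_-}(\lambda_1+\Delta_-,\lambda_2)\,G^{\rm proj}_{2\lambda_1+2n}(\eta)$$ if $\lambda_1+\Delta_-,\ \lambda_1-\Delta_-,\ 2\lambda_1+1-h\notin-\mathbb N$. -/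

import Mathlib

open Set Filter Topology MeasureTheory

noncomputable section

namespace AlphaSpace

/-- `z` is not one of `0, -1, -2, …`, i.e. `z` is not a pole of the Gamma function. -/
def NonPole (z : ℂ) : Prop := ∀ m : ℕ, z ≠ -(m : ℂ)

/-- The Pochhammer symbol `(a)_n = a (a + 1) ⋯ (a + n - 1)`. -/
def poch (a : ℂ) (n : ℕ) : ℂ := (ascPochhammer ℂ n).eval a

/-- The `k`-th term of the series `₃F₂(a, b, c; d, e; 1)`. -/
def threeFTwoTerm (a b c d e : ℂ) (k : ℕ) : ℂ :=
  poch a k * poch b k * poch c k / (poch d k * poch e k * (k.factorial : ℂ))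

/-- The sum of the series `₃F₂(a, b, c; d, e; 1)`. -/
def threeFTwoOne (a b c d e : ℂ) : ℂ := ∑' k : ℕ, threeFTwoTerm a b c d e k

/-- The Gauss hypergeometric function `₂F₁(a, b; c; z)` on `{|z| < 1} ∪ {Re z < 1/2}`: the power
series inside the unit disc, and its analytic continuation, written as
`(1 - z)^(-a) ₂F₁(a, c - b; c; z / (z - 1))`, outside of it. Only arguments `z < 1` are used. -/
def gaussF (a b c z : ℂ) : ℂ :=
  if ‖z‖ < 1 then ₂F₁ a b c z else (1 - z) ^ (-a) * ₂F₁ a (c - b) c (z / (z - 1))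

/-- `f` is meromorphic at `z₀` and its residue there is `c`: all sufficiently small circles around
`z₀` give `(2πi)⁻¹ ∮ f = c`. -/
def HasResidue (f : ℂ → ℂ) (z₀ c : ℂ) : Prop :=
  MeromorphicAt f z₀ ∧
    ∀ᶠ r in 𝓝[>] (0 : ℝ), (2 * (Real.pi : ℂ) * Complex.I)⁻¹ * (∮ z in C(z₀, r), f z) = c

/-! ### The Jacobi transform -/

/-- The weight `w_{p,q}(x) = (1 - x)^p / x^(2 + p + q)`. -/
def jacobiWeight (p q : ℂ) (x : ℝ) : ℂ := (1 - (x : ℂ)) ^ p / (x : ℂ) ^ (2 + p + q)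

/-- The Jacobi function `ϑ_α^{(p,q)}(x)`. -/
def jacobiFun (p q α : ℂ) (x : ℝ) : ℂ :=
  gaussF ((1 + p + q) / 2 + α) ((1 + p + q) / 2 - α) (1 + p) (((x : ℂ) - 1) / (x : ℂ))

/-- The coefficient function `Q_{p,q}(α)`. -/
def jacobiQ (p q α : ℂ) : ℂ :=
  2 * Complex.Gamma (1 + p) * Complex.Gamma (-2 * α) /
    (Complex.Gamma ((1 + p + q) / 2 - α) * Complex.Gamma ((1 + p - q) / 2 - α))

/-- The double power law `x^l₁ / (1 - x)^l₂`. -/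
def powerLaw (l₁ l₂ : ℂ) (x : ℝ) : ℂ := (x : ℂ) ^ l₁ / (1 - (x : ℂ)) ^ l₂

/-- The integrand of the Jacobi transform of a double power law. -/
def jacobiIntegrand (p q α l₁ l₂ : ℂ) (x : ℝ) : ℂ :=
  jacobiWeight p q x * powerLaw l₁ l₂ x * jacobiFun p q α x

/-- The integral defining the Jacobi transform converges at `x = 0`. -/
def ConvergesAtZero (p q α l₁ : ℂ) : Prop :=
  0 < (l₁ - (1 + p + q) / 2 + α).re ∧ 0 < (l₁ - (1 + p + q) / 2 - α).re

/-- Generic parameters: no Gamma function or series in the closed formula is singular, nor is the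
factor `Γ(1 + p - l₂)` hidden in the `₃F₂(1)` series. -/
def Generic (p q α l₁ l₂ : ℂ) : Prop :=
  NonPole (1 + p) ∧ NonPole l₁ ∧ NonPole (l₁ - q) ∧
    NonPole (l₁ - (1 + p + q) / 2 + α) ∧ NonPole (l₁ - (1 + p + q) / 2 - α) ∧
    NonPole (1 + p - l₂)

/-- The Gamma factor times the `₃F₂(1)` series. -/
def closedForm (p q α l₁ l₂ : ℂ) : ℂ :=
  Complex.Gamma (1 + p) *
      (Complex.Gamma (l₁ - (1 + p + q) / 2 + α) * Complex.Gamma (l₁ - (1 + p + q) / 2 - α)) /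
      (Complex.Gamma l₁ * Complex.Gamma (l₁ - q)) *
    threeFTwoOne (l₁ - (1 + p + q) / 2 + α) (l₁ - (1 + p + q) / 2 - α) l₂ l₁ (l₁ - q)

/-- The coefficient `Y_n^{p,q}(l₁, l₂)`, with a terminating `₃F₂(1)` series. -/
def coeffY (p q l₁ l₂ : ℂ) (n : ℕ) : ℂ :=
  (-1) ^ n / (n.factorial : ℂ) * (poch l₁ n * poch (l₁ - q) n / poch (2 * l₁ - 1 - p - q + n) n) *
    threeFTwoOne (-(n : ℂ)) (2 * l₁ - 1 - p - q + n) l₂ l₁ (l₁ - q)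

/-! ### Bulk, boundary and crosscap channels

`d` is the spacetime dimension and `D₁`, `D₂` are the external scaling dimensions. -/

/-- `Δ₋ = (Δ₁ - Δ₂) / 2`. -/
def deltaMinus (D₁ D₂ : ℂ) : ℂ := (D₁ - D₂) / 2

def weightBulk (d : ℂ) (ρ : ℝ) : ℂ := 1 / (ρ : ℂ) ^ (d / 2 + 1)

def weightBdy (d : ℂ) (ρ : ℝ) : ℂ := (ρ : ℂ) ^ (d / 2 - 1) / (1 - (ρ : ℂ)) ^ d

def weightProj (d : ℂ) (η : ℝ) : ℂ := (1 - (η : ℂ)) ^ (d / 2 - 1) / (η : ℂ) ^ (d / 2 + 1)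

/-- The bulk partial wave. -/
def waveBulk (d D₁ D₂ α : ℂ) (ρ : ℝ) : ℂ :=
  ((1 - (ρ : ℂ)) / (ρ : ℂ)) ^ deltaMinus D₁ D₂ *
    jacobiFun (2 * deltaMinus D₁ D₂) (d / 2 - 1) α ρ

/-- The boundary partial wave. -/
def waveBdy (d ν : ℂ) (ρ : ℝ) : ℂ := jacobiFun (d / 2 - 1) (d / 2 - 1) ν (1 - ρ)

/-- The crosscap partial wave. -/
def waveProj (d D₁ D₂ α : ℂ) (η : ℝ) : ℂ :=
  (η : ℂ) ^ (-deltaMinus D₁ D₂) * jacobiFun (d / 2 - 1) (2 * deltaMinus D₁ D₂) α η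

/-- The bulk conformal block of dimension `D`. -/
def blockBulk (d D₁ D₂ D : ℂ) (ρ : ℝ) : ℂ :=
  (ρ : ℂ) ^ (D / 2) * (1 - (ρ : ℂ)) ^ deltaMinus D₁ D₂ *
    gaussF (D / 2 + deltaMinus D₁ D₂) (D / 2 + 1 - d / 2 + deltaMinus D₁ D₂) (D + 1 - d / 2) ρ

/-- The boundary conformal block of dimension `D`. -/
def blockBdy (d D : ℂ) (ρ : ℝ) : ℂ :=
  (1 - (ρ : ℂ)) ^ D * gaussF D (D + 1 - d / 2) (2 * D + 2 - d) (1 - (ρ : ℂ))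

/-- The crosscap conformal block of dimension `D`. -/
def blockProj (d D₁ D₂ D : ℂ) (η : ℝ) : ℂ :=
  (η : ℂ) ^ (D / 2) *
    gaussF (D / 2 + deltaMinus D₁ D₂) (D / 2 - deltaMinus D₁ D₂) (D + 1 - d / 2) η

end AlphaSpace

end

open Set Filter Topology MeasureTheory

noncomputable section

namespace AlphaSpace

/-! ### Pochhammer symbols -/

/-! Transform. Pfaff's transformation writes the Jacobi function on `(0,1)` as a power of `x` times
a Gauss series in `1 - x`, so the integrand becomes `x^(a-1) (1-x)^(s-1) ₂F₁(A₁, A₂; P; 1-x)` with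
`P = 1 + p`, `a = l₁ - A + α`, `s = 1 + p - l₂` (`jacobiIntegrand_eq`). Integrating the Gauss series
termwise with Beta integrals gives a `₃F₂(1)` that converges when `b = l₁ - A - α` has positive real
part (`integral_betaFun_mul_gauss`). Thomae's transformation (`thomae`) turns it into the series of
the closed formula, whose convergence parameter is `s`. Thomae's formula itself comes from expanding
`(1-x)^(s-1) = (1-x)^(P-1) (1-x)^(-(P-s))` in powers of `x`: each resulting integral is summed by
Gauss's theorem (`hSum_gauss`). This needs `|P - s| < Re P`, and analytic continuation removes that
restriction.

Continuation. All series are divided by `Γ(d) Γ(e)`, so that poles in the lower parameters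
disappear. Write `σ = d + e - a - b - c`. The terms decay like `k^(-Re σ - 1)`, uniformly for
bounded parameters, so the sum is holomorphic for `Re σ > 0`. A telescoping relation
(`hSum_recurrence`) expresses `σ` times the series through two series with excess `σ + 1` and `σ +
2`; iterating it continues the series to every `σ` outside `-ℕ` (`hFull`). Here `σ = 1 + p - l₂`.

Residues. In `2 / Q(-α)` times the transform, the pole at `α = l₁ - A + n` comes from `Γ(l₁ - A -
α)` alone. There an upper parameter equals `-n`, the continued series is a finite sum
(`hFull_neg_nat`), and the value is `-Y_n`.

Blocks. All three expansions are one identity, `hasSum_blockCoeff_mul`: `(1-x)^(-c)` is a sum of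
multiples of `x^n ₂F₁(d+n, e+n; g+2n; x)`. The coefficients of `x^N` agree by an inverse-pair
identity (`orthogonality`). Rearranging the double series requires absolute convergence on the whole
of `0 < x < 1`. The Gauss functions are `O(4^n)` at fixed `x`, so the coefficients must be
`O((q/4)^n)` for every `q > 1`. The prefactor has ratio tending to `1/4` in norm, and the remaining
Hahn polynomial grows subexponentially by its three-term recurrence (`hahn_recurrence`,
`exists_norm_hahn_le`). -/

@[simp] lemma poch_zero (a : ℂ) : poch a 0 = 1 := by simp [poch]

lemma poch_succ (a : ℂ) (k : ℕ) : poch a (k + 1) = poch a k * (a + k) := by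
  simp [poch, ascPochhammer_succ_eval]

@[simp] lemma poch_one (a : ℂ) : poch a 1 = a := by simp [poch]

lemma poch_add (a : ℂ) (m n : ℕ) : poch a (m + n) = poch a m * poch (a + m) n := by
  induction n with
  | zero => simp
  | succ n ih => rw [← add_assoc, poch_succ, ih, poch_succ]; push_cast; ring

lemma poch_succ_left (a : ℂ) (k : ℕ) : poch a (k + 1) = a * poch (a + 1) k := by
  rw [add_comm, poch_add]; simp

lemma poch_one_left (k : ℕ) : poch 1 k = k.factorial := by
  induction k with
  | zero => simp
  | succ k ih => rw [poch_succ, ih, Nat.factorial_succ]; push_cast; ring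

lemma NonPole.add_nat_ne_zero {a : ℂ} (h : NonPole a) (k : ℕ) : a + k ≠ 0 := by
  intro h0; exact h k (by linear_combination h0)

lemma NonPole.add_nat {a : ℂ} (h : NonPole a) (k : ℕ) : NonPole (a + k) := by
  intro m hm; exact h (m + k) (by push_cast; linear_combination hm)

lemma nonPole_of_re_pos {a : ℂ} (h : 0 < a.re) : NonPole a := by
  rintro m rfl
  have : (0 : ℝ) ≤ m := by positivity
  simp at h; linarith

lemma NonPole.gamma_ne_zero {a : ℂ} (h : NonPole a) : Complex.Gamma a ≠ 0 := Complex.Gamma_ne_zero h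

lemma NonPole.poch_ne_zero {a : ℂ} (h : NonPole a) (k : ℕ) : poch a k ≠ 0 := by
  induction k with
  | zero => simp
  | succ k ih => rw [poch_succ]; exact mul_ne_zero ih (h.add_nat_ne_zero k)

lemma poch_neg_nat {n k : ℕ} (h : n < k) : poch (-(n : ℂ)) k = 0 := by
  obtain ⟨j, rfl⟩ := Nat.exists_eq_add_of_lt h
  rw [add_assoc, poch_add, poch_succ_left]; simp

lemma poch_neg_nat_eq {n k : ℕ} (h : k ≤ n) :
    poch (-(n : ℂ)) k * ((n - k).factorial : ℂ) = (-1) ^ k * (n.factorial : ℂ) := by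
  induction k with
  | zero => simp
  | succ k ih =>
    have h1 := ih (by omega)
    obtain ⟨j, rfl⟩ := Nat.exists_eq_add_of_le h
    have e1 : k + 1 + j - k = j + 1 := by omega
    have e2 : k + 1 + j - (k + 1) = j := by omega
    rw [e1, Nat.factorial_succ] at h1
    rw [e2, poch_succ, pow_succ]
    push_cast at h1 ⊢
    linear_combination -h1

/-- `1/Γ` is entire, and the convention `Γ(-m) = 0`, `0⁻¹ = 0` gives it the right zeros, so no
condition on `a` is needed. -/
lemma rgamma_eq_poch_mul (a : ℂ) (k : ℕ) :
    (Complex.Gamma a)⁻¹ = poch a k * (Complex.Gamma (a + k))⁻¹ := by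
  induction k with
  | zero => simp
  | succ k ih =>
    rw [ih, poch_succ, Complex.one_div_Gamma_eq_self_mul_one_div_Gamma_add_one (a + k)]
    push_cast; ring_nf

lemma NonPole.gamma_add_nat {a : ℂ} (h : NonPole a) (k : ℕ) :
    Complex.Gamma (a + k) = poch a k * Complex.Gamma a := by
  have h1 := rgamma_eq_poch_mul a k
  have h2 := h.gamma_ne_zero
  have h3 := (h.add_nat k).gamma_ne_zero
  field_simp at h1
  rw [h1, mul_comm]

lemma differentiable_poch (k : ℕ) : Differentiable ℂ (fun a => poch a k) :=
  (ascPochhammer ℂ k).differentiable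

/-! ### Growth of Pochhammer symbols and of `1/Γ`, uniformly in the parameter. -/

lemma norm_one_add_le_exp (w : ℂ) : ‖1 + w‖ ≤ Real.exp (w.re + ‖w‖ ^ 2 / 2) := by
  refine (pow_le_pow_iff_left₀ (norm_nonneg _) (Real.exp_pos _).le two_ne_zero).1 ?_
  rw [← Real.exp_nat_mul]
  have h : ‖1 + w‖ ^ 2 = (2 * w.re + ‖w‖ ^ 2) + 1 := by
    rw [Complex.sq_norm, Complex.sq_norm, Complex.normSq_apply, Complex.normSq_apply]
    simp; ring
  rw [h]
  refine (Real.add_one_le_exp _).trans_eq ?_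
  congr 1; push_cast; ring

/-- Apply the bound for `1 + w` to `(1 + w)⁻¹ = 1 - w (1 + w)⁻¹`; the condition `‖w‖ ≤ 1/2` keeps
the inverse at most `2`. -/
lemma norm_inv_one_add_le_exp {w : ℂ} (hw : ‖w‖ ≤ 1 / 2) :
    ‖(1 + w)⁻¹‖ ≤ Real.exp (-w.re + 4 * ‖w‖ ^ 2) := by
  have h1 : 1 / 2 ≤ ‖1 + w‖ := by
    have := norm_sub_norm_le (1 : ℂ) (-w)
    rw [norm_one, norm_neg, sub_neg_eq_add] at this; linarith
  have h0 : 1 + w ≠ 0 := by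
    intro h; rw [h, norm_zero] at h1; norm_num at h1
  have h2 : ‖(1 + w)⁻¹‖ ≤ 2 := by
    rw [norm_inv]; exact inv_le_of_inv_le₀ (by norm_num) (by linarith)
  have e1 : (1 + w)⁻¹ = 1 + -w * (1 + w)⁻¹ := by field_simp; ring
  have e2 : -w * (1 + w)⁻¹ = -w + w ^ 2 * (1 + w)⁻¹ := by field_simp; ring
  have h3 : ‖-w * (1 + w)⁻¹‖ ≤ 2 * ‖w‖ := by
    rw [norm_mul, norm_neg]; nlinarith [norm_nonneg w]
  have h4 : (-w * (1 + w)⁻¹).re ≤ -w.re + 2 * ‖w‖ ^ 2 := by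
    rw [e2, Complex.add_re, Complex.neg_re]
    have := (Complex.re_le_norm (w ^ 2 * (1 + w)⁻¹))
    rw [norm_mul, norm_pow] at this
    nlinarith [sq_nonneg ‖w‖]
  rw [e1]
  refine (norm_one_add_le_exp _).trans (Real.exp_le_exp.2 ?_)
  have : ‖-w * (1 + w)⁻¹‖ ^ 2 ≤ (2 * ‖w‖) ^ 2 := pow_le_pow_left₀ (norm_nonneg _) h3 2
  nlinarith

lemma sum_inv_sq_le_two (k : ℕ) : ∑ j ∈ Finset.range k, 1 / ((j : ℝ) + 1) ^ 2 ≤ 2 := by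
  have h : ∀ k : ℕ, ∑ j ∈ Finset.range (k + 1), 1 / ((j : ℝ) + 1) ^ 2 ≤ 2 - 1 / ((k : ℝ) + 1) := by
    intro k
    induction k with
    | zero => simp; norm_num
    | succ k ih =>
      rw [Finset.sum_range_succ]
      have : 1 / (((k + 1 : ℕ) : ℝ) + 1) ^ 2 ≤ 1 / ((k : ℝ) + 1) - 1 / (((k + 1 : ℕ) : ℝ) + 1) := by
        push_cast
        rw [div_sub_div _ _ (by positivity) (by positivity), div_le_div_iff₀ (by positivity) (by positivity)]
        have : (0 : ℝ) ≤ k := by positivity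
        nlinarith
      linarith
  rcases k with _ | k
  · simp
  · have : 0 ≤ 1 / ((k : ℝ) + 1) := by positivity
    linarith [h k]

/-- The harmonic numbers, as real numbers. -/
def harm (k : ℕ) : ℝ := ∑ j ∈ Finset.range k, 1 / ((j : ℝ) + 1)

lemma abs_harm_sub_log (k : ℕ) : |harm k - Real.log (k + 1)| ≤ 1 := by
  have e : harm k = (harmonic k : ℝ) := by simp [harm, harmonic]
  have h1 := log_add_one_le_harmonic k
  have h2 := harmonic_le_one_add_log k
  rw [e, abs_le]
  push_cast at h1
  constructor
  · linarith
  · rcases k with _ | k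
    · simp
    · have : Real.log ((k + 1 : ℕ) : ℝ) ≤ Real.log (((k + 1 : ℕ) : ℝ) + 1) :=
        Real.log_le_log (by positivity) (by linarith)
      linarith

lemma exp_mul_harm_le (x : ℝ) (k : ℕ) :
    Real.exp (x * harm k) ≤ Real.exp |x| * ((k : ℝ) + 1) ^ x := by
  rw [Real.rpow_def_of_pos (by positivity), ← Real.exp_add, Real.exp_le_exp]
  have h1 := abs_harm_sub_log k
  have h2 : x * (harm k - Real.log (k + 1)) ≤ |x| * 1 := by
    refine (le_abs_self _).trans ?_
    rw [abs_mul]; gcongr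
  linarith

/-- Write `(a)_k = k! ∏ (1 + (a-1)/(j+1))` and bound each factor by an exponential: the linear terms
add up to `(Re a - 1) H_k`, comparable to `(Re a - 1) log (k+1)`, and the quadratic terms are
summable. -/
lemma norm_poch_le (a : ℂ) (k : ℕ) :
    ‖poch a k‖ ≤ Real.exp (‖a - 1‖ ^ 2 + ‖a - 1‖) * k.factorial * ((k : ℝ) + 1) ^ (a.re - 1) := by
  have key : ‖poch a k‖ ≤ k.factorial * Real.exp ((a.re - 1) * harm k +
      ‖a - 1‖ ^ 2 / 2 * ∑ j ∈ Finset.range k, 1 / ((j : ℝ) + 1) ^ 2) := by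
    induction k with
    | zero => simp [harm]
    | succ k ih =>
      have hk : ((k : ℂ) + 1) ≠ 0 := by exact_mod_cast Nat.succ_ne_zero k
      have e : a + k = (k + 1) * (1 + (a - 1) / (k + 1)) := by field_simp; ring
      have hn : ‖(k : ℂ) + 1‖ = (k : ℝ) + 1 := by
        rw [← Nat.cast_add_one, Complex.norm_natCast]; push_cast; rfl
      have hre : ((a - 1) / ((k : ℂ) + 1)).re = (a.re - 1) * (1 / ((k : ℝ) + 1)) := by
        rw [← Nat.cast_add_one, Complex.div_natCast_re]; simp; ring
      have h1 : ‖a + k‖ ≤ (k + 1) * Real.exp ((a.re - 1) * (1 / ((k : ℝ) + 1)) +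
          ‖a - 1‖ ^ 2 / 2 * (1 / ((k : ℝ) + 1) ^ 2)) := by
        rw [e, norm_mul, hn]
        gcongr
        refine (norm_one_add_le_exp _).trans_eq ?_
        rw [hre, norm_div, hn]
        congr 1; field_simp
      rw [poch_succ, norm_mul]
      refine (mul_le_mul ih h1 (norm_nonneg _) (by positivity)).trans_eq ?_
      rw [harm, harm, Finset.sum_range_succ, Finset.sum_range_succ, mul_mul_mul_comm, ← Real.exp_add,
        Nat.factorial_succ]
      push_cast
      rw [mul_comm (k.factorial : ℝ)]
      congr 2; ring
  refine key.trans ?_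
  rw [Real.exp_add]
  have h1 := exp_mul_harm_le (a.re - 1) k
  have h2 : Real.exp (‖a - 1‖ ^ 2 / 2 * ∑ j ∈ Finset.range k, 1 / ((j : ℝ) + 1) ^ 2) ≤
      Real.exp (‖a - 1‖ ^ 2) := by
    rw [Real.exp_le_exp]
    nlinarith [sum_inv_sq_le_two k, sq_nonneg ‖a - 1‖]
  have h3 : Real.exp |a.re - 1| ≤ Real.exp ‖a - 1‖ := by
    rw [Real.exp_le_exp]; simpa using Complex.abs_re_le_norm (a - 1)
  rw [Real.exp_add]
  calc _ ≤ (k.factorial : ℝ) * ((Real.exp |a.re - 1| * ((k : ℝ) + 1) ^ (a.re - 1)) * Real.exp (‖a - 1‖ ^ 2)) := by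
        gcongr
    _ ≤ (k.factorial : ℝ) * ((Real.exp ‖a - 1‖ * ((k : ℝ) + 1) ^ (a.re - 1)) * Real.exp (‖a - 1‖ ^ 2)) := by
        gcongr
    _ = _ := by ring

/-- A bound for `(a)_k`, uniform for bounded `a`. -/
lemma exists_norm_poch_le (R : ℝ) : ∃ C > 0, ∀ a : ℂ, ‖a‖ ≤ R → ∀ k : ℕ,
    ‖poch a k‖ ≤ C * k.factorial * ((k : ℝ) + 1) ^ (a.re - 1) := by
  refine ⟨Real.exp ((R + 1) ^ 2 + (R + 1)), Real.exp_pos _, fun a ha k => ?_⟩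
  have h : ‖a - 1‖ ≤ R + 1 := (norm_sub_le _ _).trans (by simpa using ha)
  refine (norm_poch_le a k).trans ?_
  gcongr

/-- A bound for `k! / Γ(d + k)`, uniform for bounded `d`. -/
lemma exists_norm_rgamma_le (R : ℝ) : ∃ C > 0, ∀ d : ℂ, ‖d‖ ≤ R → ∀ k : ℕ,
    ‖(Complex.Gamma (d + k))⁻¹‖ * k.factorial ≤ C * ((k : ℝ) + 1) ^ (1 - d.re) := by
  -- From `j₀` on, `(d-1)/(k+1)` has norm at most `1/2`, so each new factor can be inverted. The
  -- finitely many `k ≤ j₀`, where `d + k` may vanish, are covered by compactness and continuity of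
  -- `1/Γ`.
  obtain ⟨j₀, hj₀⟩ := exists_nat_ge (2 * (R + 1))
  have hb : ∃ C₀ > 0, ∀ k ≤ j₀, ∀ d ∈ Metric.closedBall (0 : ℂ) R,
      ‖(Complex.Gamma (d + k))⁻¹‖ * k.factorial * Real.exp ((d.re - 1) * harm k) ≤ C₀ := by
    have h1 : ∀ k : ℕ, ∃ C₀, ∀ d ∈ Metric.closedBall (0 : ℂ) R,
        ‖(Complex.Gamma (d + k))⁻¹‖ * k.factorial * Real.exp ((d.re - 1) * harm k) ≤ C₀ := by
      intro k
      have hc : Continuous fun d : ℂ =>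
          ‖(Complex.Gamma (d + k))⁻¹‖ * k.factorial * Real.exp ((d.re - 1) * harm k) := by
        have : Continuous fun d : ℂ => (Complex.Gamma (d + k))⁻¹ :=
          Complex.differentiable_one_div_Gamma.continuous.comp (by fun_prop)
        have := Complex.continuous_re
        fun_prop
      obtain ⟨C, hC⟩ := ((isCompact_closedBall (0 : ℂ) R).image hc).bddAbove
      exact ⟨C, fun d hd => hC ⟨d, hd, rfl⟩⟩
    choose C hC using h1
    refine ⟨∑ k ∈ Finset.range (j₀ + 1), |C k| + 1, by positivity, fun k hk d hd => ?_⟩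
    have := Finset.single_le_sum (f := fun k => |C k|) (fun i _ => abs_nonneg _)
      (Finset.mem_range.2 (Nat.lt_succ_of_le hk))
    linarith [hC k d hd, le_abs_self (C k)]
  obtain ⟨C₀, hC₀, hb⟩ := hb
  have key : ∀ d : ℂ, ‖d‖ ≤ R → ∀ k : ℕ,
      ‖(Complex.Gamma (d + k))⁻¹‖ * k.factorial ≤ C₀ * Real.exp ((1 - d.re) * harm k +
        4 * (R + 1) ^ 2 * ∑ j ∈ Finset.range k, 1 / ((j : ℝ) + 1) ^ 2) := by
    intro d hd k
    have hd1 : ‖d - 1‖ ≤ R + 1 := (norm_sub_le _ _).trans (by simpa using hd)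
    by_cases hk : k ≤ j₀
    · have h := hb k hk d (by simpa using hd)
      rw [← le_div_iff₀ (Real.exp_pos _), div_eq_mul_inv, ← Real.exp_neg] at h
      refine h.trans ?_
      have : 0 ≤ ∑ j ∈ Finset.range k, 1 / ((j : ℝ) + 1) ^ 2 := Finset.sum_nonneg fun _ _ => by positivity
      gcongr
      nlinarith [sq_nonneg (R + 1), mul_nonneg (sq_nonneg (R + 1)) this]
    · push Not at hk
      induction k, hk.le using Nat.le_induction with
      | base => exact absurd hk (lt_irrefl _)
      | succ k hjk ih =>
        have ih' : ‖(Complex.Gamma (d + k))⁻¹‖ * k.factorial ≤ C₀ * Real.exp ((1 - d.re) * harm k +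
            4 * (R + 1) ^ 2 * ∑ j ∈ Finset.range k, 1 / ((j : ℝ) + 1) ^ 2) := by
          rcases hjk.eq_or_lt with h | h
          · subst h
            have h := hb j₀ le_rfl d (by simpa using hd)
            rw [← le_div_iff₀ (Real.exp_pos _), div_eq_mul_inv, ← Real.exp_neg] at h
            refine h.trans ?_
            have : 0 ≤ ∑ j ∈ Finset.range j₀, 1 / ((j : ℝ) + 1) ^ 2 :=
              Finset.sum_nonneg fun _ _ => by positivity
            gcongr
            nlinarith [sq_nonneg (R + 1), mul_nonneg (sq_nonneg (R + 1)) this]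
          · exact ih h
        have hk : ((k : ℂ) + 1) ≠ 0 := by exact_mod_cast Nat.succ_ne_zero k
        have hn : ‖(k : ℂ) + 1‖ = (k : ℝ) + 1 := by
          rw [← Nat.cast_add_one, Complex.norm_natCast]; push_cast; rfl
        have hre : ((d - 1) / ((k : ℂ) + 1)).re = (d.re - 1) * (1 / ((k : ℝ) + 1)) := by
          rw [← Nat.cast_add_one, Complex.div_natCast_re]; simp; ring
        have hjk' : (j₀ : ℝ) ≤ k := by exact_mod_cast hjk
        have hw : ‖(d - 1) / ((k : ℂ) + 1)‖ ≤ 1 / 2 := by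
          rw [norm_div, hn, div_le_iff₀ (by positivity)]; linarith
        have e : d + k = (k + 1) * (1 + (d - 1) / (k + 1)) := by field_simp; ring
        have h0 : d + k ≠ 0 := by
          rw [e]
          refine mul_ne_zero hk fun h => ?_
          rw [add_eq_zero_iff_eq_neg'.1 h] at hw
          norm_num at hw
        have h1 : ‖(d + k)⁻¹‖ * (k + 1) ≤ Real.exp ((1 - d.re) * (1 / ((k : ℝ) + 1)) +
            4 * (R + 1) ^ 2 * (1 / ((k : ℝ) + 1) ^ 2)) := by
          rw [e, mul_inv, norm_mul, norm_inv, hn, mul_comm, ← mul_assoc, mul_inv_cancel₀ (by positivity),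
            one_mul]
          refine (norm_inv_one_add_le_exp hw).trans (Real.exp_le_exp.2 ?_)
          rw [hre, norm_div, hn, div_pow, mul_one_div (4 * (R + 1) ^ 2), mul_div_assoc]
          have : ‖d - 1‖ ^ 2 / ((k : ℝ) + 1) ^ 2 ≤ (R + 1) ^ 2 / ((k : ℝ) + 1) ^ 2 := by gcongr
          linarith
        have e2 : (Complex.Gamma (d + (k + 1 : ℕ)))⁻¹ = (d + k)⁻¹ * (Complex.Gamma (d + k))⁻¹ := by
          rw [Complex.one_div_Gamma_eq_self_mul_one_div_Gamma_add_one (d + k)]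
          field_simp
          push_cast; ring_nf
        calc _ = (‖(Complex.Gamma (d + k))⁻¹‖ * k.factorial) * (‖(d + k)⁻¹‖ * (k + 1)) := by
              rw [e2, norm_mul, Nat.factorial_succ]; push_cast; ring
          _ ≤ _ := mul_le_mul ih' h1 (by positivity) (by positivity)
          _ = _ := by
              rw [harm, harm, Finset.sum_range_succ, Finset.sum_range_succ, mul_assoc, ← Real.exp_add]
              congr 2; ring
  refine ⟨C₀ * Real.exp (R + 1) * Real.exp (8 * (R + 1) ^ 2), by positivity, fun d hd k => ?_⟩
  refine (key d hd k).trans ?_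
  have hd1 : ‖1 - d‖ ≤ R + 1 := (norm_sub_le _ _).trans (by simp; linarith)
  have h1 := exp_mul_harm_le (1 - d.re) k
  have h3 : Real.exp |1 - d.re| ≤ Real.exp (R + 1) := by
    rw [Real.exp_le_exp]; refine le_trans ?_ hd1; simpa using Complex.abs_re_le_norm (1 - d)
  rw [Real.exp_add]
  have h4 : 4 * (R + 1) ^ 2 * ∑ j ∈ Finset.range k, 1 / ((j : ℝ) + 1) ^ 2 ≤ 8 * (R + 1) ^ 2 := by
    nlinarith [sum_inv_sq_le_two k, sq_nonneg (R + 1)]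
  calc _ ≤ C₀ * ((Real.exp |1 - d.re| * ((k : ℝ) + 1) ^ (1 - d.re)) * Real.exp (8 * (R + 1) ^ 2)) := by
        gcongr
    _ ≤ C₀ * ((Real.exp (R + 1) * ((k : ℝ) + 1) ^ (1 - d.re)) * Real.exp (8 * (R + 1) ^ 2)) := by
        gcongr
    _ = _ := by ring

/-! ### The regularized `₃F₂(1)` series and its continuation -/

/-- The terms of the series `₃F₂(a, b, c; d, e; 1) / (Γ(d) Γ(e))`. -/
def hTerm (a b c d e : ℂ) (k : ℕ) : ℂ :=
  poch a k * poch b k * poch c k * ((Complex.Gamma (d + k))⁻¹ * (Complex.Gamma (e + k))⁻¹) /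
    k.factorial

/-- The regularized series `₃F₂(a, b, c; d, e; 1) / (Γ(d) Γ(e))`. -/
def hSum (a b c d e : ℂ) : ℂ := ∑' k, hTerm a b c d e k

/-- The constant depends only on `R`: this uniformity is what makes the sum holomorphic in the
parameters. -/
lemma exists_norm_hTerm_le (R : ℝ) : ∃ C > 0, ∀ a b c d e : ℂ, ‖a‖ ≤ R → ‖b‖ ≤ R → ‖c‖ ≤ R →
    ‖d‖ ≤ R → ‖e‖ ≤ R → ∀ k : ℕ,
    ‖hTerm a b c d e k‖ ≤ C * ((k : ℝ) + 1) ^ (-(d + e - a - b - c).re - 1) := by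
  obtain ⟨C, hC, h1⟩ := exists_norm_poch_le R
  obtain ⟨C', hC', h2⟩ := exists_norm_rgamma_le R
  refine ⟨C ^ 3 * C' ^ 2, by positivity, fun a b c d e ha hb hc hd he k => ?_⟩
  have hk : (0 : ℝ) < k + 1 := by positivity
  have hf : (0 : ℝ) < k.factorial := by positivity
  have e1 : ‖hTerm a b c d e k‖ = ‖poch a k‖ * ‖poch b k‖ * ‖poch c k‖ *
      ((‖(Complex.Gamma (d + k))⁻¹‖ * k.factorial) * (‖(Complex.Gamma (e + k))⁻¹‖ * k.factorial)) /
        k.factorial ^ 3 := by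
    simp only [hTerm, norm_mul, norm_div, Complex.norm_natCast]
    field_simp
  rw [e1, div_le_iff₀ (by positivity)]
  have e2 : ((k : ℝ) + 1) ^ (-(d + e - a - b - c).re - 1) = ((k : ℝ) + 1) ^ (a.re - 1) *
      ((k : ℝ) + 1) ^ (b.re - 1) * ((k : ℝ) + 1) ^ (c.re - 1) *
      (((k : ℝ) + 1) ^ (1 - d.re) * ((k : ℝ) + 1) ^ (1 - e.re)) := by
    rw [← Real.rpow_add hk, ← Real.rpow_add hk, ← Real.rpow_add hk, ← Real.rpow_add hk]
    congr 1; simp; ring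
  calc _ ≤ (C * k.factorial * ((k : ℝ) + 1) ^ (a.re - 1)) *
        (C * k.factorial * ((k : ℝ) + 1) ^ (b.re - 1)) *
        (C * k.factorial * ((k : ℝ) + 1) ^ (c.re - 1)) *
        ((C' * ((k : ℝ) + 1) ^ (1 - d.re)) * (C' * ((k : ℝ) + 1) ^ (1 - e.re))) := by
          have h3 := h1 a ha k
          have h4 := h1 b hb k
          have h5 := h1 c hc k
          have h6 := mul_le_mul (h2 d hd k) (h2 e he k) (by positivity) (by positivity)
          exact mul_le_mul (mul_le_mul (mul_le_mul h3 h4 (by positivity) (by positivity)) h5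
            (by positivity) (by positivity)) h6 (by positivity) (by positivity)
    _ = _ := by rw [e2]; ring

lemma exists_norm_hTerm_le' (a b c d e : ℂ) : ∃ C > 0, ∀ k : ℕ,
    ‖hTerm a b c d e k‖ ≤ C * ((k : ℝ) + 1) ^ (-(d + e - a - b - c).re - 1) := by
  obtain ⟨C, hC, h⟩ := exists_norm_hTerm_le (max (max (max ‖a‖ ‖b‖) (max ‖c‖ ‖d‖)) ‖e‖)
  exact ⟨C, hC, h a b c d e (by simp) (by simp) (by simp) (by simp) (by simp)⟩

lemma summable_add_one_rpow {σ : ℝ} (hσ : 0 < σ) :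
    Summable fun k : ℕ => ((k : ℝ) + 1) ^ (-σ - 1) := by
  have := (summable_nat_add_iff 1).2 (Real.summable_nat_rpow (p := -σ - 1) |>.2 (by linarith))
  simpa using this

lemma summable_hTerm {a b c d e : ℂ} (h : 0 < (d + e - a - b - c).re) :
    Summable (hTerm a b c d e) := by
  obtain ⟨C, -, hC⟩ := exists_norm_hTerm_le' a b c d e
  exact Summable.of_norm_bounded ((summable_add_one_rpow h).mul_left C) hC

/-- Near `z₀` the excess has real part above a fixed `σ > 0` and the parameters are bounded by `R`,
so one convergent series `∑ C (k+1)^(-σ-1)` dominates and Weierstrass's theorem applies. -/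
lemma analyticAt_hSum {a b c d e : ℂ → ℂ} {z₀ : ℂ} (ha : AnalyticAt ℂ a z₀)
    (hb : AnalyticAt ℂ b z₀) (hc : AnalyticAt ℂ c z₀) (hd : AnalyticAt ℂ d z₀)
    (he : AnalyticAt ℂ e z₀) (hs : 0 < (d z₀ + e z₀ - a z₀ - b z₀ - c z₀).re) :
    AnalyticAt ℂ (fun z => hSum (a z) (b z) (c z) (d z) (e z)) z₀ := by
  obtain ⟨σ, hσ, hσs⟩ := exists_between hs
  set R := ‖a z₀‖ + ‖b z₀‖ + ‖c z₀‖ + ‖d z₀‖ + ‖e z₀‖ + 1 with hR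
  have n1 := norm_nonneg (a z₀)
  have n2 := norm_nonneg (b z₀)
  have n3 := norm_nonneg (c z₀)
  have n4 := norm_nonneg (d z₀)
  have n5 := norm_nonneg (e z₀)
  have hbd : ∀ f : ℂ → ℂ, AnalyticAt ℂ f z₀ → ‖f z₀‖ < R → ∀ᶠ z in 𝓝 z₀, ‖f z‖ ≤ R := by
    intro f hf h
    filter_upwards [hf.continuousAt.norm.eventually_lt_const h] with z hz using hz.le
  have hre : ∀ᶠ z in 𝓝 z₀, σ < (d z + e z - a z - b z - c z).re := by
    have : ContinuousAt (fun z => (d z + e z - a z - b z - c z).re) z₀ :=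
      Complex.continuous_re.continuousAt.comp
        ((((hd.add he).sub ha).sub hb).sub hc).continuousAt
    exact this.eventually_const_lt hσs
  have hev : ∀ᶠ z in 𝓝 z₀, (‖a z‖ ≤ R ∧ ‖b z‖ ≤ R ∧ ‖c z‖ ≤ R ∧ ‖d z‖ ≤ R ∧ ‖e z‖ ≤ R) ∧
      σ < (d z + e z - a z - b z - c z).re ∧ (AnalyticAt ℂ a z ∧ AnalyticAt ℂ b z ∧
        AnalyticAt ℂ c z ∧ AnalyticAt ℂ d z ∧ AnalyticAt ℂ e z) := by
    filter_upwards [hbd a ha (by linarith), hbd b hb (by linarith),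
      hbd c hc (by linarith), hbd d hd (by linarith),
      hbd e he (by linarith), hre, ha.eventually_analyticAt,
      hb.eventually_analyticAt, hc.eventually_analyticAt, hd.eventually_analyticAt,
      he.eventually_analyticAt] with z h1 h2 h3 h4 h5 h6 h7 h8 h9 h10 h11
    exact ⟨⟨h1, h2, h3, h4, h5⟩, h6, h7, h8, h9, h10, h11⟩
  obtain ⟨V, hV, hVo, hz₀⟩ := eventually_nhds_iff.1 hev
  obtain ⟨C, hC, hb⟩ := exists_norm_hTerm_le R
  have hdiff : DifferentiableOn ℂ (fun z => hSum (a z) (b z) (c z) (d z) (e z)) V := by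
    refine Complex.differentiableOn_tsum_of_summable_norm
      (u := fun k : ℕ => C * ((k : ℝ) + 1) ^ (-σ - 1)) ((summable_add_one_rpow hσ).mul_left C) ?_ hVo ?_
    · intro k z hz
      obtain ⟨-, -, h1, h2, h3, h4, h5⟩ := hV z hz
      apply DifferentiableAt.differentiableWithinAt
      have hp : ∀ f : ℂ → ℂ, AnalyticAt ℂ f z → DifferentiableAt ℂ (fun z => poch (f z) k) z :=
        fun f hf => (differentiable_poch k).differentiableAt.comp z hf.differentiableAt
      have hg : ∀ f : ℂ → ℂ, AnalyticAt ℂ f z →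
          DifferentiableAt ℂ (fun z => (Complex.Gamma (f z + k))⁻¹) z := fun f hf =>
        DifferentiableAt.comp (f := fun z => f z + k) z
          Complex.differentiable_one_div_Gamma.differentiableAt
          (hf.differentiableAt.add_const (k : ℂ))
      exact ((((hp a h1).mul (hp b h2)).mul (hp c h3)).mul ((hg d h4).mul (hg e h5))).div_const _
    · intro k z hz
      obtain ⟨⟨h1, h2, h3, h4, h5⟩, h6, -⟩ := hV z hz
      refine (hb _ _ _ _ _ h1 h2 h3 h4 h5 k).trans ?_
      gcongr
      simp
  exact (hdiff.analyticOnNhd hVo) z₀ hz₀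

lemma hTerm_swap (a b c d e : ℂ) (k : ℕ) : hTerm a b c e d k = hTerm a b c d e k := by
  simp only [hTerm]; ring

lemma hTerm_eq_mul_hTerm_add_one (a b c d e : ℂ) (k : ℕ) :
    hTerm a b c d e k = (d + k) * (e + k) * hTerm a b c (d + 1) (e + 1) k := by
  simp only [hTerm, add_right_comm _ (1 : ℂ)]
  rw [Complex.one_div_Gamma_eq_self_mul_one_div_Gamma_add_one (d + k),
    Complex.one_div_Gamma_eq_self_mul_one_div_Gamma_add_one (e + k)]
  ring

lemma succ_mul_hTerm (a b c d e : ℂ) (k : ℕ) :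
    ((k + 1 : ℕ) : ℂ) * hTerm a b c d e (k + 1) =
      a * b * c * hTerm (a + 1) (b + 1) (c + 1) (d + 1) (e + 1) k := by
  have h : ((k : ℂ) + 1) ≠ 0 := by exact_mod_cast Nat.succ_ne_zero k
  simp only [hTerm, poch_succ_left, Nat.factorial_succ]
  push_cast
  simp only [add_assoc, add_comm (1 : ℂ)]
  field_simp

/-- The telescoping identity behind the continuation of the series in its parameters. -/
lemma hTerm_telescope (a b c d e : ℂ) (k : ℕ) :
    (d + e - a - b - c) * hTerm a b c d e k +
      (((k + 1 : ℕ) : ℂ) * hTerm a b c d e (k + 1) - k * hTerm a b c d e k) =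
    ((d + e - a - b - c) * d * e + a * b * c) * hTerm a b c (d + 1) (e + 1) k +
      ((d + e - a - b - c) * (d + e) + a * b + b * c + c * a - d * e) *
        (k * hTerm a b c (d + 1) (e + 1) k) := by
  have h : ((k + 1 : ℕ) : ℂ) * hTerm a b c d e (k + 1) =
      (a + k) * (b + k) * (c + k) * hTerm a b c (d + 1) (e + 1) k := by
    have h : ((k : ℂ) + 1) ≠ 0 := by exact_mod_cast Nat.succ_ne_zero k
    simp only [hTerm, poch_succ, Nat.factorial_succ]
    push_cast
    simp only [add_assoc, add_comm (1 : ℂ)]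
    field_simp
  rw [h, hTerm_eq_mul_hTerm_add_one]
  ring

lemma tendsto_nat_mul_hTerm {a b c d e : ℂ} (h : 0 < (d + e - a - b - c).re) :
    Tendsto (fun k : ℕ => (k : ℂ) * hTerm a b c d e k) atTop (𝓝 0) := by
  obtain ⟨C, hC0, hC⟩ := exists_norm_hTerm_le' a b c d e
  have h1 : Tendsto (fun k : ℕ => C * ((k : ℝ) + 1) ^ (-(d + e - a - b - c).re)) atTop (𝓝 0) := by
    have := ((tendsto_rpow_neg_atTop h).comp
      (tendsto_natCast_atTop_atTop.atTop_add (tendsto_const_nhds (x := (1 : ℝ))))).const_mul C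
    simpa [Function.comp_def] using this
  refine squeeze_zero_norm (fun k => ?_) h1
  have hk : (0 : ℝ) < k + 1 := by positivity
  rw [norm_mul, Complex.norm_natCast]
  calc _ ≤ ((k : ℝ) + 1) * (C * ((k : ℝ) + 1) ^ (-(d + e - a - b - c).re - 1)) := by
        gcongr
        · linarith
        · exact hC k
    _ = _ := by
        rw [Real.rpow_sub_one hk.ne']; field_simp

/-- Sum `hTerm_telescope` over `k`. The quadratic and cubic powers of `k` cancel in it, so the right
side involves only the series at `(d+1, e+1)` and its `k`-weighted version; these have excess `σ +
2` and `σ + 1`. -/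
lemma hSum_recurrence {a b c d e : ℂ} (h : 0 < (d + e - a - b - c).re) :
    (d + e - a - b - c) * hSum a b c d e =
      ((d + e - a - b - c) * d * e + a * b * c) * hSum a b c (d + 1) (e + 1) +
      a * b * c * ((d + e - a - b - c) * (d + e) + a * b + b * c + c * a - d * e) *
        hSum (a + 1) (b + 1) (c + 1) (d + 2) (e + 2) := by
  have s0 := (summable_hTerm h).hasSum
  have s1 : HasSum (hTerm a b c (d + 1) (e + 1)) (hSum a b c (d + 1) (e + 1)) :=
    (summable_hTerm (by simp at h ⊢; linarith)).hasSum
  have s2 : HasSum (hTerm (a + 1) (b + 1) (c + 1) (d + 2) (e + 2))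
      (hSum (a + 1) (b + 1) (c + 1) (d + 2) (e + 2)) :=
    (summable_hTerm (by simp at h ⊢; linarith)).hasSum
  have s3 : HasSum (fun k : ℕ => (k : ℂ) * hTerm a b c (d + 1) (e + 1) k)
      (a * b * c * hSum (a + 1) (b + 1) (c + 1) (d + 2) (e + 2)) := by
    -- The term `k = 0` vanishes; after the shift the weight `k` raises every parameter by one.
    rw [← hasSum_nat_add_iff' 1]
    simp only [Finset.range_one, Finset.sum_singleton, Nat.cast_zero, zero_mul, sub_zero]
    refine (s2.mul_left (a * b * c)).congr_fun ?_
    intro k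
    rw [succ_mul_hTerm, add_assoc d, add_assoc e]; norm_num
  have s4 := (s1.mul_left ((d + e - a - b - c) * d * e + a * b * c)).add
    (s3.mul_left ((d + e - a - b - c) * (d + e) + a * b + b * c + c * a - d * e))
  have s5 : HasSum (fun k : ℕ => ((k + 1 : ℕ) : ℂ) * hTerm a b c d e (k + 1) - k * hTerm a b c d e k)
      0 := by
    have hsum : Summable fun k : ℕ =>
        ((k + 1 : ℕ) : ℂ) * hTerm a b c d e (k + 1) - k * hTerm a b c d e k := by
      refine (s4.sub (s0.mul_left (d + e - a - b - c))).summable.congr fun k => ?_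
      rw [← hTerm_telescope]; ring
    -- The partial sums telescope to `n` times the `n`-th term, which tends to `0` because the
    -- excess has positive real part.
    rw [hsum.hasSum_iff_tendsto_nat]
    have h2 := tendsto_nat_mul_hTerm h
    refine h2.congr fun n => ?_
    rw [Finset.sum_range_sub (fun k : ℕ => (k : ℂ) * hTerm a b c d e k)]
    simp
  have := ((s0.mul_left (d + e - a - b - c)).add s5).unique (s4.congr_fun fun k => hTerm_telescope a b c d e k)
  rw [add_zero] at this
  rw [show hSum a b c d e = ∑' k, hTerm a b c d e k from rfl, this]
  ring

/-- The continuation of `hSum` to `-M < Re (d + e - a - b - c)`. -/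
def hCont : ℕ → ℂ → ℂ → ℂ → ℂ → ℂ → ℂ
  | 0, a, b, c, d, e => hSum a b c d e
  | M + 1, a, b, c, d, e =>
    (((d + e - a - b - c) * d * e + a * b * c) * hCont M a b c (d + 1) (e + 1) +
      a * b * c * ((d + e - a - b - c) * (d + e) + a * b + b * c + c * a - d * e) *
        hCont M (a + 1) (b + 1) (c + 1) (d + 2) (e + 2)) / (d + e - a - b - c)

lemma NonPole.ne_zero {a : ℂ} (h : NonPole a) : a ≠ 0 := by simpa using h 0

/-- One more step of the recurrence changes nothing where the previous continuation is already
valid. The induction goes through because the two series on the right have excess larger by `2` and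
by `1`. -/
lemma hCont_succ (M : ℕ) : ∀ {a b c d e : ℂ}, -(M : ℝ) < (d + e - a - b - c).re →
    NonPole (d + e - a - b - c) → hCont (M + 1) a b c d e = hCont M a b c d e := by
  induction M with
  | zero =>
    intro a b c d e h hs
    have := hSum_recurrence (a := a) (b := b) (c := c) (d := d) (e := e) (by simpa using h)
    simp only [hCont]
    rw [div_eq_iff hs.ne_zero, ← this]; ring
  | succ M ih =>
    intro a b c d e h hs
    have e1 : d + 1 + (e + 1) - a - b - c = (d + e - a - b - c) + (2 : ℕ) := by push_cast; ring
    have e2 : d + 2 + (e + 2) - (a + 1) - (b + 1) - (c + 1) = (d + e - a - b - c) + (1 : ℕ) := by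
      push_cast; ring
    rw [hCont, ih, ih, ← hCont]
    · rw [e2, Complex.add_re]; push_cast at h ⊢; simp at h ⊢; linarith
    · rw [e2]; exact hs.add_nat 1
    · rw [e1, Complex.add_re]; push_cast at h ⊢; simp at h ⊢; linarith
    · rw [e1]; exact hs.add_nat 2

lemma hCont_of_le {M N : ℕ} (hMN : M ≤ N) {a b c d e : ℂ} (h : -(M : ℝ) < (d + e - a - b - c).re)
    (hs : NonPole (d + e - a - b - c)) : hCont N a b c d e = hCont M a b c d e := by
  induction N, hMN using Nat.le_induction with
  | base => rfl
  | succ N hMN ih =>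
    rw [← ih]
    have : (M : ℝ) ≤ N := by exact_mod_cast hMN
    exact hCont_succ N (by linarith) hs

lemma analyticAt_hCont (M : ℕ) : ∀ {a b c d e : ℂ → ℂ} {z₀ : ℂ}, AnalyticAt ℂ a z₀ →
    AnalyticAt ℂ b z₀ → AnalyticAt ℂ c z₀ → AnalyticAt ℂ d z₀ → AnalyticAt ℂ e z₀ →
    -(M : ℝ) < (d z₀ + e z₀ - a z₀ - b z₀ - c z₀).re →
    NonPole (d z₀ + e z₀ - a z₀ - b z₀ - c z₀) →
    AnalyticAt ℂ (fun z => hCont M (a z) (b z) (c z) (d z) (e z)) z₀ := by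
  induction M with
  | zero =>
    intro a b c d e z₀ ha hb hc hd he h _
    exact analyticAt_hSum ha hb hc hd he (by simpa using h)
  | succ M ih =>
    intro a b c d e z₀ ha hb hc hd he h hs
    have h1 := ih ha hb hc (hd.add (analyticAt_const (v := 1))) (he.add (analyticAt_const (v := 1)))
      (by simp at h ⊢; linarith) (by
        have := hs.add_nat 2
        convert this using 1; simp; ring)
    have h2 := ih (ha.add (analyticAt_const (v := 1))) (hb.add (analyticAt_const (v := 1)))
      (hc.add (analyticAt_const (v := 1))) (hd.add (analyticAt_const (v := 2)))
      (he.add (analyticAt_const (v := 2)))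
      (by simp at h ⊢; linarith) (by
        have := hs.add_nat 1
        convert this using 1; simp; ring)
    simp only [Pi.add_apply] at h1 h2
    simp only [hCont]
    have hne := hs.ne_zero
    fun_prop (disch := assumption)

/-- The continuation of `hSum` to all parameters with `d + e - a - b - c` not a pole of `Γ`. -/
def hFull (a b c d e : ℂ) : ℂ := hCont (⌈-(d + e - a - b - c).re⌉₊ + 1) a b c d e

lemma neg_ceil_lt (x : ℝ) : -((⌈-x⌉₊ + 1 : ℕ) : ℝ) < x := by
  have := Nat.le_ceil (-x); push_cast; linarith

lemma hFull_eq_hCont {M : ℕ} {a b c d e : ℂ} (h : -(M : ℝ) < (d + e - a - b - c).re)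
    (hs : NonPole (d + e - a - b - c)) : hFull a b c d e = hCont M a b c d e := by
  rcases le_total M (⌈-(d + e - a - b - c).re⌉₊ + 1) with h1 | h1
  · exact hCont_of_le h1 h hs
  · exact (hCont_of_le h1 (neg_ceil_lt _) hs).symm

lemma hFull_eq_hSum {a b c d e : ℂ} (h : 0 < (d + e - a - b - c).re) :
    hFull a b c d e = hSum a b c d e :=
  hFull_eq_hCont (M := 0) (by simpa using h) (nonPole_of_re_pos h)

/-- The poles of `Γ` are zeros of the continuous function `1/Γ`, so they stay away from a point
where it is nonzero. -/
lemma eventually_nonPole {z : ℂ} (h : NonPole z) : ∀ᶠ w in 𝓝 z, NonPole w := by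
  have h1 : (Complex.Gamma z)⁻¹ ≠ 0 := inv_ne_zero h.gamma_ne_zero
  filter_upwards [Complex.differentiable_one_div_Gamma.continuous.continuousAt.eventually_ne h1]
    with w hw
  intro m hm
  exact hw (by rw [hm, Complex.Gamma_neg_nat_eq_zero, inv_zero])

lemma analyticAt_hFull {a b c d e : ℂ → ℂ} {z₀ : ℂ} (ha : AnalyticAt ℂ a z₀)
    (hb : AnalyticAt ℂ b z₀) (hc : AnalyticAt ℂ c z₀) (hd : AnalyticAt ℂ d z₀)
    (he : AnalyticAt ℂ e z₀) (hs : NonPole (d z₀ + e z₀ - a z₀ - b z₀ - c z₀)) :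
    AnalyticAt ℂ (fun z => hFull (a z) (b z) (c z) (d z) (e z)) z₀ := by
  set M := ⌈-(d z₀ + e z₀ - a z₀ - b z₀ - c z₀).re⌉₊ + 1
  have hM : -(M : ℝ) < (d z₀ + e z₀ - a z₀ - b z₀ - c z₀).re := neg_ceil_lt _
  have hcont : ContinuousAt (fun z => d z + e z - a z - b z - c z) z₀ :=
    ((((hd.add he).sub ha).sub hb).sub hc).continuousAt
  refine (analyticAt_hCont M ha hb hc hd he hM hs).congr ?_
  filter_upwards [hcont.eventually (eventually_nonPole hs),
    (Complex.continuous_re.continuousAt.comp hcont).eventually_const_lt hM] with z h1 h2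
  exact (hFull_eq_hCont h2 h1).symm

lemma hCont_swap (M : ℕ) : ∀ a b c d e : ℂ, hCont M a b c e d = hCont M a b c d e := by
  induction M with
  | zero => intro a b c d e; simp only [hCont, hSum, hTerm_swap]
  | succ M ih =>
    intro a b c d e
    simp only [hCont]
    rw [ih a b c (d + 1), ih _ _ _ (d + 2), add_comm e d]
    ring

lemma hFull_swap (a b c d e : ℂ) : hFull a b c e d = hFull a b c d e := by
  rw [hFull, hFull, hCont_swap, add_comm e d]

lemma hTerm_neg_nat {n k : ℕ} (h : n < k) (a c d e : ℂ) : hTerm a (-(n : ℂ)) c d e k = 0 := by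
  simp [hTerm, poch_neg_nat h]

/-- A terminating series satisfies the same recurrence whatever the sign of the excess, since the
telescoping boundary term is the vanishing term of index `n + 1`. Hence its continuation is the
finite sum; the residues need exactly this. -/
lemma hCont_neg_nat (M : ℕ) : ∀ (n : ℕ) {a c d e : ℂ}, NonPole (d + e - a - -(n : ℂ) - c) →
    hCont M a (-(n : ℂ)) c d e = ∑ k ∈ Finset.range (n + 1), hTerm a (-(n : ℂ)) c d e k := by
  induction M with
  | zero =>
    intro n a c d e _
    exact tsum_eq_sum fun k hk => hTerm_neg_nat (by simpa using hk) _ _ _ _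
  | succ M ih =>
    intro n a c d e hs
    have h1 : hCont M a (-(n : ℂ)) c (d + 1) (e + 1) =
        ∑ k ∈ Finset.range (n + 1), hTerm a (-(n : ℂ)) c (d + 1) (e + 1) k := by
      apply ih
      have := hs.add_nat 2
      convert this using 1; push_cast; ring
    have h2 : a * -(n : ℂ) * c * hCont M (a + 1) (-(n : ℂ) + 1) (c + 1) (d + 2) (e + 2) =
        ∑ k ∈ Finset.range (n + 1), (k : ℂ) * hTerm a (-(n : ℂ)) c (d + 1) (e + 1) k := by
      rw [Finset.sum_range_succ']
      simp only [succ_mul_hTerm, Nat.cast_zero, zero_mul, add_zero, ← Finset.mul_sum]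
      -- For `n = 0` the prefactor vanishes; otherwise raising the upper parameter gives a
      -- terminating series of degree one less.
      rcases n with _ | n
      · simp
      · have e1 : -((n + 1 : ℕ) : ℂ) + 1 = -(n : ℂ) := by push_cast; ring
        rw [e1, ih]
        · simp only [add_assoc]; norm_num
        · have := hs.add_nat 1
          convert this using 1; push_cast; ring
    have h3 : (d + e - a - -(n : ℂ) - c) * ∑ k ∈ Finset.range (n + 1), hTerm a (-(n : ℂ)) c d e k =
        ((d + e - a - -(n : ℂ) - c) * d * e + a * -(n : ℂ) * c) *
          (∑ k ∈ Finset.range (n + 1), hTerm a (-(n : ℂ)) c (d + 1) (e + 1) k) +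
        ((d + e - a - -(n : ℂ) - c) * (d + e) + a * -(n : ℂ) + -(n : ℂ) * c + c * a - d * e) *
          ∑ k ∈ Finset.range (n + 1), (k : ℂ) * hTerm a (-(n : ℂ)) c (d + 1) (e + 1) k := by
      rw [Finset.mul_sum, Finset.mul_sum, Finset.mul_sum, ← Finset.sum_add_distrib]
      have h4 := Finset.sum_range_sub (fun k : ℕ => (k : ℂ) * hTerm a (-(n : ℂ)) c d e k) (n + 1)
      rw [hTerm_neg_nat (Nat.lt_succ_self n)] at h4
      simp only [mul_zero, Nat.cast_zero, zero_mul, sub_zero] at h4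
      simp only [← hTerm_telescope, Finset.sum_add_distrib]
      rw [h4, add_zero]
    simp only [hCont]
    rw [div_eq_iff hs.ne_zero, mul_comm _ (d + e - a - -(n : ℂ) - c), h3, ← h1, ← h2]
    ring

lemma hFull_neg_nat (n : ℕ) {a c d e : ℂ} (h : NonPole (d + e - a - -(n : ℂ) - c)) :
    hFull a (-(n : ℂ)) c d e = ∑ k ∈ Finset.range (n + 1), hTerm a (-(n : ℂ)) c d e k :=
  hCont_neg_nat _ n h

lemma hTerm_eq_threeFTwoTerm {d e : ℂ} (hd : NonPole d) (he : NonPole e) (a b c : ℂ) (k : ℕ) :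
    threeFTwoTerm a b c d e k = Complex.Gamma d * Complex.Gamma e * hTerm a b c d e k := by
  rw [threeFTwoTerm, hTerm, hd.gamma_add_nat, he.gamma_add_nat]
  have h1 := hd.gamma_ne_zero
  have h2 := he.gamma_ne_zero
  have h3 := hd.poch_ne_zero k
  have h4 := he.poch_ne_zero k
  field_simp

lemma threeFTwoOne_eq_hSum {d e : ℂ} (hd : NonPole d) (he : NonPole e) (a b c : ℂ) :
    threeFTwoOne a b c d e = Complex.Gamma d * Complex.Gamma e * hSum a b c d e := by
  simp only [threeFTwoOne, hTerm_eq_threeFTwoTerm hd he, tsum_mul_left, hSum]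

/-! ### Real Pochhammer symbols and comparison -/

/-- The real Pochhammer symbol. -/
def pochR (x : ℝ) (k : ℕ) : ℝ := (ascPochhammer ℝ k).eval x

@[simp] lemma pochR_zero (x : ℝ) : pochR x 0 = 1 := by simp [pochR]

lemma pochR_succ (x : ℝ) (k : ℕ) : pochR x (k + 1) = pochR x k * (x + k) := by
  simp [pochR, ascPochhammer_succ_eval]

lemma poch_ofReal (x : ℝ) (k : ℕ) : poch (x : ℂ) k = (pochR x k : ℂ) := by
  induction k with
  | zero => simp
  | succ k ih => rw [poch_succ, pochR_succ, ih]; push_cast; ring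

lemma pochR_nonneg {x : ℝ} (hx : 0 ≤ x) (k : ℕ) : 0 ≤ pochR x k := by
  induction k with
  | zero => simp
  | succ k ih => rw [pochR_succ]; positivity

lemma pochR_pos {x : ℝ} (hx : 0 < x) (k : ℕ) : 0 < pochR x k := by
  induction k with
  | zero => simp
  | succ k ih => rw [pochR_succ]; positivity

lemma norm_poch_le_pochR {a : ℂ} {x : ℝ} (h : ‖a‖ ≤ x) (k : ℕ) : ‖poch a k‖ ≤ pochR x k := by
  have hx := (norm_nonneg a).trans h
  induction k with
  | zero => simp
  | succ k ih =>
    rw [poch_succ, pochR_succ, norm_mul]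
    refine mul_le_mul ih ((norm_add_le _ _).trans ?_) (norm_nonneg _) (pochR_nonneg hx k)
    rw [Complex.norm_natCast]; linarith

lemma pochR_le_norm_poch {a : ℂ} {x : ℝ} (hx : 0 ≤ x) (h : x ≤ a.re) (k : ℕ) :
    pochR x k ≤ ‖poch a k‖ := by
  induction k with
  | zero => simp
  | succ k ih =>
    rw [poch_succ, pochR_succ, norm_mul]
    refine mul_le_mul ih ?_ (by positivity) (norm_nonneg _)
    refine le_trans ?_ (Complex.re_le_norm _)
    simpa using h

/-! ### Sums -/

lemma hasSum_binomial (c : ℂ) {x : ℂ} (hx : ‖x‖ < 1) :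
    HasSum (fun k : ℕ => poch c k / k.factorial * x ^ k) ((1 - x) ^ (-c)) := by
  have h := (Complex.one_div_one_sub_cpow_hasFPowerSeriesOnBall_zero c).hasSum_sub
    (y := x) (by simpa [← ofReal_norm] using hx)
  rw [one_div, ← Complex.cpow_neg] at h
  refine h.congr_fun fun k => ?_
  have e : (k.factorial : ℂ) * Ring.choose (c + k - 1) k = poch c k := by
    have h1 := Ring.descPochhammer_eq_factorial_smul_choose (c + k - 1) k
    rw [nsmul_eq_mul] at h1
    rw [← h1, Polynomial.descPochhammer_smeval_eq_ascPochhammer, Polynomial.ascPochhammer_smeval_eq_eval, poch]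
    congr 1; ring
  have hk : (k.factorial : ℂ) ≠ 0 := by exact_mod_cast k.factorial_ne_zero
  simp [← e]
  field_simp

lemma hasSum_binomial_real (c : ℝ) {x : ℝ} (h0 : 0 ≤ x) (hx : x < 1) :
    HasSum (fun k : ℕ => pochR c k / k.factorial * x ^ k) ((1 - x) ^ (-c)) := by
  rw [← Complex.hasSum_ofReal]
  have h := hasSum_binomial c (x := (x : ℂ)) (by simpa [abs_of_nonneg h0] using hx)
  rw [Complex.ofReal_cpow (by linarith)]
  push_cast
  simpa [poch_ofReal] using h

lemma summable_prod_of_bound {f : ℕ → ℕ → ℂ} {B : ℕ → ℕ → ℝ} {b : ℕ → ℝ}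
    (hf : ∀ k j, ‖f k j‖ ≤ B k j) (hB : ∀ k, HasSum (B k) (b k)) (hb : Summable b) :
    Summable fun p : ℕ × ℕ => f p.1 p.2 := by
  refine Summable.of_norm_bounded (g := fun p : ℕ × ℕ => B p.1 p.2) ?_ fun p => hf _ _
  rw [summable_prod_of_nonneg fun p => (norm_nonneg _).trans (hf p.1 p.2)]
  exact ⟨fun k => (hB k).summable, hb.congr fun k => (hB k).tsum_eq.symm⟩

lemma hasSum_rows {f : ℕ → ℕ → ℂ} (hf : Summable fun p : ℕ × ℕ => f p.1 p.2) {g : ℕ → ℂ}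
    (hg : ∀ k, HasSum (f k) (g k)) : HasSum g (∑' p : ℕ × ℕ, f p.1 p.2) :=
  hf.hasSum.prod_fiberwise hg

lemma hasSum_antidiagonals {f : ℕ → ℕ → ℂ} (hf : Summable fun p : ℕ × ℕ => f p.1 p.2) :
    HasSum (fun n => ∑ k ∈ Finset.range (n + 1), f k (n - k)) (∑' p : ℕ × ℕ, f p.1 p.2) := by
  have h1 := (Finset.HasAntidiagonal.sigmaAntidiagonalEquivProd (A := ℕ)).hasSum_iff.2 hf.hasSum
  have h2 := h1.sigma fun n => hasSum_fintype _
  refine h2.congr_fun fun n => ?_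
  rw [← Finset.Nat.sum_antidiagonal_eq_sum_range_succ f n, ← Finset.sum_coe_sort]
  rfl

lemma summable_rpow_mul_pow (σ : ℝ) {r : ℝ} (h0 : 0 ≤ r) (h1 : r < 1) :
    Summable fun k : ℕ => ((k : ℝ) + 1) ^ σ * r ^ k := by
  obtain ⟨N, hN⟩ := exists_nat_ge σ
  rcases h0.eq_or_lt with rfl | h0
  · refine summable_of_ne_finset_zero (s := {0}) fun k hk => ?_
    simp at hk; simp [hk]
  have h2 := summable_pow_mul_geometric_of_norm_lt_one N (r := r) (by simpa [abs_of_pos h0] using h1)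
  have h3 := ((summable_nat_add_iff 1).2 h2).mul_left r⁻¹
  refine Summable.of_nonneg_of_le (fun k => by positivity) (fun k => ?_) h3
  have : ((k : ℝ) + 1) ^ σ ≤ ((k : ℝ) + 1) ^ N := by
    rw [← Real.rpow_natCast]
    exact Real.rpow_le_rpow_of_exponent_le (by linarith [(Nat.cast_nonneg k : (0 : ℝ) ≤ k)]) hN
  rw [pow_succ]
  push_cast
  calc _ ≤ ((k : ℝ) + 1) ^ N * r ^ k := by gcongr
    _ = _ := by field_simp

/-! ### Gauss's summation theorem -/

/-- With `1` above and below, the `₃F₂` terms reduce to Gauss terms, so the bounds and the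
analyticity are shared. -/
lemma hTerm_one_one (a b c : ℂ) (k : ℕ) :
    hTerm a b 1 c 1 k = poch a k * poch b k * (Complex.Gamma (c + k))⁻¹ / k.factorial := by
  have h : Complex.Gamma (1 + k) = k.factorial := by rw [add_comm, Complex.Gamma_nat_eq_factorial]
  have hk : (k.factorial : ℂ) ≠ 0 := by exact_mod_cast k.factorial_ne_zero
  rw [hTerm, h, poch_one_left]; field_simp

/-- The coefficients of the Gauss series. -/
def gaussCoeff (a b c : ℂ) (k : ℕ) : ℂ := poch a k * poch b k / (poch c k * k.factorial)

lemma gaussCoeff_eq {c : ℂ} (hc : NonPole c) (a b : ℂ) (k : ℕ) :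
    gaussCoeff a b c k = Complex.Gamma c * hTerm a b 1 c 1 k := by
  rw [hTerm_one_one, gaussCoeff, hc.gamma_add_nat]
  have h1 := hc.gamma_ne_zero
  have h2 := hc.poch_ne_zero k
  field_simp

lemma exists_norm_gaussCoeff_le {c : ℂ} (hc : NonPole c) (a b : ℂ) : ∃ C > 0, ∀ k : ℕ,
    ‖gaussCoeff a b c k‖ ≤ C * ((k : ℝ) + 1) ^ ((a + b - c).re - 1) := by
  obtain ⟨C, hC, h⟩ := exists_norm_hTerm_le' a b 1 c 1
  refine ⟨‖Complex.Gamma c‖ * C, mul_pos (norm_pos_iff.2 hc.gamma_ne_zero) hC, fun k => ?_⟩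
  rw [gaussCoeff_eq hc, norm_mul, mul_assoc]
  gcongr
  have e : (a + b - c).re = -(c + 1 - a - b - 1).re := by simp; ring
  rw [e]; exact h k

lemma summable_gaussCoeff {c : ℂ} (hc : NonPole c) {a b : ℂ} (h : 0 < (c - a - b).re) :
    Summable (gaussCoeff a b c) := by
  have := (summable_hTerm (a := a) (b := b) (c := 1) (d := c) (e := 1)
    (by simp at h ⊢; linarith)).mul_left (Complex.Gamma c)
  exact this.congr fun k => (gaussCoeff_eq hc a b k).symm

/-- Contiguous relation in `c`: termwise the two sides differ by a telescoping difference, whose sum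
vanishes under the convergence condition. -/
lemma hSum_gauss_recurrence {a b c : ℂ} (h : 0 < (c - a - b).re) :
    (c - a - b) * hSum a b 1 c 1 = (c - a) * (c - b) * hSum a b 1 (c + 1) 1 := by
  have hs : 0 < (c + 1 - a - b - 1).re := by simp at h ⊢; linarith
  have s0 := (summable_hTerm (a := a) (b := b) (c := 1) (d := c) (e := 1) hs).hasSum
  have s1 := (summable_hTerm (a := a) (b := b) (c := 1) (d := c + 1) (e := 1)
    (by simp at h ⊢; linarith)).hasSum
  have tel : ∀ k : ℕ, (c - a) * (c - b) * hTerm a b 1 (c + 1) 1 k = (c - a - b) * hTerm a b 1 c 1 k +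
      (((k + 1 : ℕ) : ℂ) * hTerm a b 1 c 1 (k + 1) - k * hTerm a b 1 c 1 k) := by
    intro k
    have hk : ((k : ℂ) + 1) ≠ 0 := by exact_mod_cast Nat.succ_ne_zero k
    have h1 : ((k + 1 : ℕ) : ℂ) * hTerm a b 1 c 1 (k + 1) =
        (a + k) * (b + k) * hTerm a b 1 (c + 1) 1 k := by
      simp only [hTerm_one_one, poch_succ, Nat.factorial_succ]
      push_cast
      simp only [add_assoc, add_comm (1 : ℂ)]
      field_simp
    have h2 : hTerm a b 1 c 1 k = (c + k) * hTerm a b 1 (c + 1) 1 k := by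
      simp only [hTerm_one_one, add_right_comm _ (1 : ℂ)]
      rw [Complex.one_div_Gamma_eq_self_mul_one_div_Gamma_add_one (c + k)]
      ring
    rw [h1, h2]; ring
  have s5 : HasSum (fun k : ℕ => ((k + 1 : ℕ) : ℂ) * hTerm a b 1 c 1 (k + 1) - k * hTerm a b 1 c 1 k)
      0 := by
    have hsum : Summable fun k : ℕ =>
        ((k + 1 : ℕ) : ℂ) * hTerm a b 1 c 1 (k + 1) - k * hTerm a b 1 c 1 k := by
      refine ((s1.mul_left ((c - a) * (c - b))).sub (s0.mul_left (c - a - b))).summable.congr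
        fun k => ?_
      rw [tel]; ring
    rw [hsum.hasSum_iff_tendsto_nat]
    refine (tendsto_nat_mul_hTerm hs).congr fun n => ?_
    rw [Finset.sum_range_sub (fun k : ℕ => (k : ℂ) * hTerm a b 1 c 1 k)]
    simp
  have := ((s0.mul_left (c - a - b)).add s5).unique ((s1.mul_left _).congr_fun fun k => (tel k).symm)
  rwa [add_zero] at this

lemma hSum_gauss_iterate {a b c : ℂ} (h : 0 < (c - a - b).re) (n : ℕ) :
    poch (c - a - b) n * hSum a b 1 c 1 = poch (c - a) n * poch (c - b) n * hSum a b 1 (c + n) 1 := by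
  induction n with
  | zero => simp
  | succ n ih =>
    have h1 := hSum_gauss_recurrence (a := a) (b := b) (c := c + n) (by
      have : (0 : ℝ) ≤ n := by positivity
      simp at h ⊢; linarith)
    rw [poch_succ, poch_succ, poch_succ]
    push_cast
    rw [← add_assoc c]
    linear_combination (c - a - b + n) * ih + poch (c - a) n * poch (c - b) n * h1

/-- Only the term `k = 0` survives as the lower parameter grows. The series with lower parameter `Re
c` dominates, since `|c + n + j| ≥ Re c + j`. -/
lemma tendsto_tsum_gaussCoeff_add_nat {a b c : ℂ} (hc : 0 < c.re) (h : 0 < (c - a - b).re) :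
    Tendsto (fun n : ℕ => ∑' k, gaussCoeff a b (c + n) k) atTop (𝓝 1) := by
  have hcr : NonPole (c.re : ℂ) := nonPole_of_re_pos (by simpa using hc)
  have hs : Summable fun k => ‖gaussCoeff a b (c.re : ℂ) k‖ :=
    (summable_gaussCoeff hcr (by simpa using h)).norm
  have e : (∑' k : ℕ, if k = 0 then (1 : ℂ) else 0) = 1 := by simp
  rw [← e]
  refine tendsto_tsum_of_dominated_convergence hs (fun k => ?_) (Eventually.of_forall fun n k => ?_)
  · rcases k with _ | k
    · simp [gaussCoeff]
    · simp only [Nat.succ_ne_zero, if_false]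
      have h1 : Tendsto (fun n : ℕ => ‖poch (c + n) (k + 1)‖) atTop atTop := by
        refine tendsto_atTop_mono (f := fun n : ℕ => c.re ^ 0 * pochR c.re k * n) ?_ ?_
        · intro n
          rw [poch_succ, norm_mul, pow_zero, one_mul]
          refine mul_le_mul (pochR_le_norm_poch hc.le (by simp) k) ?_ (by positivity) (norm_nonneg _)
          refine le_trans ?_ (Complex.re_le_norm _)
          have : (0 : ℝ) ≤ k := by positivity
          simp; linarith
        · exact tendsto_natCast_atTop_atTop.const_mul_atTop (by simpa using pochR_pos hc k)
      rw [tendsto_zero_iff_norm_tendsto_zero]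
      have h2 := (h1.inv_tendsto_atTop).const_mul (‖poch a (k + 1)‖ * ‖poch b (k + 1)‖ / (k + 1).factorial)
      rw [mul_zero] at h2
      refine h2.congr fun n => ?_
      simp only [gaussCoeff, norm_div, norm_mul, Complex.norm_natCast, Pi.inv_apply]
      rw [div_mul_eq_div_div]
      ring
  · simp only [gaussCoeff, norm_div, norm_mul, Complex.norm_natCast]
    have h0 := pochR_pos hc k
    rw [poch_ofReal, Complex.norm_real, Real.norm_of_nonneg h0.le]
    have := pochR_le_norm_poch (a := c + n) hc.le (by simp) k
    gcongr

lemma gammaSeq_eq_poch (z : ℂ) (n : ℕ) :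
    Complex.GammaSeq z n = (n : ℂ) ^ z * n.factorial / poch z (n + 1) := by
  rw [Complex.GammaSeq]
  congr 1
  generalize n + 1 = m
  induction m with
  | zero => simp
  | succ m ih => rw [Finset.prod_range_succ, ih, poch_succ]

/-- **Gauss's theorem**, in the regularized form. -/
theorem hSum_gauss {a b c : ℂ} (h : 0 < (c - a - b).re) :
    hSum a b 1 c 1 = Complex.Gamma (c - a - b) *
      ((Complex.Gamma (c - a))⁻¹ * (Complex.Gamma (c - b))⁻¹) := by
  wlog hpos : 0 < c.re ∧ 0 < (c - a).re ∧ 0 < (c - b).re generalizing c with H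
  -- Raising `c` by a large `N` makes all three real parts positive; the iterated contiguous
  -- relation transports the result back.
  · obtain ⟨N, hN⟩ := exists_nat_gt (|c.re| + |(c - a).re| + |(c - b).re|)
    have hN0 : (0 : ℝ) ≤ N := by positivity
    have h1 := neg_abs_le c.re
    have h2 := neg_abs_le (c - a).re
    have h3 := neg_abs_le (c - b).re
    have g1 := abs_nonneg c.re
    have g2 := abs_nonneg (c - a).re
    have g3 := abs_nonneg (c - b).re
    have e1 : c + N - a = c - a + N := by ring
    have e2 : c + N - b = c - b + N := by ring
    have e3 : c + N - a - b = c - a - b + N := by ring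
    have := H (c := c + N) (by rw [e3, Complex.add_re, Complex.natCast_re]; linarith) (by
      rw [e1, e2]
      simp only [Complex.add_re, Complex.natCast_re]
      exact ⟨by linarith, by linarith, by linarith⟩)
    have h4 := hSum_gauss_iterate h N
    have hnp := nonPole_of_re_pos h
    rw [this, e3, e1, e2, hnp.gamma_add_nat] at h4
    rw [rgamma_eq_poch_mul (c - a) N, rgamma_eq_poch_mul (c - b) N]
    apply mul_left_cancel₀ (hnp.poch_ne_zero N)
    rw [h4]; ring
  obtain ⟨hc, ha, hb⟩ := hpos
  have n0 := nonPole_of_re_pos hc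
  have n1 := nonPole_of_re_pos ha
  have n2 := nonPole_of_re_pos hb
  have n3 := nonPole_of_re_pos h
  -- Euler's limit formula: the ratio of Pochhammer symbols from the iterated relation is a ratio of
  -- four `GammaSeq` values, in which the powers of `n` cancel.
  have t1 : Tendsto (fun n : ℕ => Complex.GammaSeq (c - a - b) n * Complex.GammaSeq c n /
      (Complex.GammaSeq (c - a) n * Complex.GammaSeq (c - b) n) *
      ∑' k, gaussCoeff a b (c + ((n + 1 : ℕ) : ℂ)) k) atTop
      (𝓝 (Complex.Gamma (c - a - b) * Complex.Gamma c /
        (Complex.Gamma (c - a) * Complex.Gamma (c - b)) * 1)) :=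
    (((Complex.GammaSeq_tendsto_Gamma _).mul (Complex.GammaSeq_tendsto_Gamma _)).div
      ((Complex.GammaSeq_tendsto_Gamma _).mul (Complex.GammaSeq_tendsto_Gamma _))
      (mul_ne_zero n1.gamma_ne_zero n2.gamma_ne_zero)).mul
      ((tendsto_add_atTop_iff_nat 1).2 (tendsto_tsum_gaussCoeff_add_nat hc h))
  have t2 : ∀ᶠ n : ℕ in atTop, Complex.GammaSeq (c - a - b) n * Complex.GammaSeq c n /
      (Complex.GammaSeq (c - a) n * Complex.GammaSeq (c - b) n) *
      ∑' k, gaussCoeff a b (c + ((n + 1 : ℕ) : ℂ)) k = Complex.Gamma c * hSum a b 1 c 1 := by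
    filter_upwards [eventually_ne_atTop 0] with n hn
    have hn' : (n : ℂ) ≠ 0 := by exact_mod_cast hn
    have e : ∑' k, gaussCoeff a b (c + ((n + 1 : ℕ) : ℂ)) k =
        Complex.Gamma (c + ((n + 1 : ℕ) : ℂ)) * hSum a b 1 (c + ((n + 1 : ℕ) : ℂ)) 1 := by
      rw [hSum, ← tsum_mul_left]
      exact tsum_congr fun k => gaussCoeff_eq (n0.add_nat _) a b k
    have h4 := hSum_gauss_iterate h (n + 1)
    have p0 := n0.poch_ne_zero (n + 1)
    have p1 := n1.poch_ne_zero (n + 1)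
    have p2 := n2.poch_ne_zero (n + 1)
    have p3 := n3.poch_ne_zero (n + 1)
    have q1 : (n : ℂ) ^ (c - a - b) * (n : ℂ) ^ c = (n : ℂ) ^ (c - a) * (n : ℂ) ^ (c - b) := by
      rw [← Complex.cpow_add _ _ hn', ← Complex.cpow_add _ _ hn']; congr 1; ring
    have q2 : (n : ℂ) ^ (c - a) ≠ 0 := by simp [Complex.cpow_eq_zero_iff, hn']
    have q3 : (n : ℂ) ^ (c - b) ≠ 0 := by simp [Complex.cpow_eq_zero_iff, hn']
    have hf : (n.factorial : ℂ) ≠ 0 := by exact_mod_cast n.factorial_ne_zero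
    rw [e, n0.gamma_add_nat]
    simp only [gammaSeq_eq_poch]
    have e5 : (n : ℂ) ^ (c - a - b) * n.factorial / poch (c - a - b) (n + 1) *
        ((n : ℂ) ^ c * n.factorial / poch c (n + 1)) /
        ((n : ℂ) ^ (c - a) * n.factorial / poch (c - a) (n + 1) *
          ((n : ℂ) ^ (c - b) * n.factorial / poch (c - b) (n + 1))) =
        poch (c - a) (n + 1) * poch (c - b) (n + 1) / (poch (c - a - b) (n + 1) * poch c (n + 1)) := by
      rw [div_mul_div_comm, div_mul_div_comm, mul_mul_mul_comm ((n : ℂ) ^ (c - a - b)), q1]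
      field_simp
    rw [e5]
    field_simp
    linear_combination -Complex.Gamma c * h4
  have t3 := tendsto_nhds_unique (tendsto_const_nhds.congr' (t2.mono fun n hn => hn.symm)) t1
  have g0 := n0.gamma_ne_zero
  have g1 := n1.gamma_ne_zero
  have g2 := n2.gamma_ne_zero
  apply mul_left_cancel₀ g0
  rw [t3]; field_simp

/-! ### The Gauss function and Pfaff's transformation -/

lemma _root_.HasSum.congr_val {E : Type*} [AddCommMonoid E] [TopologicalSpace E] {f : ℕ → E} {x y : E}
    (h : HasSum f x) (hxy : x = y) : HasSum f y := hxy ▸ h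

lemma ordinaryHypergeometric_eq_tsum_gaussCoeff (a b c z : ℂ) :
    ₂F₁ a b c z = ∑' k, gaussCoeff a b c k * z ^ k := by
  rw [ordinaryHypergeometric_eq_tsum]
  refine tsum_congr fun k => ?_
  simp only [gaussCoeff, poch, smul_eq_mul]
  rw [mul_comm (Polynomial.eval c _), div_mul_eq_div_div]
  ring

lemma summable_norm_gaussCoeff_mul_pow {c : ℂ} (hc : NonPole c) (a b : ℂ) {r : ℝ} (h0 : 0 ≤ r)
    (h1 : r < 1) : Summable fun k : ℕ => ‖gaussCoeff a b c k‖ * r ^ k := by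
  obtain ⟨C, -, hC⟩ := exists_norm_gaussCoeff_le hc a b
  refine Summable.of_nonneg_of_le (fun k => by positivity) (fun k => ?_)
    ((summable_rpow_mul_pow ((a + b - c).re - 1) h0 h1).mul_left C)
  rw [← mul_assoc]
  gcongr
  exact hC k

lemma hasSum_gaussCoeff {c : ℂ} (hc : NonPole c) (a b : ℂ) {z : ℂ} (hz : ‖z‖ < 1) :
    HasSum (fun k => gaussCoeff a b c k * z ^ k) (₂F₁ a b c z) := by
  rw [ordinaryHypergeometric_eq_tsum_gaussCoeff]
  refine Summable.hasSum (Summable.of_norm ?_)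
  simpa using summable_norm_gaussCoeff_mul_pow hc a b (norm_nonneg z) hz

/-- The Chu–Vandermonde identity. -/
lemma chu_vandermonde (n : ℕ) : ∀ {b c : ℂ}, NonPole c →
    ∑ k ∈ Finset.range (n + 1), (-1) ^ k * (n.choose k : ℂ) * (poch b k / poch c k) =
      poch (c - b) n / poch c n := by
  induction n with
  | zero => intro b c _; simp
  | succ n ih =>
    intro b c hc
    have h1 := ih (b := b) hc
    have h2 := ih (b := b + 1) (hc.add_nat 1)
    have hc0 := hc.ne_zero
    have e : ∀ k ∈ Finset.range (n + 1), (-1) ^ (k + 1) * ((n + 1).choose (k + 1) : ℂ) *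
        (poch b (k + 1) / poch c (k + 1)) =
        (-1) ^ (k + 1) * (n.choose (k + 1) : ℂ) * (poch b (k + 1) / poch c (k + 1)) -
        b / c * ((-1) ^ k * (n.choose k : ℂ) * (poch (b + 1) k / poch (c + (1 : ℕ)) k)) := by
      intro k _
      rw [Nat.choose_succ_succ]
      push_cast
      rw [poch_succ_left b, poch_succ_left c, mul_div_mul_comm]
      ring
    rw [Finset.sum_range_succ', Finset.sum_congr rfl e, Finset.sum_sub_distrib, ← Finset.mul_sum, h2]
    have h3 : ∑ k ∈ Finset.range (n + 1), (-1) ^ (k + 1) * (n.choose (k + 1) : ℂ) *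
        (poch b (k + 1) / poch c (k + 1)) + 1 = poch (c - b) n / poch c n := by
      have h5 := Finset.sum_range_succ' (fun k => (-1) ^ k * (n.choose k : ℂ) * (poch b k / poch c k))
        (n + 1)
      rw [Finset.sum_range_succ, h1] at h5
      simpa using h5.symm
    have h4 : poch c n * (c + n) = c * poch (c + 1) n := by rw [← poch_succ, poch_succ_left]
    have n1 := hc.poch_ne_zero n
    have n2 := hc.add_nat_ne_zero n
    have n3 := (hc.add_nat 1).poch_ne_zero n
    push_cast at n3 h2 ⊢
    have e5 : c + 1 - (b + 1) = c - b := by ring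
    have e6 : poch (c + 1) n = poch c n * (c + n) / c := by rw [h4]; field_simp
    simp only [pow_zero, Nat.choose_zero_right, Nat.cast_one, poch_zero, div_one, mul_one]
    rw [e5, e6, sub_add_eq_add_sub, h3, poch_succ, poch_succ]
    field_simp
    ring

lemma choose_eq_div {n k : ℕ} (h : k ≤ n) :
    (n.choose k : ℂ) = n.factorial / (k.factorial * (n - k).factorial) :=
  Nat.cast_choose ℂ h

/-- **Pfaff's transformation**, inside the disc of radius `1/2`. -/
lemma pfaff {c : ℂ} (hc : NonPole c) (a b : ℂ) {w : ℝ} (h0 : 0 ≤ w) (h1 : w < 1 / 2) :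
    ₂F₁ a b c (-(w : ℂ) / (1 - w)) = (1 - (w : ℂ)) ^ a * ₂F₁ a (c - b) c (w : ℂ) := by
  have hw : (1 - (w : ℂ)) ≠ 0 := by
    rw [← Complex.ofReal_one, ← Complex.ofReal_sub]; exact_mod_cast (by linarith : (1 - w) ≠ 0)
  set f : ℕ → ℕ → ℂ := fun k j => gaussCoeff a b c k * (-(w : ℂ)) ^ k *
    (poch (a + k) j / j.factorial * (w : ℂ) ^ j) with hf
  set B : ℕ → ℕ → ℝ := fun k j => ‖gaussCoeff a b c k‖ * w ^ k *
    (pochR (‖a‖ + k) j / j.factorial * w ^ j) with hB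
  have hn : ‖(w : ℂ)‖ = w := by simp [abs_of_nonneg h0]
  have hrow : ∀ k, HasSum (f k) ((1 - (w : ℂ)) ^ (-a) * (gaussCoeff a b c k * (-(w : ℂ) / (1 - w)) ^ k)) := by
    intro k
    have := (hasSum_binomial (a + k) (x := (w : ℂ)) (by rw [hn]; linarith)).mul_left
      (gaussCoeff a b c k * (-(w : ℂ)) ^ k)
    refine this.congr_val ?_
    rw [neg_add, Complex.cpow_add _ _ hw, Complex.cpow_neg _ (k : ℂ), Complex.cpow_natCast, div_pow]
    ring
  -- The rows, summed in absolute value, are bounded by Gauss terms at `w/(1-w)`, and this is below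
  -- `1` precisely because `w < 1/2`. The antidiagonals are then evaluated by Chu–Vandermonde.
  have hs : Summable fun p : ℕ × ℕ => f p.1 p.2 := by
    refine summable_prod_of_bound (B := B)
      (b := fun k => (1 - w) ^ (-‖a‖) * (‖gaussCoeff a b c k‖ * (w / (1 - w)) ^ k)) ?_ ?_ ?_
    · intro k j
      simp only [hf, hB, norm_mul, norm_div, norm_pow, norm_neg, hn, Complex.norm_natCast]
      gcongr
      exact norm_poch_le_pochR ((norm_add_le _ _).trans (by simp)) j
    · intro k
      have := (hasSum_binomial_real (‖a‖ + k) h0 (by linarith)).mul_left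
        (‖gaussCoeff a b c k‖ * w ^ k)
      refine this.congr_val ?_
      rw [neg_add, Real.rpow_add (by linarith), Real.rpow_neg (by linarith) (k : ℝ), Real.rpow_natCast,
        div_pow]
      ring
    · refine (summable_norm_gaussCoeff_mul_pow hc a b (div_nonneg h0 (by linarith)) ?_).mul_left _
      rw [div_lt_one (by linarith)]; linarith
  have s1 := hasSum_rows hs hrow
  have s2 := hasSum_antidiagonals hs
  have hz : ‖-(w : ℂ) / (1 - w)‖ < 1 := by
    rw [norm_div, norm_neg, hn, ← Complex.ofReal_one, ← Complex.ofReal_sub, Complex.norm_real,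
      Real.norm_of_nonneg (by linarith), div_lt_one (by linarith)]
    linarith
  have s3 := (hasSum_gaussCoeff hc a b hz).mul_left ((1 - (w : ℂ)) ^ (-a))
  have s4 := hasSum_gaussCoeff hc a (c - b) (z := (w : ℂ)) (by rw [hn]; linarith)
  have e : ∀ n, ∑ k ∈ Finset.range (n + 1), f k (n - k) = gaussCoeff a (c - b) c n * (w : ℂ) ^ n := by
    intro n
    have hn0 : (n.factorial : ℂ) ≠ 0 := by exact_mod_cast n.factorial_ne_zero
    have : ∀ k ∈ Finset.range (n + 1), f k (n - k) = poch a n / n.factorial * (w : ℂ) ^ n *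
        ((-1) ^ k * (n.choose k : ℂ) * (poch b k / poch c k)) := by
      intro k hk
      have hk : k ≤ n := Nat.lt_succ_iff.1 (Finset.mem_range.1 hk)
      have h1 : poch a n = poch a k * poch (a + k) (n - k) := by
        rw [← poch_add, Nat.add_sub_cancel' hk]
      have h2 : (w : ℂ) ^ n = w ^ k * w ^ (n - k) := by rw [← pow_add, Nat.add_sub_cancel' hk]
      have k0 : (k.factorial : ℂ) ≠ 0 := by exact_mod_cast k.factorial_ne_zero
      have k1 : ((n - k).factorial : ℂ) ≠ 0 := by exact_mod_cast (n - k).factorial_ne_zero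
      have k2 := hc.poch_ne_zero k
      simp only [hf, gaussCoeff]
      rw [choose_eq_div hk, h1, h2, neg_pow]
      field_simp
    rw [Finset.sum_congr rfl this, ← Finset.mul_sum, chu_vandermonde n hc, gaussCoeff]
    have := hc.poch_ne_zero n
    field_simp
  have s5 := (s3.unique s1).trans (s2.unique (s4.congr_fun e))
  rw [← s5, ← mul_assoc, ← Complex.cpow_add _ _ hw]
  simp

/-- The Jacobi function as a power series in `1 - x`. -/
lemma jacobiFun_eq {p : ℂ} (hp : NonPole (1 + p)) (q α : ℂ) {x : ℝ} (hx : x ∈ Ioo (0 : ℝ) 1) :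
    jacobiFun p q α x = (x : ℂ) ^ ((1 + p + q) / 2 + α) *
      ₂F₁ ((1 + p + q) / 2 + α) ((1 + p - q) / 2 + α) (1 + p) (1 - x : ℂ) := by
  obtain ⟨h0, h1⟩ := hx
  have hx0 : (x : ℂ) ≠ 0 := by exact_mod_cast h0.ne'
  have e2 : (1 + p) - ((1 + p + q) / 2 - α) = (1 + p - q) / 2 + α := by ring
  rw [jacobiFun, gaussF]
  split_ifs with h
  -- This branch is `x > 1/2`, where `pfaff` applies with `w = 1 - x`. In the other branch the
  -- definition of `gaussF` already is the transformed formula.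
  · have hz : ((x : ℂ) - 1) / x = ((((x - 1) / x : ℝ)) : ℂ) := by push_cast; rfl
    have hlt : 1 - x < 1 / 2 := by
      rw [hz, Complex.norm_real, Real.norm_eq_abs, abs_div, abs_of_pos h0, abs_of_neg (by linarith),
        div_lt_one h0] at h
      linarith
    have := pfaff hp ((1 + p + q) / 2 + α) ((1 + p + q) / 2 - α) (w := 1 - x) (by linarith) hlt
    rw [e2] at this
    push_cast at this
    rw [sub_sub_cancel, neg_sub] at this
    exact this
  · have e1 : 1 - ((x : ℂ) - 1) / x = (x : ℂ)⁻¹ := by field_simp; ring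
    have e3 : ((x : ℂ) - 1) / x / (((x : ℂ) - 1) / x - 1) = 1 - x := by
      have : ((x : ℂ) - 1) / x - 1 = -(x : ℂ)⁻¹ := by field_simp; ring
      rw [this]; field_simp; ring
    rw [e1, e2, e3, Complex.inv_cpow _ _ (by
      rw [Complex.arg_ofReal_of_nonneg h0.le]; exact Real.pi_pos.ne), Complex.cpow_neg, inv_inv]

/-! ### Beta-type integrals of the Gauss function -/

/-- Besides the termwise integral this supplies integrability of the sum, from `‖f‖ ≤ ∑ ‖F i‖` and
Tonelli. -/
lemma integrable_of_hasSum {Ω : Type*} [MeasurableSpace Ω] {μ : Measure Ω} {F : ℕ → Ω → ℂ} {f : Ω → ℂ}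
    (hF : ∀ i, Integrable (F i) μ) (hsum : Summable fun i => ∫ x, ‖F i x‖ ∂μ)
    (hn : ∀ᵐ x ∂μ, Summable fun i => ‖F i x‖) (hf : ∀ᵐ x ∂μ, HasSum (fun i => F i x) (f x)) :
    Integrable f μ ∧ HasSum (fun i => ∫ x, F i x ∂μ) (∫ x, f x ∂μ) := by
  constructor
  · refine ⟨aestronglyMeasurable_of_tendsto_ae (u := atTop)
      (f := fun n x => ∑ i ∈ Finset.range n, F i x)
      (fun n => Finset.aestronglyMeasurable_fun_sum _ fun i _ => (hF i).1) ?_, ?_⟩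
    · filter_upwards [hf] with x hx using hx.tendsto_sum_nat
    · have h1 : ∀ᵐ x ∂μ, ‖f x‖ₑ ≤ ∑' i, ‖F i x‖ₑ := by
        filter_upwards [hf, hn] with x hx hx'
        have h2 : ‖f x‖ ≤ ∑' i, ‖F i x‖ := by
          rw [← hx.tsum_eq]; exact norm_tsum_le_tsum_norm hx'
        rw [← ofReal_norm]
        refine (ENNReal.ofReal_le_ofReal h2).trans_eq ?_
        rw [ENNReal.ofReal_tsum_of_nonneg (fun _ => norm_nonneg _) hx']
        simp only [ofReal_norm]
      refine (lintegral_mono_ae h1).trans_lt ?_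
      rw [lintegral_tsum fun i => (hF i).1.enorm]
      have h2 : ∀ i, ∫⁻ x, ‖F i x‖ₑ ∂μ = ENNReal.ofReal (∫ x, ‖F i x‖ ∂μ) := by
        intro i
        rw [ofReal_integral_norm_eq_lintegral_enorm (hF i)]
      simp only [h2]
      rw [← ENNReal.ofReal_tsum_of_nonneg (fun i => integral_nonneg fun _ => norm_nonneg _) hsum]
      exact ENNReal.ofReal_lt_top
  · have := hasSum_integral_of_summable_integral_norm hF hsum
    convert! this using 1
    refine integral_congr_ae ?_
    filter_upwards [hf] with x hx using hx.tsum_eq.symm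

lemma norm_ofReal_cpow {x : ℝ} (hx : 0 < x) (z : ℂ) : ‖(x : ℂ) ^ z‖ = x ^ z.re := by
  rw [Complex.norm_cpow_eq_rpow_re_of_pos hx]

lemma norm_one_sub_cpow {x : ℝ} (hx : x < 1) (z : ℂ) : ‖(1 - (x : ℂ)) ^ z‖ = (1 - x) ^ z.re := by
  rw [← norm_ofReal_cpow (sub_pos.2 hx)]; push_cast; rfl

lemma one_sub_ne_zero {x : ℝ} (hx : x < 1) : (1 - (x : ℂ)) ≠ 0 := by
  rw [← Complex.ofReal_one, ← Complex.ofReal_sub]; exact_mod_cast (sub_pos.2 hx).ne'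

/-- The integrand of the Beta function. -/
def betaFun (a s : ℂ) (x : ℝ) : ℂ := (x : ℂ) ^ (a - 1) * (1 - (x : ℂ)) ^ (s - 1)

lemma integrableOn_betaFun {a s : ℂ} (ha : 0 < a.re) (hs : 0 < s.re) :
    IntegrableOn (betaFun a s) (Ioo 0 1) :=
  (intervalIntegrable_iff_integrableOn_Ioo_of_le zero_le_one).1 (Complex.betaIntegral_convergent ha hs)

lemma integral_betaFun {a s : ℂ} (ha : 0 < a.re) (hs : 0 < s.re) :
    ∫ x in Ioo (0 : ℝ) 1, betaFun a s x =
      Complex.Gamma a * Complex.Gamma s * (Complex.Gamma (s + a))⁻¹ := by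
  rw [← integral_Ioc_eq_integral_Ioo, ← intervalIntegral.integral_of_le zero_le_one, add_comm s,
    ← div_eq_mul_inv, ← Complex.betaIntegral_eq_Gamma_mul_div a s ha hs]
  rfl

lemma norm_betaFun {x : ℝ} (hx : x ∈ Ioo (0 : ℝ) 1) (a s : ℂ) :
    ‖betaFun a s x‖ = x ^ (a.re - 1) * (1 - x) ^ (s.re - 1) := by
  rw [betaFun, norm_mul, norm_ofReal_cpow hx.1, norm_one_sub_cpow hx.2]; simp

lemma integral_norm_betaFun {a s : ℂ} (ha : 0 < a.re) (hs : 0 < s.re) :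
    ∫ x in Ioo (0 : ℝ) 1, ‖betaFun a s x‖ = ‖Complex.Gamma a.re * Complex.Gamma s.re *
      (Complex.Gamma (s.re + a.re))⁻¹‖ := by
  rw [← integral_betaFun (a := (a.re : ℂ)) (s := (s.re : ℂ)) (by simpa) (by simpa)]
  have h : ∀ x ∈ Ioo (0 : ℝ) 1, betaFun (a.re : ℂ) (s.re : ℂ) x = ((‖betaFun a s x‖ : ℝ) : ℂ) := by
    intro x hx
    have hx1 : (0 : ℝ) ≤ 1 - x := by linarith [hx.2]
    rw [norm_betaFun hx, betaFun]
    push_cast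
    rw [Complex.ofReal_cpow hx.1.le, Complex.ofReal_cpow hx1]
    push_cast; rfl
  rw [setIntegral_congr_fun measurableSet_Ioo h, integral_complex_ofReal, Complex.norm_real,
    Real.norm_of_nonneg (integral_nonneg fun _ => norm_nonneg _)]

lemma betaFun_add_nat {x : ℝ} (hx : x < 1) (a s : ℂ) (m : ℕ) :
    betaFun a (s + m) x = betaFun a s x * (1 - (x : ℂ)) ^ m := by
  rw [betaFun, betaFun, add_sub_right_comm, Complex.cpow_add _ _ (one_sub_ne_zero hx),
    Complex.cpow_natCast]
  ring

/-- The Beta integral of a Gauss function. -/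
lemma integral_betaFun_mul_gauss {A₁ A₂ P a s : ℂ} (hP : NonPole P) (ha : 0 < a.re) (hs : 0 < s.re)
    (hb : 0 < (P + a - A₁ - A₂).re) :
    IntegrableOn (fun x : ℝ => betaFun a s x * ₂F₁ A₁ A₂ P (1 - x : ℂ)) (Ioo 0 1) ∧
    ∫ x in Ioo (0 : ℝ) 1, betaFun a s x * ₂F₁ A₁ A₂ P (1 - x : ℂ) =
      Complex.Gamma P * Complex.Gamma a * Complex.Gamma s * hSum A₁ A₂ s P (s + a) := by
  have hsm : ∀ m : ℕ, 0 < (s + m).re := fun m => by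
    have : (0 : ℝ) ≤ m := by positivity
    simp; linarith
  set F : ℕ → ℝ → ℂ := fun m x => gaussCoeff A₁ A₂ P m * betaFun a (s + m) x with hF
  have hint : ∀ m, IntegrableOn (F m) (Ioo 0 1) := fun m =>
    (integrableOn_betaFun ha (hsm m)).const_mul _
  have hnorm : ∀ x ∈ Ioo (0 : ℝ) 1, ‖(1 - (x : ℂ))‖ < 1 := by
    intro x hx
    rw [← Complex.ofReal_one, ← Complex.ofReal_sub, Complex.norm_real,
      Real.norm_of_nonneg (by linarith [hx.2])]
    linarith [hx.1]
  have hpt : ∀ x ∈ Ioo (0 : ℝ) 1, HasSum (fun m => F m x)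
      (betaFun a s x * ₂F₁ A₁ A₂ P (1 - x : ℂ)) := by
    intro x hx
    refine ((hasSum_gaussCoeff hP A₁ A₂ (hnorm x hx)).mul_left (betaFun a s x)).congr_fun fun m => ?_
    simp only [hF]
    rw [betaFun_add_nat hx.2]; ring
  have hptn : ∀ x ∈ Ioo (0 : ℝ) 1, Summable fun m => ‖F m x‖ := fun x hx => (hpt x hx).summable.norm
  have hsum : Summable fun m => ∫ x in Ioo (0 : ℝ) 1, ‖F m x‖ := by
    obtain ⟨C, hC0, hC⟩ := exists_norm_gaussCoeff_le hP A₁ A₂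
    -- This choice of parameters makes the term equal to `(Re s)_m / Γ(Re s + Re a + m)`, so the
    -- general bound gives the decay `m^(-Re a)` of the Beta integrals.
    obtain ⟨C', hC0', hC'⟩ := exists_norm_hTerm_le' (s.re : ℂ) 1 1 (s.re + a.re : ℂ) 1
    have hb' : 0 < (P + a - A₁ - A₂).re := hb
    refine Summable.of_nonneg_of_le (fun m => integral_nonneg fun _ => norm_nonneg _) (fun m => ?_)
      ((summable_add_one_rpow hb').mul_left
        (C * (C' * ‖Complex.Gamma a.re‖ * ‖Complex.Gamma s.re‖)))
    have hm : (0 : ℝ) < m + 1 := by positivity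
    have e1 : ∫ x in Ioo (0 : ℝ) 1, ‖F m x‖ = ‖gaussCoeff A₁ A₂ P m‖ *
        ‖Complex.Gamma a.re * Complex.Gamma (s + m).re * (Complex.Gamma ((s + m).re + a.re))⁻¹‖ := by
      simp only [hF, norm_mul]
      rw [integral_const_mul, integral_norm_betaFun ha (hsm m)]
      simp only [norm_mul]
    have hsr : NonPole (s.re : ℂ) := nonPole_of_re_pos (by simpa)
    have e2 : Complex.Gamma a.re * Complex.Gamma (s + m).re * (Complex.Gamma ((s + m).re + a.re))⁻¹ =
        Complex.Gamma a.re * Complex.Gamma s.re * hTerm (s.re : ℂ) 1 1 (s.re + a.re : ℂ) 1 m := by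
      have h : Complex.Gamma (1 + m) = m.factorial := by rw [add_comm, Complex.Gamma_nat_eq_factorial]
      have hk : (m.factorial : ℂ) ≠ 0 := by exact_mod_cast m.factorial_ne_zero
      rw [hTerm, h, poch_one_left]
      push_cast [Complex.add_re, Complex.natCast_re]
      rw [hsr.gamma_add_nat, add_right_comm]
      field_simp
    rw [e1, e2]
    have e3 : ((m : ℝ) + 1) ^ (-(P + a - A₁ - A₂).re - 1) =
        ((m : ℝ) + 1) ^ ((A₁ + A₂ - P).re - 1) *
        ((m : ℝ) + 1) ^ (-((s.re + a.re : ℂ) + 1 - s.re - 1 - 1).re - 1) := by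
      rw [← Real.rpow_add hm]; congr 1; simp; ring
    rw [e3, norm_mul, norm_mul]
    calc _ ≤ (C * ((m : ℝ) + 1) ^ ((A₁ + A₂ - P).re - 1)) *
          (‖Complex.Gamma a.re‖ * ‖Complex.Gamma s.re‖ *
          (C' * ((m : ℝ) + 1) ^ (-((s.re + a.re : ℂ) + 1 - s.re - 1 - 1).re - 1))) := by
            have := hC m
            have := hC' m
            gcongr
      _ = _ := by ring
  have key := integrable_of_hasSum hint hsum
    (ae_restrict_of_forall_mem measurableSet_Ioo hptn) (ae_restrict_of_forall_mem measurableSet_Ioo hpt)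
  refine ⟨key.1, key.2.unique ?_⟩
  have hs0 : 0 < (P + (s + a) - A₁ - A₂ - s).re := by
    have e : P + (s + a) - A₁ - A₂ - s = P + a - A₁ - A₂ := by ring
    rwa [e]
  refine ((summable_hTerm hs0).hasSum.mul_left
    (Complex.Gamma P * Complex.Gamma a * Complex.Gamma s)).congr_fun fun m => ?_
  simp only [hF]
  rw [integral_const_mul, integral_betaFun ha (hsm m), gaussCoeff, hTerm, hP.gamma_add_nat,
    (nonPole_of_re_pos hs).gamma_add_nat, add_right_comm s]
  have h1 := hP.gamma_ne_zero
  have h2 := hP.poch_ne_zero m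
  field_simp

/-! ### Thomae's transformation -/

/-- Evaluate one integral in two ways: expand the Gauss function in powers of `1 - x`, or expand
`(1-x)^(-c)`, `c = P - s`, in powers of `x` and sum each term by Gauss's theorem. -/
lemma thomae_of_norm_lt {A₁ A₂ a b s : ℂ} (ha : 0 < a.re) (hb : 0 < b.re) (hs : 0 < s.re)
    (h : ‖A₁ + A₂ + b - a - s‖ < (A₁ + A₂ + b - a).re) :
    Complex.Gamma s * hSum A₁ A₂ s (A₁ + A₂ + b - a) (s + a) =
      Complex.Gamma b * hSum a b (A₁ + A₂ + b - a - s) (A₁ + b) (A₂ + b) := by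
  set P := A₁ + A₂ + b - a with hPdef
  set c := P - s with hc
  have hPre : 0 < P.re := (norm_nonneg _).trans_lt h
  have hP := nonPole_of_re_pos hPre
  have hb1 : P + a - A₁ - A₂ = b := by rw [hPdef]; ring
  -- Replacing the binomial coefficients by their majorants `(‖c‖)_k / k!` sums to `(1-x)^(-‖c‖)`;
  -- positivity here makes this dominating function integrable at `x = 1`.
  have hs' : 0 < (P - ‖c‖ : ℂ).re := by simpa using h
  have h1 := integral_betaFun_mul_gauss (A₁ := A₁) (A₂ := A₂) hP ha hs (by rwa [hb1])
  have hd := (integral_betaFun_mul_gauss (A₁ := A₁) (A₂ := A₂) hP ha hs' (by rwa [hb1])).1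
  have hak : ∀ k : ℕ, 0 < (a + k).re := fun k => by
    have : (0 : ℝ) ≤ k := by positivity
    simp; linarith
  have hbk : ∀ k : ℕ, 0 < (b + k).re := fun k => by
    have : (0 : ℝ) ≤ k := by positivity
    simp; linarith
  have hb2 : ∀ k : ℕ, P + (a + k) - A₁ - A₂ = b + k := fun k => by rw [hPdef]; ring
  have hk := fun k : ℕ => integral_betaFun_mul_gauss (A₁ := A₁) (A₂ := A₂) hP (hak k) hPre
    (by rw [hb2]; exact hbk k)
  have e0 : ∀ k : ℕ, ∀ x ∈ Ioo (0 : ℝ) 1, betaFun (a + k) P x = betaFun a P x * (x : ℂ) ^ k := by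
    intro k x hx
    have hx0 : (x : ℂ) ≠ 0 := by exact_mod_cast hx.1.ne'
    rw [betaFun, betaFun, add_sub_right_comm, Complex.cpow_add _ _ hx0, Complex.cpow_natCast]
    ring
  have key : HasSum (fun k : ℕ => ∫ x in Ioo (0 : ℝ) 1, poch c k / k.factorial *
      (betaFun (a + k) P x * ₂F₁ A₁ A₂ P (1 - x : ℂ)))
      (∫ x in Ioo (0 : ℝ) 1, betaFun a s x * ₂F₁ A₁ A₂ P (1 - x : ℂ)) := by
    have hbs : ∀ x ∈ Ioo (0 : ℝ) 1, HasSum (fun k : ℕ => pochR ‖c‖ k / k.factorial * x ^ k *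
        ‖betaFun a P x * ₂F₁ A₁ A₂ P (1 - x : ℂ)‖)
        ‖betaFun a (P - ‖c‖) x * ₂F₁ A₁ A₂ P (1 - x : ℂ)‖ := by
      intro x hx
      refine ((hasSum_binomial_real ‖c‖ hx.1.le hx.2).mul_right _).congr_val ?_
      rw [norm_mul, norm_mul, norm_betaFun hx, norm_betaFun hx, ← mul_assoc, mul_left_comm,
        ← Real.rpow_add (by linarith [hx.2])]
      congr 3; simp; ring
    refine hasSum_integral_of_dominated_convergence
      (fun k x => pochR ‖c‖ k / k.factorial * x ^ k * ‖betaFun a P x * ₂F₁ A₁ A₂ P (1 - x : ℂ)‖)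
      (fun k => ((hk k).1.const_mul _).1) (fun k => ?_) ?_ ?_ ?_
    · refine ae_restrict_of_forall_mem measurableSet_Ioo fun x hx => ?_
      rw [e0 k x hx]
      simp only [norm_mul, norm_div, norm_pow, Complex.norm_natCast, Complex.norm_real,
        Real.norm_of_nonneg hx.1.le]
      have := norm_poch_le_pochR (le_refl ‖c‖) k
      have h2 : 0 ≤ x := hx.1.le
      calc _ = ‖poch c k‖ / k.factorial * x ^ k * (‖betaFun a P x‖ * ‖₂F₁ A₁ A₂ P (1 - x : ℂ)‖) := by
            ring
        _ ≤ _ := by gcongr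
    · exact ae_restrict_of_forall_mem measurableSet_Ioo fun x hx => (hbs x hx).summable
    · refine hd.norm.congr ?_
      exact ae_restrict_of_forall_mem measurableSet_Ioo fun x hx => (hbs x hx).tsum_eq.symm
    · refine ae_restrict_of_forall_mem measurableSet_Ioo fun x hx => ?_
      have hx1 : ‖(x : ℂ)‖ < 1 := by simpa [abs_of_pos hx.1] using hx.2
      refine HasSum.congr_fun (HasSum.congr_val ((hasSum_binomial c hx1).mul_right
        (betaFun a P x * ₂F₁ A₁ A₂ P (1 - x : ℂ))) ?_) fun k => ?_
      · rw [betaFun, betaFun, ← mul_assoc, mul_left_comm, ← Complex.cpow_add _ _ (one_sub_ne_zero hx.2),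
          hc]
        congr 3; ring
      · rw [e0 k x hx]; ring
  rw [h1.2] at key
  have hs2 : 0 < (A₁ + b + (A₂ + b) - a - b - c).re := by
    have e : A₁ + b + (A₂ + b) - a - b - c = s := by rw [hc, hPdef]; ring
    rwa [e]
  have key2 := (summable_hTerm hs2).hasSum.mul_left
    (Complex.Gamma P * Complex.Gamma a * Complex.Gamma b)
  have e3 := key.unique (key2.congr_fun fun k => by
    have g : 0 < (P + (a + k) - A₁ - A₂).re := by rw [hb2]; exact hbk k
    have g2 : 0 < (P + (a + k) - A₁ - A₂).re := g
    rw [integral_const_mul, (hk k).2]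
    -- The exponent `P - 1` was chosen so that an upper and a lower parameter both equal `P` and
    -- cancel, leaving a Gauss series.
    have hg : hSum A₁ A₂ P P (P + (a + k)) = (Complex.Gamma P)⁻¹ * hSum A₁ A₂ 1 (P + (a + k)) 1 := by
      rw [hSum, hSum, ← tsum_mul_left]
      refine tsum_congr fun m => ?_
      rw [hTerm_one_one, hTerm, rgamma_eq_poch_mul P m]; ring
    have e1 : P + (a + k) - A₁ = A₂ + b + k := by rw [hPdef]; ring
    have e2 : P + (a + k) - A₂ = A₁ + b + k := by rw [hPdef]; ring
    rw [hg, hSum_gauss g, hb2, e1, e2, (nonPole_of_re_pos ha).gamma_add_nat,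
      (nonPole_of_re_pos hb).gamma_add_nat, hTerm]
    have := hP.gamma_ne_zero
    field_simp)
  have h3 := hP.gamma_ne_zero
  have h4 := (nonPole_of_re_pos ha).gamma_ne_zero
  apply mul_left_cancel₀ (mul_ne_zero h3 h4)
  rw [← mul_assoc, e3, ← mul_assoc]
  rfl

/-- **Thomae's transformation** of the `₃F₂(1)` series. -/
theorem thomae (A₁ A₂ : ℂ) {a b s : ℂ} (ha : 0 < a.re) (hb : 0 < b.re) (hs : 0 < s.re) :
    Complex.Gamma s * hSum A₁ A₂ s (A₁ + A₂ + b - a) (s + a) =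
      Complex.Gamma b * hSum a b (A₁ + A₂ + b - a - s) (A₁ + b) (A₂ + b) := by
  -- Shifting `A₁` and `A₂` together keeps `a`, `b`, `s` fixed, so the excesses `b` and `s` of the
  -- two sides do not move and both sides are entire in `t`.
  set f : ℂ → ℂ := fun t => Complex.Gamma s * hSum (A₁ + t) (A₂ + t) s
    ((A₁ + t) + (A₂ + t) + b - a) (s + a) with hf
  set g : ℂ → ℂ := fun t => Complex.Gamma b * hSum a b ((A₁ + t) + (A₂ + t) + b - a - s)
    ((A₁ + t) + b) ((A₂ + t) + b) with hg
  have hfa : AnalyticOnNhd ℂ f univ := fun t _ => by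
    refine analyticAt_const.mul (analyticAt_hSum (by fun_prop) (by fun_prop) (by fun_prop)
      (by fun_prop) (by fun_prop) ?_)
    have e : ((A₁ + t) + (A₂ + t) + b - a) + (s + a) - (A₁ + t) - (A₂ + t) - s = b := by ring
    rwa [e]
  have hga : AnalyticOnNhd ℂ g univ := fun t _ => by
    refine analyticAt_const.mul (analyticAt_hSum (by fun_prop) (by fun_prop) (by fun_prop)
      (by fun_prop) (by fun_prop) ?_)
    have e : ((A₁ + t) + b) + ((A₂ + t) + b) - a - b - ((A₁ + t) + (A₂ + t) + b - a - s) = s := by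
      ring
    rwa [e]
  set w := A₁ + A₂ + b - a with hw
  -- With `R = Re (w + 2t)`, squaring reduces the inequality to `Im(w - s)² / Re s < 2R - Re s`,
  -- true for large `t` since `Re s > 0`.
  obtain ⟨t₀, ht₀⟩ : ∃ t : ℝ, ‖w + 2 * t - s‖ < (w + 2 * t).re := by
    obtain ⟨N, hN⟩ := exists_nat_gt (|w.re| + |s.re| + (w - s).im ^ 2 / s.re)
    refine ⟨N, ?_⟩
    have hpos : 0 < (w + 2 * (N : ℝ)).re := by
      have h1 := neg_abs_le w.re
      have h2 : 0 ≤ (w - s).im ^ 2 / s.re := by positivity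
      have h3 := abs_nonneg s.re
      have h4 := abs_nonneg w.re
      simp; linarith
    apply lt_of_pow_lt_pow_left₀ 2 hpos.le
    rw [Complex.sq_norm, Complex.normSq_apply]
    have h5 : (w - s).im ^ 2 / s.re < 2 * N + w.re + (w.re - s.re) + 2 * N := by
      have h1 := neg_abs_le w.re
      have h2 : 0 ≤ (w - s).im ^ 2 / s.re := by positivity
      have h3 := le_abs_self s.re
      have h4 := abs_nonneg w.re
      have h6 := abs_nonneg s.re
      linarith
    rw [div_lt_iff₀ hs] at h5
    simp at h5 ⊢
    nlinarith
  have heq : f =ᶠ[𝓝 (t₀ : ℂ)] g := by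
    have hcont : Continuous fun t : ℂ => (w + 2 * t).re - ‖w + 2 * t - s‖ := by
      have := Complex.continuous_re
      fun_prop
    filter_upwards [hcont.continuousAt.eventually_const_lt (sub_pos.2 ht₀)] with t ht
    have e : (A₁ + t) + (A₂ + t) + b - a = w + 2 * t := by rw [hw]; ring
    exact thomae_of_norm_lt ha hb hs (by rw [e]; linarith)
  have := congr_fun (hfa.eq_of_eventuallyEq hga heq) 0
  simpa [hf, hg] using this

/-! ### The Jacobi transform of a power law -/

/-- The Jacobi transform of a double power law, continued in its parameters. -/
def jacobiTransform (p q α l₁ l₂ : ℂ) : ℂ :=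
  Complex.Gamma (1 + p) *
    (Complex.Gamma (l₁ - (1 + p + q) / 2 + α) * Complex.Gamma (l₁ - (1 + p + q) / 2 - α)) *
    hFull (l₁ - (1 + p + q) / 2 + α) (l₁ - (1 + p + q) / 2 - α) l₂ l₁ (l₁ - q)

lemma ofReal_ne_zero_of_pos {x : ℝ} (hx : 0 < x) : (x : ℂ) ≠ 0 := by exact_mod_cast hx.ne'

lemma jacobiIntegrand_eq {p : ℂ} (hp : NonPole (1 + p)) (q α l₁ l₂ : ℂ) {x : ℝ}
    (hx : x ∈ Ioo (0 : ℝ) 1) :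
    jacobiIntegrand p q α l₁ l₂ x = betaFun (l₁ - (1 + p + q) / 2 + α) (1 + p - l₂) x *
      ₂F₁ ((1 + p + q) / 2 + α) ((1 + p - q) / 2 + α) (1 + p) (1 - x : ℂ) := by
  have h0 := ofReal_ne_zero_of_pos hx.1
  have h1 := one_sub_ne_zero hx.2
  rw [jacobiIntegrand, jacobiFun_eq hp q α hx, jacobiWeight, powerLaw, betaFun, ← mul_assoc]
  congr 1
  simp only [Complex.cpow_def_of_ne_zero h0, Complex.cpow_def_of_ne_zero h1, div_eq_mul_inv,
    ← Complex.exp_neg, ← Complex.exp_add]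
  congr 1; ring

/-- In Thomae's formula `P - s = l₂`, `A₁ + b = l₁` and `A₂ + b = l₁ - q`: these are the parameters
of the closed form, with excess `s = 1 + p - l₂`. -/
lemma integral_jacobiIntegrand {p q α l₁ l₂ : ℂ} (hp : NonPole (1 + p))
    (h : ConvergesAtZero p q α l₁) (hs : 0 < (1 + p - l₂).re) :
    IntegrableOn (jacobiIntegrand p q α l₁ l₂) (Ioo 0 1) ∧
    ∫ x in Ioo (0 : ℝ) 1, jacobiIntegrand p q α l₁ l₂ x = jacobiTransform p q α l₁ l₂ := by
  obtain ⟨ha, hb⟩ := h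
  have e1 : 1 + p + (l₁ - (1 + p + q) / 2 + α) - ((1 + p + q) / 2 + α) - ((1 + p - q) / 2 + α) =
      l₁ - (1 + p + q) / 2 - α := by ring
  have key := integral_betaFun_mul_gauss (A₁ := (1 + p + q) / 2 + α) (A₂ := (1 + p - q) / 2 + α)
    hp ha hs (by rwa [e1])
  have hth := thomae ((1 + p + q) / 2 + α) ((1 + p - q) / 2 + α) ha hb hs
  have e2 : (1 + p + q) / 2 + α + ((1 + p - q) / 2 + α) + (l₁ - (1 + p + q) / 2 - α) -
      (l₁ - (1 + p + q) / 2 + α) = 1 + p := by ring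
  have e3 : (1 + p + q) / 2 + α + (l₁ - (1 + p + q) / 2 - α) = l₁ := by ring
  have e4 : (1 + p - q) / 2 + α + (l₁ - (1 + p + q) / 2 - α) = l₁ - q := by ring
  rw [e2, e3, e4, sub_sub_cancel] at hth
  have hfull : hFull (l₁ - (1 + p + q) / 2 + α) (l₁ - (1 + p + q) / 2 - α) l₂ l₁ (l₁ - q) =
      hSum (l₁ - (1 + p + q) / 2 + α) (l₁ - (1 + p + q) / 2 - α) l₂ l₁ (l₁ - q) := by
    apply hFull_eq_hSum
    have e : l₁ + (l₁ - q) - (l₁ - (1 + p + q) / 2 + α) - (l₁ - (1 + p + q) / 2 - α) - l₂ =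
      1 + p - l₂ := by ring
    rwa [e]
  refine ⟨key.1.congr_fun (fun x hx => (jacobiIntegrand_eq hp q α l₁ l₂ hx).symm) measurableSet_Ioo, ?_⟩
  rw [setIntegral_congr_fun measurableSet_Ioo fun x hx => jacobiIntegrand_eq hp q α l₁ l₂ hx, key.2,
    jacobiTransform, hfull, mul_assoc, hth]
  ring

/-! ### Necessity of the convergence condition at `x = 1`, and the closed formula. -/

lemma continuousAt_gauss_zero {c : ℂ} (hc : NonPole c) (a b : ℂ) : ContinuousAt (₂F₁ a b c) (0 : ℂ) := by
  have h : ContinuousOn (fun z : ℂ => ∑' k, gaussCoeff a b c k * z ^ k) (Metric.closedBall 0 (1 / 2)) := by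
    refine continuousOn_tsum (fun k => by fun_prop)
      (summable_norm_gaussCoeff_mul_pow hc a b (r := 1 / 2) (by norm_num) (by norm_num)) ?_
    intro k z hz
    rw [norm_mul, norm_pow]
    gcongr
    simpa using hz
  have e : (₂F₁ a b c : ℂ → ℂ) = fun z : ℂ => ∑' k, gaussCoeff a b c k * z ^ k :=
    funext (ordinaryHypergeometric_eq_tsum_gaussCoeff a b c)
  rw [e]
  exact h.continuousAt (Metric.closedBall_mem_nhds _ (by norm_num))

/-- Near `x = 1` the Gauss function tends to `1` and the power of `x` is bounded below, so
integrability forces that of `y^(Re s - 1)` at `y = 1 - x = 0`. -/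
lemma re_pos_of_integrableOn_betaFun_mul_gauss {A₁ A₂ P a s : ℂ} (hP : NonPole P)
    (h : IntegrableOn (fun x : ℝ => betaFun a s x * ₂F₁ A₁ A₂ P (1 - x : ℂ)) (Ioo 0 1)) :
    0 < s.re := by
  have hlim : Tendsto (fun y : ℝ => ‖₂F₁ A₁ A₂ P (y : ℂ)‖) (𝓝 0) (𝓝 1) := by
    have := ((continuousAt_gauss_zero hP A₁ A₂).comp_of_eq (x := (0 : ℝ))
      (f := fun y : ℝ => (y : ℂ)) Complex.continuous_ofReal.continuousAt (by simp)).norm.tendsto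
    simpa [Function.comp_def] using this
  obtain ⟨δ, hδ0, hδ⟩ := Metric.eventually_nhds_iff.1
    (hlim.eventually_const_lt (show (1 / 2 : ℝ) < 1 by norm_num))
  set η := min δ (1 / 2) with hη
  have hη0 : 0 < η := by positivity
  have hη1 : η ≤ 1 / 2 := min_le_right _ _
  have h1 : IntegrableOn (fun x : ℝ => ‖betaFun a s x * ₂F₁ A₁ A₂ P (1 - x : ℂ)‖) (Ioo (1 - η) 1) :=
    (h.mono_set (Ioo_subset_Ioo (by linarith) le_rfl)).norm
  have h2 : IntervalIntegrable (fun x : ℝ => ‖betaFun a s x * ₂F₁ A₁ A₂ P (1 - x : ℂ)‖) volume (1 - η) 1 :=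
    (intervalIntegrable_iff_integrableOn_Ioo_of_le (by linarith)).2 h1
  have h3 := (h2.comp_sub_left 1).symm
  simp only [sub_self, sub_sub_cancel] at h3
  have h4 := (intervalIntegrable_iff_integrableOn_Ioo_of_le hη0.le).1 h3
  have h5 : IntegrableOn (fun y : ℝ => y ^ (s.re - 1)) (Ioo 0 η) := by
    -- The factor `2` compensates a Gauss function that is only known to exceed `1/2`; the power of
    -- `2` compensates `(1-y)^(Re a - 1)` for `y < 1/2`.
    refine Integrable.mono' (h4.const_mul (2 * 2 ^ |a.re - 1|)) ?_ ?_
    · refine ContinuousOn.aestronglyMeasurable (fun y hy => ?_) measurableSet_Ioo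
      exact (Real.continuousAt_rpow_const _ _ (Or.inl hy.1.ne')).continuousWithinAt
    · refine ae_restrict_of_forall_mem measurableSet_Ioo fun y hy => ?_
      have hy0 := hy.1
      have hy1 : y < 1 / 2 := hy.2.trans_le hη1
      have hyδ : y < δ := hy.2.trans_le (min_le_left _ _)
      have hg := (hδ (y := y) (by simpa [abs_of_pos hy0] using hyδ)).le
      have e : (1 - ((1 - y : ℝ) : ℂ)) = y := by push_cast; ring
      rw [norm_mul, norm_betaFun ⟨by linarith, by linarith⟩, e, sub_sub_cancel,
        Real.norm_of_nonneg (by positivity)]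
      have hp : 1 ≤ 2 ^ |a.re - 1| * (1 - y) ^ (a.re - 1) := by
        rcases le_total 0 (a.re - 1) with h0 | h0
        · rw [abs_of_nonneg h0, ← Real.mul_rpow (by norm_num) (by linarith)]
          exact Real.one_le_rpow (by linarith) h0
        · refine one_le_mul_of_one_le_of_one_le (Real.one_le_rpow (by norm_num) (abs_nonneg _)) ?_
          exact Real.one_le_rpow_of_pos_of_le_one_of_nonpos (by linarith) (by linarith) h0
      have hq : 0 ≤ y ^ (s.re - 1) := by positivity
      calc y ^ (s.re - 1) = (2 * (1 / 2)) * 1 * y ^ (s.re - 1) := by ring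
        _ ≤ (2 * ‖₂F₁ A₁ A₂ P (y : ℂ)‖) * (2 ^ |a.re - 1| * (1 - y) ^ (a.re - 1)) * y ^ (s.re - 1) := by
            gcongr
        _ = _ := by ring
  have := (intervalIntegral.integrableOn_Ioo_rpow_iff hη0).1 h5
  linarith

lemma integrableOn_jacobiIntegrand_iff {p q α l₁ l₂ : ℂ} (hp : NonPole (1 + p))
    (h : ConvergesAtZero p q α l₁) :
    IntegrableOn (jacobiIntegrand p q α l₁ l₂) (Ioo 0 1) ↔ 0 < (1 + p - l₂).re := by
  refine ⟨fun hi => ?_, fun hs => (integral_jacobiIntegrand hp h hs).1⟩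
  exact re_pos_of_integrableOn_betaFun_mul_gauss hp
    (hi.congr_fun (fun x hx => jacobiIntegrand_eq hp q α l₁ l₂ hx) measurableSet_Ioo)

lemma summable_threeFTwoTerm_and_eq_closedForm {p q α l₁ l₂ : ℂ} (h : Generic p q α l₁ l₂)
    (hs : 0 < (1 + p - l₂).re) :
    Summable (threeFTwoTerm (l₁ - (1 + p + q) / 2 + α) (l₁ - (1 + p + q) / 2 - α) l₂ l₁ (l₁ - q)) ∧
      jacobiTransform p q α l₁ l₂ = closedForm p q α l₁ l₂ := by
  obtain ⟨-, h1, h2, -, -, -⟩ := h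
  have hs' : 0 < (l₁ + (l₁ - q) - (l₁ - (1 + p + q) / 2 + α) - (l₁ - (1 + p + q) / 2 - α) - l₂).re := by
    have e : l₁ + (l₁ - q) - (l₁ - (1 + p + q) / 2 + α) - (l₁ - (1 + p + q) / 2 - α) - l₂ =
      1 + p - l₂ := by ring
    rwa [e]
  constructor
  · exact ((summable_hTerm hs').mul_left _).congr fun k => (hTerm_eq_threeFTwoTerm h1 h2 _ _ _ k).symm
  · rw [jacobiTransform, closedForm, threeFTwoOne_eq_hSum h1 h2, hFull_eq_hSum hs']
    have g1 := h1.gamma_ne_zero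
    have g2 := h2.gamma_ne_zero
    field_simp

/-! ### Holomorphy of the transform and the reflection `q → -q`. -/

lemma analyticAt_gamma {z : ℂ} (h : NonPole z) : AnalyticAt ℂ Complex.Gamma z := by
  rw [Complex.analyticAt_iff_eventually_differentiableAt]
  filter_upwards [eventually_nonPole h] with w hw using Complex.differentiableAt_Gamma w hw

lemma analyticAt_gamma_comp {f : ℂ → ℂ} {z : ℂ} (hf : AnalyticAt ℂ f z) (h : NonPole (f z)) :
    AnalyticAt ℂ (fun w => Complex.Gamma (f w)) z :=
  (analyticAt_gamma h).comp hf

lemma analyticAt_jacobiTransform {p q : ℂ} {α l₁ l₂ : ℂ → ℂ} {z : ℂ} (hα : AnalyticAt ℂ α z)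
    (hl₁ : AnalyticAt ℂ l₁ z) (hl₂ : AnalyticAt ℂ l₂ z) (h : Generic p q (α z) (l₁ z) (l₂ z)) :
    AnalyticAt ℂ (fun w => jacobiTransform p q (α w) (l₁ w) (l₂ w)) z := by
  obtain ⟨-, -, -, h3, h4, h5⟩ := h
  have ha : AnalyticAt ℂ (fun w => l₁ w - (1 + p + q) / 2 + α w) z := by fun_prop
  have hb : AnalyticAt ℂ (fun w => l₁ w - (1 + p + q) / 2 - α w) z := by fun_prop
  refine (analyticAt_const.mul ((analyticAt_gamma_comp ha h3).mul (analyticAt_gamma_comp hb h4))).mul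
    (analyticAt_hFull ha hb hl₂ hl₁ (by fun_prop) ?_)
  convert h5 using 1; ring

/-- The reflection keeps `l₁ - A` and exchanges the lower parameters `l₁` and `l₁ - q`, in which the
series is symmetric. -/
lemma jacobiTransform_neg (p q α l₁ l₂ : ℂ) :
    jacobiTransform p q α l₁ l₂ = jacobiTransform p (-q) α (l₁ - q) l₂ := by
  have e1 : l₁ - q - (1 + p + -q) / 2 = l₁ - (1 + p + q) / 2 := by ring
  have e2 : l₁ - q - -q = l₁ := by ring
  rw [jacobiTransform, jacobiTransform, e1, e2, hFull_swap]

/-! ### Residues -/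

lemma hasResidue_of_eq_div {f h : ℂ → ℂ} {z₀ : ℂ} (hf : ∀ z, f z = h z / (z - z₀))
    (hh : AnalyticAt ℂ h z₀) : HasResidue f z₀ (h z₀) := by
  have hf' : f = fun z => (z - z₀)⁻¹ * h z := by
    ext z; rw [hf, div_eq_inv_mul]
  subst hf'
  constructor
  · have := hh.meromorphicAt
    fun_prop
  · obtain ⟨ε, hε, hd⟩ := Metric.eventually_nhds_iff_ball.1 hh.eventually_analyticAt
    filter_upwards [Ioo_mem_nhdsGT hε] with r hr
    have hdiff : DiffContOnCl ℂ h (Metric.ball z₀ r) := by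
      refine DifferentiableOn.diffContOnCl fun z hz => ?_
      rw [closure_ball _ hr.1.ne'] at hz
      exact (hd z (Metric.closedBall_subset_ball hr.2 hz)).differentiableAt.differentiableWithinAt
    have := hdiff.circleIntegral_sub_inv_smul (Metric.mem_ball_self hr.1)
    simp only [smul_eq_mul] at this
    rw [this, ← mul_assoc, inv_mul_cancel₀ Complex.two_pi_I_ne_zero, one_mul]

/-- Isolates the simple pole of `Γ` at `-n` in the single factor `b + n`. -/
lemma gamma_eq_div (b : ℂ) (n : ℕ) :
    Complex.Gamma b = Complex.Gamma (b + (n + 1 : ℕ)) / (poch b n * (b + n)) := by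
  rw [← poch_succ, ← inv_inj, rgamma_eq_poch_mul b (n + 1), inv_div, div_eq_mul_inv]

lemma hSum_neg_nat (n : ℕ) (b c d e : ℂ) :
    hSum (-(n : ℂ)) b c d e = ∑ k ∈ Finset.range (n + 1), hTerm b (-(n : ℂ)) c d e k := by
  have h : ∀ k, hTerm (-(n : ℂ)) b c d e k = hTerm b (-(n : ℂ)) c d e k := fun k => by
    simp only [hTerm]; ring
  simp only [hSum, h]
  exact tsum_eq_sum fun k hk => hTerm_neg_nat (by simpa using hk) _ _ _ _

lemma hasResidue_jacobiTransform {p q l₁ l₂ : ℂ} (n : ℕ) (hp : NonPole (1 + p)) (h1 : NonPole l₁)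
    (h2 : NonPole (l₁ - q)) (h3 : NonPole (1 + p - l₂)) (h4 : NonPole (2 * l₁ - 1 - p - q + n)) :
    HasResidue (fun α => 2 / jacobiQ p q (-α) * jacobiTransform p q α l₁ l₂)
      (l₁ - (1 + p + q) / 2 + n) (-coeffY p q l₁ l₂ n) := by
  set α₀ := l₁ - (1 + p + q) / 2 + n with hα₀
  -- This is the function with its factor `1/(α - α₀)` removed. Keeping `1/Γ(2α)` as an entire
  -- factor avoids any condition on `2α₀`.
  set h : ℂ → ℂ := fun α => -(Complex.Gamma ((1 + p + q) / 2 + α) *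
    Complex.Gamma ((1 + p - q) / 2 + α) * (Complex.Gamma (2 * α))⁻¹ *
    Complex.Gamma (l₁ - (1 + p + q) / 2 + α) *
    (Complex.Gamma (l₁ - (1 + p + q) / 2 - α + (n + 1 : ℕ)) / poch (l₁ - (1 + p + q) / 2 - α) n) *
    hFull (l₁ - (1 + p + q) / 2 + α) (l₁ - (1 + p + q) / 2 - α) l₂ l₁ (l₁ - q)) with hh
  have eb : l₁ - (1 + p + q) / 2 - α₀ = -(n : ℂ) := by rw [hα₀]; ring
  have ea : l₁ - (1 + p + q) / 2 + α₀ = 2 * l₁ - 1 - p - q + n := by rw [hα₀]; ring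
  have e1 : (1 + p + q) / 2 + α₀ = l₁ + n := by rw [hα₀]; ring
  have e2 : (1 + p - q) / 2 + α₀ = l₁ - q + n := by rw [hα₀]; ring
  have e3 : 2 * α₀ = 2 * l₁ - 1 - p - q + n + n := by rw [hα₀]; ring
  have es : l₁ + (l₁ - q) - (2 * l₁ - 1 - p - q + n) - -(n : ℂ) - l₂ = 1 + p - l₂ := by ring
  have hn : (n.factorial : ℂ) ≠ 0 := by exact_mod_cast n.factorial_ne_zero
  have hpn : poch (-(n : ℂ)) n = (-1) ^ n * n.factorial := by
    have := poch_neg_nat_eq (le_refl n); simpa using this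
  -- Valid for every `α`, even at `α₀`, where both sides are `0` by the conventions for `Γ` at its
  -- poles and for division by zero.
  have hfh : ∀ α, 2 / jacobiQ p q (-α) * jacobiTransform p q α l₁ l₂ = h α / (α - α₀) := by
    intro α
    have hb : l₁ - (1 + p + q) / 2 - α + n = -(α - α₀) := by rw [hα₀]; ring
    have g0 := hp.gamma_ne_zero
    simp only [hh, jacobiQ, jacobiTransform]
    rw [gamma_eq_div (l₁ - (1 + p + q) / 2 - α) n, hb, sub_neg_eq_add, sub_neg_eq_add,
      neg_mul_neg, div_div_eq_mul_div]
    simp only [div_eq_mul_inv, mul_inv, inv_neg]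
    field_simp
  have hha : AnalyticAt ℂ h α₀ := by
    refine AnalyticAt.neg (((((AnalyticAt.mul ?_ ?_).mul ?_).mul ?_).mul (AnalyticAt.div ?_ ?_ ?_)).mul ?_)
    · exact analyticAt_gamma_comp (by fun_prop) (by rw [e1]; exact h1.add_nat n)
    · exact analyticAt_gamma_comp (by fun_prop) (by rw [e2]; exact h2.add_nat n)
    · exact (Complex.differentiable_one_div_Gamma.comp (by fun_prop : Differentiable ℂ
        fun α : ℂ => 2 * α)).analyticAt _
    · exact analyticAt_gamma_comp (by fun_prop) (by rw [ea]; exact h4)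
    · refine analyticAt_gamma_comp (by fun_prop) ?_
      rw [eb]
      apply nonPole_of_re_pos
      simp
    · exact ((differentiable_poch n).comp (by fun_prop : Differentiable ℂ
        fun α : ℂ => l₁ - (1 + p + q) / 2 - α)).analyticAt _
    · rw [eb, hpn]
      exact mul_ne_zero (by simp) hn
    · refine analyticAt_hFull (by fun_prop) (by fun_prop) (by fun_prop) (by fun_prop) (by fun_prop) ?_
      rw [ea, eb, es]; exact h3
  have hval : h α₀ = -coeffY p q l₁ l₂ n := by
    simp only [hh]
    rw [e1, e2, e3, ea, eb, hpn, h1.gamma_add_nat, h2.gamma_add_nat, h4.gamma_add_nat, coeffY,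
      threeFTwoOne_eq_hSum h1 h2, hSum_neg_nat, hFull_neg_nat n (by rw [es]; exact h3)]
    have e6 : -(n : ℂ) + ((n + 1 : ℕ) : ℂ) = 1 := by push_cast; ring
    rw [e6, Complex.Gamma_one]
    have g4 := h4.gamma_ne_zero
    have g5 := h4.poch_ne_zero n
    have g6 : ((-1 : ℂ) ^ n) * (-1) ^ n = 1 := by rw [← mul_pow]; simp
    have g7 : ((-1 : ℂ) ^ n) ≠ 0 := by simp
    generalize 2 * l₁ - 1 - p - q + (n : ℂ) = g at g4 g5 ⊢
    rw [mul_inv]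
    field_simp
    rw [show ((-1 : ℂ) ^ n) ^ 2 = 1 by rw [sq, g6]]
    try ring
  rw [← hval]
  exact hasResidue_of_eq_div hfh hha

/-! ### Bulk, boundary and crosscap transforms -/

lemma bulk_transform {d D₁ D₂ α l₁ l₂ : ℂ} (hp : NonPole (1 + 2 * deltaMinus D₁ D₂))
    (h1 : 0 < (l₁ - d / 4 + α).re) (h2 : 0 < (l₁ - d / 4 - α).re)
    (h3 : 0 < (1 + deltaMinus D₁ D₂ - l₂).re) :
    IntegrableOn (fun ρ : ℝ => weightBulk d ρ * powerLaw l₁ l₂ ρ * waveBulk d D₁ D₂ α ρ) (Ioo 0 1) ∧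
      ∫ ρ in Ioo (0 : ℝ) 1, weightBulk d ρ * powerLaw l₁ l₂ ρ * waveBulk d D₁ D₂ α ρ =
        jacobiTransform (2 * deltaMinus D₁ D₂) (d / 2 - 1) α
          (l₁ + deltaMinus D₁ D₂) (l₂ + deltaMinus D₁ D₂) := by
  set δ := deltaMinus D₁ D₂ with hδ
  have hc : ConvergesAtZero (2 * δ) (d / 2 - 1) α (l₁ + δ) := by
    have e : l₁ + δ - (1 + 2 * δ + (d / 2 - 1)) / 2 = l₁ - d / 4 := by ring
    rw [ConvergesAtZero, e]; exact ⟨h1, h2⟩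
  have key := integral_jacobiIntegrand (l₂ := l₂ + δ) hp hc (by
    have e : 1 + 2 * δ - (l₂ + δ) = 1 + δ - l₂ := by ring
    rwa [e])
  have heq : ∀ x ∈ Ioo (0 : ℝ) 1, jacobiIntegrand (2 * δ) (d / 2 - 1) α (l₁ + δ) (l₂ + δ) x =
      weightBulk d x * powerLaw l₁ l₂ x * waveBulk d D₁ D₂ α x := by
    intro x hx
    have g0 := ofReal_ne_zero_of_pos hx.1
    have g1 := one_sub_ne_zero hx.2
    have g2 : ((1 - (x : ℂ)) / x) ^ δ = (1 - (x : ℂ)) ^ δ / (x : ℂ) ^ δ := by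
      have := Complex.div_cpow_ofReal_nonneg (a := 1 - x) (b := x) (by linarith [hx.2]) hx.1.le δ
      push_cast at this; exact this
    rw [jacobiIntegrand, jacobiWeight, powerLaw, weightBulk, powerLaw, waveBulk, ← hδ, g2, ← mul_assoc]
    congr 1
    simp only [Complex.cpow_def_of_ne_zero g0, Complex.cpow_def_of_ne_zero g1, div_eq_mul_inv, one_mul,
      ← Complex.exp_neg, ← Complex.exp_add]
    congr 1; ring
  exact ⟨key.1.congr_fun heq measurableSet_Ioo, by
    rw [← key.2]; exact setIntegral_congr_fun measurableSet_Ioo fun x hx => (heq x hx).symm⟩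

lemma crosscap_transform {d D₁ D₂ α l₁ l₂ : ℂ} (hp : NonPole (d / 2))
    (h1 : 0 < (l₁ - d / 4 + α).re) (h2 : 0 < (l₁ - d / 4 - α).re) (h3 : 0 < (d / 2 - l₂).re) :
    IntegrableOn (fun η : ℝ => weightProj d η * powerLaw l₁ l₂ η * waveProj d D₁ D₂ α η) (Ioo 0 1) ∧
      ∫ η in Ioo (0 : ℝ) 1, weightProj d η * powerLaw l₁ l₂ η * waveProj d D₁ D₂ α η =
        jacobiTransform (d / 2 - 1) (2 * deltaMinus D₁ D₂) α (l₁ + deltaMinus D₁ D₂) l₂ := by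
  set δ := deltaMinus D₁ D₂ with hδ
  have hc : ConvergesAtZero (d / 2 - 1) (2 * δ) α (l₁ + δ) := by
    have e : l₁ + δ - (1 + (d / 2 - 1) + 2 * δ) / 2 = l₁ - d / 4 := by ring
    rw [ConvergesAtZero, e]; exact ⟨h1, h2⟩
  have e0 : 1 + (d / 2 - 1) = d / 2 := by ring
  have key := integral_jacobiIntegrand (l₂ := l₂) (by rwa [e0]) hc (by rwa [e0])
  have heq : ∀ x ∈ Ioo (0 : ℝ) 1, jacobiIntegrand (d / 2 - 1) (2 * δ) α (l₁ + δ) l₂ x =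
      weightProj d x * powerLaw l₁ l₂ x * waveProj d D₁ D₂ α x := by
    intro x hx
    have g0 := ofReal_ne_zero_of_pos hx.1
    have g1 := one_sub_ne_zero hx.2
    rw [jacobiIntegrand, jacobiWeight, powerLaw, weightProj, powerLaw, waveProj, ← hδ, ← mul_assoc]
    congr 1
    simp only [Complex.cpow_def_of_ne_zero g0, Complex.cpow_def_of_ne_zero g1, div_eq_mul_inv,
      ← Complex.exp_neg, ← Complex.exp_add]
    congr 1; ring
  exact ⟨key.1.congr_fun heq measurableSet_Ioo, by
    rw [← key.2]; exact setIntegral_congr_fun measurableSet_Ioo fun x hx => (heq x hx).symm⟩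

lemma integrableOn_comp_one_sub {f : ℝ → ℂ} (hf : IntegrableOn f (Ioo 0 1)) :
    IntegrableOn (fun x => f (1 - x)) (Ioo 0 1) := by
  rw [← intervalIntegrable_iff_integrableOn_Ioo_of_le zero_le_one] at hf ⊢
  simpa using (hf.comp_sub_left 1).symm

lemma integral_comp_one_sub (f : ℝ → ℂ) :
    ∫ x in Ioo (0 : ℝ) 1, f (1 - x) = ∫ x in Ioo (0 : ℝ) 1, f x := by
  simp only [← integral_Ioc_eq_integral_Ioo, ← intervalIntegral.integral_of_le zero_le_one]
  simp [intervalIntegral.integral_comp_sub_left]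

/-- The reflection `ρ → 1 - ρ` exchanges the two endpoints, which turns `(l₁, l₂)` into `(-l₂,
-l₁)`. -/
lemma boundary_transform {d ν l₁ l₂ : ℂ} (hp : NonPole (d / 2))
    (h1 : 0 < (-l₂ + 1 / 2 - d / 2 + ν).re) (h2 : 0 < (-l₂ + 1 / 2 - d / 2 - ν).re)
    (h3 : 0 < (d / 2 + l₁).re) :
    IntegrableOn (fun ρ : ℝ => weightBdy d ρ * powerLaw l₁ l₂ ρ * waveBdy d ν ρ) (Ioo 0 1) ∧
      ∫ ρ in Ioo (0 : ℝ) 1, weightBdy d ρ * powerLaw l₁ l₂ ρ * waveBdy d ν ρ =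
        jacobiTransform (d / 2 - 1) (d / 2 - 1) ν (-l₂) (-l₁) := by
  have hc : ConvergesAtZero (d / 2 - 1) (d / 2 - 1) ν (-l₂) := by
    have e : -l₂ - (1 + (d / 2 - 1) + (d / 2 - 1)) / 2 = -l₂ + 1 / 2 - d / 2 := by ring
    rw [ConvergesAtZero, e]; exact ⟨h1, h2⟩
  have e0 : 1 + (d / 2 - 1) = d / 2 := by ring
  have key := integral_jacobiIntegrand (l₂ := -l₁) (by rwa [e0]) hc (by rwa [e0, sub_neg_eq_add])
  have heq : ∀ x ∈ Ioo (0 : ℝ) 1, jacobiIntegrand (d / 2 - 1) (d / 2 - 1) ν (-l₂) (-l₁) (1 - x) =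
      weightBdy d x * powerLaw l₁ l₂ x * waveBdy d ν x := by
    intro x hx
    have g0 := ofReal_ne_zero_of_pos hx.1
    have g1 := one_sub_ne_zero hx.2
    rw [jacobiIntegrand, jacobiWeight, powerLaw, weightBdy, powerLaw, waveBdy]
    push_cast
    rw [sub_sub_cancel]
    congr 1
    simp only [Complex.cpow_def_of_ne_zero g0, Complex.cpow_def_of_ne_zero g1, div_eq_mul_inv,
      ← Complex.exp_neg, ← Complex.exp_add]
    congr 1; ring
  refine ⟨(integrableOn_comp_one_sub key.1).congr_fun heq measurableSet_Ioo, ?_⟩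
  rw [← key.2, ← integral_comp_one_sub (jacobiIntegrand _ _ _ _ _)]
  exact setIntegral_congr_fun measurableSet_Ioo fun x hx => (heq x hx).symm

/-! ### The coefficients of the block expansion -/

/-- The base `g - 1 + n` may vanish only at `n = 0`, and then `k = 0` makes the product empty. -/
lemma NonPole.poch_sub_one_add_ne_zero {g : ℂ} (hg : NonPole g) {n k : ℕ} (h : k ≤ n) :
    poch (g - 1 + n) k ≠ 0 := by
  rcases k with _ | k
  · simp
  · obtain ⟨j, rfl⟩ := Nat.exists_eq_add_of_le h
    have e : g - 1 + ((k + 1 + j : ℕ) : ℂ) = g + ((k + j : ℕ) : ℂ) := by push_cast; ring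
    rw [e]
    exact (hg.add_nat _).poch_ne_zero _

/-- The sum is summable in closed form: its partial sums are hypergeometric terms, so induction on
the upper limit works. The total degree `J + 1 + i` stays fixed, so the step uses `i + 1`. -/
lemma orthogonality_partial {G : ℂ} (hG : NonPole G) (J : ℕ) : ∀ i : ℕ,
    ∑ j ∈ Finset.range (J + 1), (-1 : ℂ) ^ j / (j.factorial * (J + 1 + i - j).factorial *
      (poch (G - 1 + j) j * poch (G + 2 * j) (J + 1 + i - j))) =
    (-1) ^ J / ((J + 1 + i) * J.factorial * i.factorial * poch (G + J) (J + 1 + i)) := by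
  induction J with
  | zero =>
    intro i
    simp [add_comm 1 i, Nat.factorial_succ, add_comm (1 : ℂ)]
  | succ J ih =>
    intro i
    have h1 := ih (i + 1)
    have e1 : J + 1 + (i + 1) = J + 1 + 1 + i := by ring
    have e2 : J + 1 + 1 + i - (J + 1) = i + 1 := by omega
    rw [e1] at h1
    rw [Finset.sum_range_succ, h1, e2]
    have hP := hG.add_nat J
    -- Both denominators are expressed through the common product `(G + J + 1)_(J+2+i)`; what
    -- remains is a rational identity.
    have w1 : poch (G + J) (J + 1 + 1 + i) * (G + J + (J + 1 + 1 + i : ℕ)) =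
        (G + J) * poch (G + J + 1) (J + 1 + 1 + i) := by rw [← poch_succ, poch_succ_left]
    have w2 : poch (G + J) (J + 1) * (G + J + (J + 1 : ℕ)) * poch (G + 2 * (J + 1 : ℕ)) (i + 1) =
        (G + J) * poch (G + J + 1) (J + 1 + 1 + i) := by
      rw [← poch_succ_left, ← poch_succ, show J + 1 + 1 + i + 1 = J + 1 + 1 + (i + 1) by ring,
        poch_add (G + J) (J + 1 + 1)]
      congr 2; push_cast; ring
    have e3 : G - 1 + ((J + 1 : ℕ) : ℂ) = G + J := by push_cast; ring
    have e4 : G + ((J + 1 : ℕ) : ℂ) = G + J + 1 := by push_cast; ring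
    rw [e3, e4]
    have n1 := hP.poch_ne_zero (J + 1 + 1 + i)
    have n2 := hP.poch_ne_zero (J + 1)
    have n3 : poch (G + J + 1) (J + 1 + 1 + i) ≠ 0 := by
      have := (hP.add_nat 1).poch_ne_zero (J + 1 + 1 + i); simpa using this
    have n4 : poch (G + 2 * (J + 1 : ℕ)) (i + 1) ≠ 0 := by
      have := (hG.add_nat (2 * (J + 1))).poch_ne_zero (i + 1); push_cast at this ⊢; exact this
    have n5 := hP.ne_zero
    have n6 := hP.add_nat_ne_zero (J + 1)
    have n7 := hP.add_nat_ne_zero (J + 1 + 1 + i)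
    have q1 : poch (G + J) (J + 1 + 1 + i) =
        (G + J) * poch (G + J + 1) (J + 1 + 1 + i) / (G + J + (J + 1 + 1 + i : ℕ)) := by
      rw [← w1]; field_simp
    have q2 : poch (G + J) (J + 1) * poch (G + 2 * (J + 1 : ℕ)) (i + 1) =
        (G + J) * poch (G + J + 1) (J + 1 + 1 + i) / (G + J + (J + 1 : ℕ)) := by
      rw [← w2]; field_simp
    rw [q1, q2]
    have f1 : (J.factorial : ℂ) ≠ 0 := by exact_mod_cast J.factorial_ne_zero
    have f2 : (i.factorial : ℂ) ≠ 0 := by exact_mod_cast i.factorial_ne_zero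
    have f3 : ((J : ℂ) + 1) ≠ 0 := by exact_mod_cast J.succ_ne_zero
    have f4 : ((i : ℂ) + 1) ≠ 0 := by exact_mod_cast i.succ_ne_zero
    have f5 : ((J : ℂ) + 1 + 1 + i) ≠ 0 := by exact_mod_cast (by omega : J + 1 + 1 + i ≠ 0)
    have f6 : ((J : ℂ) + 1 + (i + 1)) ≠ 0 := by exact_mod_cast (by omega : J + 1 + (i + 1) ≠ 0)
    rw [Nat.factorial_succ, Nat.factorial_succ]
    push_cast at n6 n7 ⊢
    rw [pow_succ]
    generalize poch (G + J + 1) (J + 1 + 1 + i) = W at n3 ⊢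
    field_simp
    ring

lemma orthogonality {G : ℂ} (hG : NonPole G) (M : ℕ) :
    ∑ j ∈ Finset.range (M + 1), (-1 : ℂ) ^ j / (j.factorial * (M - j).factorial *
      (poch (G - 1 + j) j * poch (G + 2 * j) (M - j))) = if M = 0 then 1 else 0 := by
  rcases M with _ | M
  · simp
  · have h := orthogonality_partial hG M 0
    simp only [add_zero] at h
    have e : G - 1 + ((M + 1 : ℕ) : ℂ) = G + M := by push_cast; ring
    rw [Finset.sum_range_succ, h, e]
    have n1 := (hG.add_nat M).poch_ne_zero (M + 1)
    have f1 : (M.factorial : ℂ) ≠ 0 := by exact_mod_cast M.factorial_ne_zero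
    have f3 : ((M : ℂ) + 1) ≠ 0 := by exact_mod_cast M.succ_ne_zero
    simp [Nat.factorial_succ, pow_succ]
    field_simp
    ring

lemma threeFTwoTerm_neg_nat {n k : ℕ} (h : n < k) (b c d e : ℂ) :
    threeFTwoTerm (-(n : ℂ)) b c d e k = 0 := by
  simp [threeFTwoTerm, poch_neg_nat h]

lemma threeFTwoOne_neg_nat {n N : ℕ} (h : n ≤ N) (b c d e : ℂ) :
    threeFTwoOne (-(n : ℂ)) b c d e =
      ∑ k ∈ Finset.range (N + 1), threeFTwoTerm (-(n : ℂ)) b c d e k :=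
  tsum_eq_sum fun k hk => threeFTwoTerm_neg_nat (by simp at hk; omega) _ _ _ _

/-- The coefficient of the `n`-th block in the expansion of a power law. -/
def blockCoeff (g c d e : ℂ) (n : ℕ) : ℂ :=
  (-1) ^ n / (n.factorial : ℂ) * (poch d n * poch e n / poch (g - 1 + n) n) *
    threeFTwoOne (-(n : ℂ)) (g - 1 + n) c d e

/-- After exchanging the sums over `n` and over the `₃F₂` index `k`, the inner sum with `n = k + j`
is `orthogonality` for `G = g + 2k` and `M = N - k`, so only `k = N` survives. -/
lemma sum_blockCoeff_mul_gaussCoeff {g c d e : ℂ} (hg : NonPole g) (hd : NonPole d) (he : NonPole e)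
    (N : ℕ) : ∑ n ∈ Finset.range (N + 1),
      blockCoeff g c d e n * gaussCoeff (d + n) (e + n) (g + 2 * n) (N - n) =
        poch c N / N.factorial := by
  have hterm : ∀ k ∈ Finset.range (N + 1), ∀ n ∈ Finset.range (N + 1),
      (-1) ^ n / (n.factorial : ℂ) * (poch d n * poch e n / poch (g - 1 + n) n) *
        threeFTwoTerm (-(n : ℂ)) (g - 1 + n) c d e k *
        gaussCoeff (d + n) (e + n) (g + 2 * n) (N - n) =
      poch d N * poch e N * poch c k / (poch d k * poch e k * k.factorial) *
        if k ≤ n then (-1 : ℂ) ^ (n - k) / ((n - k).factorial * (N - k - (n - k)).factorial *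
          (poch (g + 2 * k - 1 + (n - k : ℕ)) (n - k) *
            poch (g + 2 * k + 2 * (n - k : ℕ)) (N - k - (n - k)))) else 0 := by
    intro k _ n hn
    have hnN : n ≤ N := Nat.lt_succ_iff.1 (Finset.mem_range.1 hn)
    split_ifs with hkn
    · obtain ⟨j, rfl⟩ := Nat.exists_eq_add_of_le hkn
      obtain ⟨i, rfl⟩ := Nat.exists_eq_add_of_le hnN
      have s1 : k + j - k = j := by omega
      have s2 : k + j + i - k - j = i := by omega
      have s3 : k + j + i - (k + j) = i := by omega
      have hneg := poch_neg_nat_eq hkn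
      rw [s1] at hneg
      rw [s1, s2, s3]
      have p1 : poch (g - 1 + (k + j : ℕ)) (k + j) =
          poch (g - 1 + (k + j : ℕ)) k * poch (g + 2 * k - 1 + j) j := by
        rw [poch_add]; congr 2; push_cast; ring
      have p2 : poch d (k + j + i) = poch d (k + j) * poch (d + (k + j : ℕ)) i := poch_add _ _ _
      have p3 : poch e (k + j + i) = poch e (k + j) * poch (e + (k + j : ℕ)) i := poch_add _ _ _
      have p4 : g + 2 * ((k + j : ℕ) : ℂ) = g + 2 * k + 2 * j := by push_cast; ring
      have n1 := hg.poch_sub_one_add_ne_zero hkn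
      have n2 := hg.poch_sub_one_add_ne_zero (le_refl (k + j))
      rw [p1] at n2
      have n2 := right_ne_zero_of_mul n2
      have n3 : poch (g + 2 * k + 2 * j) i ≠ 0 := by
        have := (hg.add_nat (2 * (k + j))).poch_ne_zero i
        push_cast at this
        convert this using 2; ring
      have n4 := hd.poch_ne_zero k
      have n5 := he.poch_ne_zero k
      have f1 : (k.factorial : ℂ) ≠ 0 := by exact_mod_cast k.factorial_ne_zero
      have f2 : (j.factorial : ℂ) ≠ 0 := by exact_mod_cast j.factorial_ne_zero
      have f3 : (i.factorial : ℂ) ≠ 0 := by exact_mod_cast i.factorial_ne_zero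
      have f4 : ((k + j).factorial : ℂ) ≠ 0 := by exact_mod_cast (k + j).factorial_ne_zero
      have hneg' : poch (-((k + j : ℕ) : ℂ)) k = (-1) ^ k * (k + j).factorial / j.factorial := by
        rw [← hneg]; field_simp
      have sq : ((-1 : ℂ) ^ k) * (-1) ^ k = 1 := by rw [← mul_pow]; simp
      rw [threeFTwoTerm, gaussCoeff, hneg', p1, p2, p3, p4, pow_add]
      field_simp
      rw [show ((-1 : ℂ) ^ k) ^ 2 = 1 by rw [pow_two, sq]]
      try ring
    · rw [threeFTwoTerm_neg_nat (by omega)]; simp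
  have h1 : ∀ n ∈ Finset.range (N + 1),
      blockCoeff g c d e n * gaussCoeff (d + n) (e + n) (g + 2 * n) (N - n) =
      ∑ k ∈ Finset.range (N + 1), (-1) ^ n / (n.factorial : ℂ) *
        (poch d n * poch e n / poch (g - 1 + n) n) *
        threeFTwoTerm (-(n : ℂ)) (g - 1 + n) c d e k *
        gaussCoeff (d + n) (e + n) (g + 2 * n) (N - n) := by
    intro n hn
    rw [blockCoeff, threeFTwoOne_neg_nat (Nat.lt_succ_iff.1 (Finset.mem_range.1 hn)),
      Finset.mul_sum, Finset.sum_mul]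
  rw [Finset.sum_congr rfl h1, Finset.sum_comm,
    Finset.sum_congr rfl fun k hk => Finset.sum_congr rfl (hterm k hk)]
  simp only [← Finset.mul_sum]
  have h2 : ∀ k ∈ Finset.range (N + 1), ∑ n ∈ Finset.range (N + 1),
      (if k ≤ n then (-1 : ℂ) ^ (n - k) / ((n - k).factorial * (N - k - (n - k)).factorial *
          (poch (g + 2 * k - 1 + (n - k : ℕ)) (n - k) *
            poch (g + 2 * k + 2 * (n - k : ℕ)) (N - k - (n - k)))) else 0) =
      if N - k = 0 then 1 else 0 := by
    intro k hk
    have hk : k ≤ N := Nat.lt_succ_iff.1 (Finset.mem_range.1 hk)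
    have hG : NonPole (g + 2 * k) := by
      have := hg.add_nat (2 * k); push_cast at this; exact this
    rw [← orthogonality hG (N - k)]
    obtain ⟨M, rfl⟩ := Nat.exists_eq_add_of_le hk
    rw [show k + M + 1 = k + (M + 1) by ring, Finset.sum_range_add]
    rw [Finset.sum_eq_zero (s := Finset.range k) fun n hn => if_neg (by simpa using hn), zero_add]
    refine Finset.sum_congr (by simp) fun j _ => ?_
    simp
  have h3 : ∀ k ∈ Finset.range (N + 1), poch d N * poch e N * poch c k /
      (poch d k * poch e k * k.factorial) * (if N - k = 0 then 1 else 0) =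
      if k = N then poch c N / N.factorial else 0 := by
    intro k hk
    have hk : k ≤ N := Nat.lt_succ_iff.1 (Finset.mem_range.1 hk)
    by_cases hkN : k = N
    · subst hkN
      have n4 := hd.poch_ne_zero k
      have n5 := he.poch_ne_zero k
      simp
      field_simp
    · rw [if_neg (by omega), if_neg hkN, mul_zero]
  rw [Finset.sum_congr rfl fun k hk => by rw [h2 k hk, h3 k hk]]
  simp

/-! ### The three-term recurrence of the Hahn polynomials and growth of the coefficients -/

/-- The terminating series `₃F₂(-n, g - 1 + n, c; d, e; 1)`, a Hahn polynomial in `-c`. -/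
def hahn (g c d e : ℂ) (n : ℕ) : ℂ := threeFTwoOne (-(n : ℂ)) (g - 1 + n) c d e

/-- The upper coefficient of the three-term recurrence. -/
def hahnA (g d e : ℂ) (n : ℕ) : ℂ :=
  -((g + n) * (d + n + 1) * (e + n + 1)) / ((g + 2 * n + 1) * (g + 2 * n + 2))

/-- The lower coefficient of the three-term recurrence. -/
def hahnC (g d e : ℂ) (n : ℕ) : ℂ :=
  (n + 1) * (g - d + n) * (g - e + n) / ((g + 2 * n) * (g + 2 * n + 1))

lemma NonPole.add_two_mul_ne_zero {g : ℂ} (hg : NonPole g) (n : ℕ) :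
    g + 2 * n ≠ 0 ∧ g + 2 * n + 1 ≠ 0 ∧ g + 2 * n + 2 ≠ 0 := by
  have h0 := hg.add_nat_ne_zero (2 * n)
  have h1 := hg.add_nat_ne_zero (2 * n + 1)
  have h2 := hg.add_nat_ne_zero (2 * n + 2)
  push_cast at h0 h1 h2
  refine ⟨h0, ?_, ?_⟩
  · rwa [add_assoc]
  · rwa [add_assoc]

/-- Creative telescoping: the recurrence in `n` holds term by term up to a difference in `m`, whose
certificate is `c + m` times the term of degree `n + 1`. -/
lemma threeFTwoTerm_recurrence {g c d e : ℂ} (hg : NonPole g) (hd : NonPole d) (he : NonPole e)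
    (n m : ℕ) :
    c * threeFTwoTerm (-((n + 1 : ℕ) : ℂ)) (g - 1 + (n + 1 : ℕ)) c d e (m + 1) =
      hahnA g d e n * threeFTwoTerm (-((n + 2 : ℕ) : ℂ)) (g - 1 + (n + 2 : ℕ)) c d e (m + 1) -
      (hahnA g d e n + hahnC g d e n) *
        threeFTwoTerm (-((n + 1 : ℕ) : ℂ)) (g - 1 + (n + 1 : ℕ)) c d e (m + 1) +
      hahnC g d e n * threeFTwoTerm (-(n : ℂ)) (g - 1 + n) c d e (m + 1) +
      (threeFTwoTerm (-((n + 1 : ℕ) : ℂ)) (g - 1 + (n + 1 : ℕ)) c d e (m + 1) * (c + (m + 1 : ℕ)) -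
        threeFTwoTerm (-((n + 1 : ℕ) : ℂ)) (g - 1 + (n + 1 : ℕ)) c d e m * (c + m)) := by
  obtain ⟨h0, h1, h2⟩ := hg.add_two_mul_ne_zero n
  have a1 : -((n + 1 : ℕ) : ℂ) + 1 = -(n : ℂ) := by push_cast; ring
  have a2 : -((n + 2 : ℕ) : ℂ) + 1 = -((n + 1 : ℕ) : ℂ) := by push_cast; ring
  have b0 : g - 1 + (n : ℂ) + 1 = g + n := by ring
  have b1 : g - 1 + ((n + 1 : ℕ) : ℂ) = g + n := by push_cast; ring
  have b2 : g - 1 + ((n + 2 : ℕ) : ℂ) = g + n + 1 := by push_cast; ring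
  have hA : hahnA g d e n * ((g + 2 * n + 1) * (g + 2 * n + 2)) =
      -((g + n) * (d + n + 1) * (e + n + 1)) := div_mul_cancel₀ _ (mul_ne_zero h1 h2)
  have hC : hahnC g d e n * ((g + 2 * n) * (g + 2 * n + 1)) =
      (n + 1) * (g - d + n) * (g - e + n) := div_mul_cancel₀ _ (mul_ne_zero h0 h1)
  rw [b1, b2]
  generalize hahnA g d e n = A at *
  generalize hahnC g d e n = C at *
  apply mul_left_cancel₀ (mul_ne_zero (mul_ne_zero h0 h1) h2)
  rcases m with _ | m
  · have d0 := hd.ne_zero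
    have e0 := he.ne_zero
    obtain ⟨K, hK⟩ : ∃ K, c = d * e * K := ⟨c / (d * e), by field_simp⟩
    have t : ∀ x y : ℂ, threeFTwoTerm x y c d e (0 + 1) = x * y * K := by
      intro x y
      simp only [threeFTwoTerm, zero_add, poch_one, Nat.factorial_one, Nat.cast_one]
      rw [hK]; field_simp
    have t0 : ∀ x y : ℂ, threeFTwoTerm x y c d e 0 = 1 := by
      intro x y; simp [threeFTwoTerm]
    rw [t, t, t, t0, hK]
    push_cast
    linear_combination (-(g + 2 * n) * (-(n + 2) * (g + n + 1) + (n + 1) * (g + n)) * K) * hA -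
      (g + 2 * n + 2) * (-n * (g - 1 + n) + (n + 1) * (g + n)) * K * hC
  · have u1 : poch (-((n + 2 : ℕ) : ℂ)) (m + 1 + 1) = (n + 2) * (n + 1) * poch (-(n : ℂ)) m := by
      rw [poch_succ_left, a2, poch_succ_left, a1]; push_cast; ring
    have u2 : poch (-((n + 1 : ℕ) : ℂ)) (m + 1 + 1) = -(n + 1) * (-n + m) * poch (-(n : ℂ)) m := by
      rw [poch_succ_left, a1, poch_succ]; push_cast; ring
    have u3 : poch (-((n + 1 : ℕ) : ℂ)) (m + 1) = -(n + 1) * poch (-(n : ℂ)) m := by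
      rw [poch_succ_left, a1]; push_cast; ring
    have u4 : poch (-(n : ℂ)) (m + 1 + 1) = (-n + m) * (-n + m + 1) * poch (-(n : ℂ)) m := by
      rw [poch_succ, poch_succ]; push_cast; ring
    have v1 : poch (g + n + 1) (m + 1 + 1) =
        (g + n + 1 + m) * (g + n + 2 + m) * poch (g + n + 1) m := by
      rw [poch_succ, poch_succ]; push_cast; ring
    have v3 : poch (g + n) (m + 1) = (g + n) * poch (g + n + 1) m := poch_succ_left _ _
    have v2 : poch (g + n) (m + 1 + 1) = (g + n) * (g + n + 1 + m) * poch (g + n + 1) m := by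
      rw [poch_succ, v3]; push_cast; ring
    have v4 : poch (g - 1 + n) (m + 1 + 1) = (g - 1 + n) * (g + n) * poch (g + n + 1) m := by
      rw [poch_succ_left, b0, v3]; ring
    have d1 : poch d (m + 1 + 1) = poch d (m + 1) * (d + m + 1) := by
      rw [poch_succ]; push_cast; ring
    have e1 : poch e (m + 1 + 1) = poch e (m + 1) * (e + m + 1) := by
      rw [poch_succ]; push_cast; ring
    have d0 := hd.poch_ne_zero (m + 1)
    have e0 := he.poch_ne_zero (m + 1)
    have d2 : d + m + 1 ≠ 0 := by
      have := hd.add_nat_ne_zero (m + 1)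
      push_cast at this
      rwa [add_assoc]
    have e2 : e + m + 1 ≠ 0 := by
      have := he.add_nat_ne_zero (m + 1)
      push_cast at this
      rwa [add_assoc]
    have f1 : ((m + 1).factorial : ℂ) ≠ 0 := by exact_mod_cast (m + 1).factorial_ne_zero
    have f2 : ((m : ℂ) + 1 + 1) ≠ 0 := by exact_mod_cast (m + 1).succ_ne_zero
    -- All four terms are polynomial multiples of this common factor, which reduces the claim to a
    -- polynomial identity modulo the defining relations of `A` and `C`.
    obtain ⟨K, hK⟩ : ∃ K, K = poch (-(n : ℂ)) m * poch (g + n + 1) m * poch c (m + 1) /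
      (poch d (m + 1) * poch e (m + 1) * ((m + 1).factorial : ℂ) * (d + m + 1) * (e + m + 1) *
        (m + 1 + 1)) := ⟨_, rfl⟩
    have t : ∀ x y X Y : ℂ, poch x (m + 1 + 1) = X * poch (-(n : ℂ)) m →
        poch y (m + 1 + 1) = Y * poch (g + n + 1) m →
        threeFTwoTerm x y c d e (m + 1 + 1) = X * Y * (c + m + 1) * K := by
      intro x y X Y hX hY
      rw [threeFTwoTerm, hX, hY, d1, e1, Nat.factorial_succ (m + 1), poch_succ c (m + 1), hK]
      push_cast
      field_simp
      ring
    have t1 : threeFTwoTerm (-((n + 1 : ℕ) : ℂ)) (g + n) c d e (m + 1) =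
        -(n + 1) * (g + n) * ((d + m + 1) * (e + m + 1) * (m + 1 + 1)) * K := by
      rw [threeFTwoTerm, u3, v3, hK]
      field_simp
    rw [t _ _ _ _ u1 v1, t _ _ _ _ u2 v2, t _ _ _ _ u4 v4, t1]
    push_cast
    linear_combination
      (-(g + 2 * n) * ((n + 2) * (n + 1) * ((g + n + 1 + m) * (g + n + 2 + m)) * (c + m + 1) -
        -(n + 1) * (-n + m) * ((g + n) * (g + n + 1 + m)) * (c + m + 1)) * K) * hA -
      (g + 2 * n + 2) * ((-n + m) * (-n + m + 1) * ((g - 1 + n) * (g + n)) * (c + m + 1) -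
        -(n + 1) * (-n + m) * ((g + n) * (g + n + 1 + m)) * (c + m + 1)) * K * hC

lemma hahn_recurrence {g d e : ℂ} (hg : NonPole g) (hd : NonPole d) (he : NonPole e) (c : ℂ) (n : ℕ) :
    c * hahn g c d e (n + 1) = hahnA g d e n * hahn g c d e (n + 2) -
      (hahnA g d e n + hahnC g d e n) * hahn g c d e (n + 1) + hahnC g d e n * hahn g c d e n := by
  have hN : ∀ j, j ≤ n + 2 → hahn g c d e j =
      ∑ m ∈ Finset.range (n + 2), threeFTwoTerm (-(j : ℂ)) (g - 1 + j) c d e (m + 1) + 1 := by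
    intro j hj
    rw [hahn, threeFTwoOne_neg_nat hj, Finset.sum_range_succ']
    simp [threeFTwoTerm]
  have hs : ∑ m ∈ Finset.range (n + 2),
      (threeFTwoTerm (-((n + 1 : ℕ) : ℂ)) (g - 1 + (n + 1 : ℕ)) c d e (m + 1) * (c + (m + 1 : ℕ)) -
        threeFTwoTerm (-((n + 1 : ℕ) : ℂ)) (g - 1 + (n + 1 : ℕ)) c d e m * (c + m)) = -c := by
    rw [Finset.sum_range_sub (fun m : ℕ =>
      threeFTwoTerm (-((n + 1 : ℕ) : ℂ)) (g - 1 + (n + 1 : ℕ)) c d e m * (c + m)),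
      threeFTwoTerm_neg_nat (by omega)]
    simp [threeFTwoTerm]
  have key := Finset.sum_congr (rfl : Finset.range (n + 2) = _)
    fun m _ => threeFTwoTerm_recurrence (c := c) hg hd he n m
  simp only [Finset.sum_add_distrib, Finset.sum_sub_distrib, ← Finset.mul_sum] at key hs
  rw [hN _ (by omega), hN (n + 2) (by omega), hN n (by omega)]
  linear_combination key + hs

lemma tendsto_add_div_nat (r z : ℂ) : Tendsto (fun n : ℕ => (z + r * n) / n) atTop (𝓝 r) := by
  have h : Tendsto (fun n : ℕ => z / (n : ℂ) + r) atTop (𝓝 (0 + r)) :=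
    (tendsto_const_div_atTop_nhds_zero_nat z).add tendsto_const_nhds
  rw [zero_add] at h
  refine h.congr' ?_
  filter_upwards [eventually_ne_atTop 0] with n hn
  have : (n : ℂ) ≠ 0 := by exact_mod_cast hn
  field_simp

lemma tendsto_hahnA_div (g d e : ℂ) : Tendsto (fun n : ℕ => hahnA g d e n / n) atTop (𝓝 (-(1 / 4))) := by
  have h := ((((tendsto_add_div_nat 1 g).mul (tendsto_add_div_nat 1 (d + 1))).mul
    (tendsto_add_div_nat 1 (e + 1))).div
    ((tendsto_add_div_nat 2 (g + 1)).mul (tendsto_add_div_nat 2 (g + 2))) (by norm_num)).neg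
  rw [show (-(1 * 1 * 1 / (2 * 2)) : ℂ) = -(1 / 4) by norm_num] at h
  refine h.congr' ?_
  filter_upwards [eventually_ne_atTop 0] with n hn
  have : (n : ℂ) ≠ 0 := by exact_mod_cast hn
  rw [hahnA]
  simp only [Pi.div_apply, add_right_comm _ (1 : ℂ), add_right_comm _ (2 : ℂ), one_mul]
  field_simp

lemma tendsto_hahnC_div (g d e : ℂ) : Tendsto (fun n : ℕ => hahnC g d e n / n) atTop (𝓝 (1 / 4)) := by
  have h := ((((tendsto_add_div_nat 1 1).mul (tendsto_add_div_nat 1 (g - d))).mul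
    (tendsto_add_div_nat 1 (g - e))).div
    ((tendsto_add_div_nat 2 g).mul (tendsto_add_div_nat 2 (g + 1))) (by norm_num))
  rw [show (1 * 1 * 1 / (2 * 2) : ℂ) = 1 / 4 by norm_num] at h
  refine h.congr' ?_
  filter_upwards [eventually_ne_atTop 0] with n hn
  have : (n : ℂ) ≠ 0 := by exact_mod_cast hn
  rw [hahnC, add_comm (n : ℂ) 1]
  simp only [Pi.div_apply, add_right_comm _ (1 : ℂ), one_mul]
  field_simp

lemma exists_le_mul_pow {b : ℕ → ℝ} {q : ℝ} (hq : 0 < q) (h : ∀ᶠ n in atTop, b (n + 1) ≤ q * b n) :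
    ∃ C, 0 ≤ C ∧ ∀ᶠ n in atTop, b n ≤ C * q ^ n := by
  obtain ⟨N, hN⟩ := eventually_atTop.1 h
  refine ⟨|b N| / q ^ N, by positivity, eventually_atTop.2 ⟨N, fun n hn => ?_⟩⟩
  induction n, hn using Nat.le_induction with
  | base =>
    rw [div_mul_cancel₀ _ (by positivity)]; exact le_abs_self _
  | succ n hn ih =>
    calc b (n + 1) ≤ q * b n := hN n hn
      _ ≤ q * (|b N| / q ^ N * q ^ n) := by gcongr
      _ = _ := by ring

/-- The recurrence coefficients behave like `-n/4` and `n/4`, so in the limit it reads `p_(n+2) =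
p_n`, and the maximum of two consecutive norms eventually grows by at most a factor `q` per step. In
general the alternating sum has exponentially large terms, so a termwise bound would not do. -/
lemma exists_norm_hahn_le {g d e : ℂ} (hg : NonPole g) (hd : NonPole d) (he : NonPole e) (c : ℂ)
    {q : ℝ} (hq : 1 < q) : ∃ C, 0 ≤ C ∧ ∀ᶠ n in atTop, ‖hahn g c d e n‖ ≤ C * q ^ n := by
  have hA := tendsto_hahnA_div g d e
  have hC := tendsto_hahnC_div g d e
  have hA0 : (-(1 / 4) : ℂ) ≠ 0 := by norm_num
  have hu : Tendsto (fun n : ℕ => ‖(c / n + hahnA g d e n / n + hahnC g d e n / n) / (hahnA g d e n / n)‖ +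
      ‖(hahnC g d e n / n) / (hahnA g d e n / n)‖) atTop (𝓝 1) := by
    have h1 := (((((tendsto_const_div_atTop_nhds_zero_nat c).add hA).add hC).div hA hA0).norm).add
      ((hC.div hA hA0).norm)
    norm_num at h1
    simpa [Pi.div_apply] using h1
  have hev : ∀ᶠ n : ℕ in atTop, max ‖hahn g c d e (n + 1)‖ ‖hahn g c d e (n + 2)‖ ≤
      q * max ‖hahn g c d e n‖ ‖hahn g c d e (n + 1)‖ := by
    filter_upwards [hu.eventually_lt_const hq, hA.eventually_ne hA0, eventually_ne_atTop 0] with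
      n h1 h2 h3
    have hn : (n : ℂ) ≠ 0 := by exact_mod_cast h3
    have hAn : hahnA g d e n ≠ 0 := fun h => h2 (by rw [h, zero_div])
    set M := max ‖hahn g c d e n‖ ‖hahn g c d e (n + 1)‖ with hM
    have hM0 : 0 ≤ M := (norm_nonneg _).trans (le_max_left _ _)
    have hrec : hahn g c d e (n + 2) =
        (c / n + hahnA g d e n / n + hahnC g d e n / n) / (hahnA g d e n / n) * hahn g c d e (n + 1) -
        (hahnC g d e n / n) / (hahnA g d e n / n) * hahn g c d e n := by
      have := hahn_recurrence hg hd he c n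
      field_simp
      linear_combination -this
    refine max_le ?_ ?_
    · nlinarith [le_max_right ‖hahn g c d e n‖ ‖hahn g c d e (n + 1)‖]
    · rw [hrec]
      refine (norm_sub_le _ _).trans ?_
      rw [norm_mul, norm_mul]
      have m1 := le_max_left ‖hahn g c d e n‖ ‖hahn g c d e (n + 1)‖
      have m2 := le_max_right ‖hahn g c d e n‖ ‖hahn g c d e (n + 1)‖
      calc _ ≤ ‖(c / n + hahnA g d e n / n + hahnC g d e n / n) / (hahnA g d e n / n)‖ * M +
            ‖(hahnC g d e n / n) / (hahnA g d e n / n)‖ * M := by gcongr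
        _ ≤ q * M := by rw [← add_mul]; gcongr
  obtain ⟨C, hC0, hC⟩ := exists_le_mul_pow (b := fun n => max ‖hahn g c d e n‖ ‖hahn g c d e (n + 1)‖)
    (zero_lt_one.trans hq) hev
  exact ⟨C, hC0, hC.mono fun n hn => (le_max_left _ _).trans hn⟩

/-- The factor of `blockCoeff` in front of the Hahn polynomial. -/
def blockPrefactor (g d e : ℂ) (n : ℕ) : ℂ :=
  (-1) ^ n / (n.factorial : ℂ) * (poch d n * poch e n / poch (g - 1 + n) n)

lemma exists_norm_blockPrefactor_le {g d e : ℂ} (hg : NonPole g) {q : ℝ} (hq : 1 / 4 < q) :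
    ∃ C, 0 ≤ C ∧ ∀ᶠ n in atTop, ‖blockPrefactor g d e n‖ ≤ C * q ^ n := by
  have h := ((((tendsto_add_div_nat 1 d).mul (tendsto_add_div_nat 1 e)).mul
    (tendsto_add_div_nat 1 (g - 1))).div
    (((tendsto_add_div_nat 1 1).mul (tendsto_add_div_nat 2 (g - 1))).mul (tendsto_add_div_nat 2 g))
    (by norm_num)).norm
  norm_num at h
  have hq' : (1 / 4 : ℝ) < q := hq
  refine exists_le_mul_pow (by linarith) ?_
  filter_upwards [h.eventually_lt_const hq', eventually_ne_atTop 0] with n hn h0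
  have hnz : (n : ℂ) ≠ 0 := by exact_mod_cast h0
  -- Writing `n = m + 1` turns `g - 1 + n` into `g + m`, which is nonzero; at `n = 0` it could
  -- vanish.
  obtain ⟨m, rfl⟩ := Nat.exists_eq_succ_of_ne_zero h0
  set n := m.succ with hnm
  have g1 : g - 1 + (n : ℂ) ≠ 0 := by
    have := hg.add_nat_ne_zero m
    convert this using 1; rw [hnm]; push_cast; ring
  have g2 : g - 1 + 2 * (n : ℂ) ≠ 0 := by
    have := hg.add_nat_ne_zero (2 * m + 1)
    convert this using 1; rw [hnm]; push_cast; ring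
  have g3 : g + 2 * (n : ℂ) ≠ 0 := (hg.add_two_mul_ne_zero n).1
  have p1 := hg.poch_sub_one_add_ne_zero (le_refl n)
  have p2 := hg.poch_sub_one_add_ne_zero (le_refl (n + 1))
  have rel : poch (g - 1 + (n + 1 : ℕ)) (n + 1) * (g - 1 + n) =
      poch (g - 1 + n) n * (g - 1 + 2 * n) * (g + 2 * n) := by
    have e1 : g - 1 + ((n + 1 : ℕ) : ℂ) = g - 1 + n + 1 := by push_cast; ring
    rw [e1, mul_comm, ← poch_succ_left, poch_succ, poch_succ]
    push_cast; ring
  have rel' : poch (g - 1 + (n + 1 : ℕ)) (n + 1) =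
      poch (g - 1 + n) n * (g - 1 + 2 * n) * (g + 2 * n) / (g - 1 + n) := by
    rw [← rel]; field_simp
  have f1 : (n.factorial : ℂ) ≠ 0 := by exact_mod_cast n.factorial_ne_zero
  have f2 : (n : ℂ) + 1 ≠ 0 := by exact_mod_cast n.succ_ne_zero
  have hstep : blockPrefactor g d e (n + 1) =
      -(((d + n) / n * ((e + n) / n) * ((g - 1 + n) / n)) /
        (((1 + n) / n * ((g - 1 + 2 * n) / n)) * ((g + 2 * n) / n))) * blockPrefactor g d e n := by
    rw [blockPrefactor, blockPrefactor, rel', poch_succ d n, poch_succ e n,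
      Nat.factorial_succ, pow_succ]
    push_cast
    rw [add_comm (1 : ℂ)]
    field_simp
  rw [hstep, norm_mul, norm_neg]
  refine mul_le_mul_of_nonneg_right (le_of_eq_of_le ?_ hn.le) (norm_nonneg _)
  simp only [norm_mul, norm_div, Complex.norm_natCast]

lemma exists_norm_blockCoeff_le {g c d e : ℂ} (hg : NonPole g) (hd : NonPole d) (he : NonPole e)
    {q : ℝ} (hq : 1 < q) : ∃ C, 0 ≤ C ∧ ∀ᶠ n in atTop, ‖blockCoeff g c d e n‖ ≤ C * (q / 4) ^ n := by
  have hr : 1 < √q := Real.lt_sqrt_of_sq_lt (by simpa)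
  obtain ⟨C, hC, h1⟩ := exists_norm_hahn_le hg hd he c hr
  obtain ⟨C', hC', h2⟩ := exists_norm_blockPrefactor_le (g := g) (d := d) (e := e) hg
    (q := √q / 4) (by linarith)
  refine ⟨C' * C, by positivity, ?_⟩
  filter_upwards [h1, h2] with n h3 h4
  have e1 : blockCoeff g c d e n = blockPrefactor g d e n * hahn g c d e n := rfl
  have e2 : q / 4 = √q / 4 * √q := by
    rw [div_mul_eq_mul_div, Real.mul_self_sqrt (by linarith)]
  rw [e1, norm_mul, e2, mul_pow]
  calc _ ≤ (C' * (√q / 4) ^ n) * (C * √q ^ n) := by gcongr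
    _ = _ := by ring

/-! ### Expansion of a power law in hypergeometric functions -/

lemma mul_pochR_add_one (x : ℝ) (m : ℕ) : x * pochR (x + 1) m = (x + m) * pochR x m := by
  induction m with
  | zero => simp
  | succ m ih =>
    rw [pochR_succ, pochR_succ, ← mul_assoc, ih]
    push_cast; ring

lemma pochR_add_one_le {x : ℝ} (hx : 1 ≤ x) (m : ℕ) : pochR (x + 1) m ≤ (1 + m) * pochR x m := by
  have h := mul_pochR_add_one x m
  have hP := pochR_nonneg (by linarith : 0 ≤ x) m
  have h1 : x * pochR (x + 1) m ≤ x * ((1 + m) * pochR x m) := by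
    rw [h, ← mul_assoc]
    gcongr
    nlinarith [(Nat.cast_nonneg m : (0 : ℝ) ≤ m)]
  exact le_of_mul_le_mul_left h1 (by linarith)

lemma pochR_add_nat_le {x : ℝ} (hx : 1 ≤ x) (m j : ℕ) :
    pochR (x + j) m ≤ (1 + m) ^ j * pochR x m := by
  induction j with
  | zero => simp
  | succ j ih =>
    have h := pochR_add_one_le (x := x + j) (by linarith [(Nat.cast_nonneg j : (0 : ℝ) ≤ j)]) m
    calc pochR (x + (j + 1 : ℕ)) m = pochR (x + j + 1) m := by push_cast; rw [add_assoc]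
      _ ≤ (1 + m) * ((1 + m) ^ j * pochR x m) := h.trans (by gcongr)
      _ = _ := by ring

lemma pochR_nat_add_one_mul (n m : ℕ) :
    pochR (n + 1) m * (n.factorial : ℝ) = ((n + m).factorial : ℝ) := by
  induction m with
  | zero => simp
  | succ m ih =>
    rw [pochR_succ, mul_right_comm, ih, ← add_assoc, Nat.factorial_succ]
    push_cast; ring

/-- The quotient `(n+1)_m² / ((2n+1)_m m!)` equals `C(n+m, n) C(2n, n) / C(2n+m, n)`, which is at
most `C(2n, n) ≤ 4^n`. -/
lemma pochR_sq_le (n m : ℕ) :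
    pochR (n + 1) m ^ 2 ≤ 4 ^ n * (pochR (2 * n + 1) m * (m.factorial : ℝ)) := by
  have h1 := pochR_nat_add_one_mul n m
  have h2 := pochR_nat_add_one_mul (2 * n) m
  have c1 : (((n + m).choose n * n.factorial * m.factorial : ℕ) : ℝ) = (n + m).factorial := by
    rw [add_comm n m, mul_right_comm, Nat.add_choose_mul_factorial_mul_factorial]
  have c2 : (((2 * n + m).choose n * n.factorial * (n + m).factorial : ℕ) : ℝ) =
      (2 * n + m).factorial := by
    rw [show 2 * n + m = n + (n + m) by ring, add_comm n (n + m), mul_right_comm,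
      Nat.add_choose_mul_factorial_mul_factorial]
  have c3 : (((2 * n).choose n * n.factorial * n.factorial : ℕ) : ℝ) = (2 * n).factorial := by
    rw [two_mul, Nat.add_choose_mul_factorial_mul_factorial]
  have l1 : ((n + m).choose n : ℝ) ≤ ((2 * n + m).choose n : ℝ) := by
    exact_mod_cast Nat.choose_le_choose n (by omega)
  have l2 : ((2 * n).choose n : ℝ) ≤ 4 ^ n := by
    exact_mod_cast (Nat.choose_le_two_pow (2 * n) n).trans_eq (by rw [pow_mul]; norm_num)
  have f1 : (0 : ℝ) < n.factorial := by exact_mod_cast n.factorial_pos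
  have f2 : (0 : ℝ) < (2 * n).factorial := by exact_mod_cast (2 * n).factorial_pos
  push_cast at h1 h2 c1 c2 c3
  refine le_of_mul_le_mul_right ?_ (mul_pos (pow_pos f1 2) f2)
  calc pochR (n + 1) m ^ 2 * ((n.factorial : ℝ) ^ 2 * (2 * n).factorial)
      = ((n + m).factorial * m.factorial * (n.factorial : ℝ) ^ 3) *
          (((n + m).choose n : ℝ) * ((2 * n).choose n : ℝ)) := by
        calc _ = (pochR (n + 1) m * n.factorial) * (pochR (n + 1) m * n.factorial) *
              (2 * n).factorial := by ring
          _ = _ := by rw [h1, ← c3]; nth_rw 2 [← c1]; ring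
    _ ≤ ((n + m).factorial * m.factorial * (n.factorial : ℝ) ^ 3) *
          (((2 * n + m).choose n : ℝ) * 4 ^ n) := by gcongr
    _ = _ := by
        calc _ = 4 ^ n * ((2 * n + m).choose n * n.factorial * (n + m).factorial) *
              (m.factorial * (n.factorial : ℝ) ^ 2) := by ring
          _ = _ := by rw [c2, ← h2]; ring

/-- Comparison with the model parameters `n + 1`, `n + 1`, `2n + 1`: each numerator symbol costs
`(1+m)^K`, the denominator `(1+m)^(K+1)`. The growth in `n` is then the `4^n` of the model case. -/
lemma norm_gaussCoeff_shift_le {g d e : ℂ} {K : ℕ} (hg : ‖g‖ ≤ K) (hd : ‖d‖ ≤ K) (he : ‖e‖ ≤ K)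
    {n : ℕ} (hn : K + 1 ≤ n) (m : ℕ) :
    ‖gaussCoeff (d + n) (e + n) (g + 2 * n) m‖ ≤ (m + 1) ^ (3 * K + 1) * 4 ^ n := by
  have hnR : (K : ℝ) + 1 ≤ n := by exact_mod_cast hn
  have hK0 : (0 : ℝ) ≤ K := K.cast_nonneg
  have hup : ∀ a : ℂ, ‖a‖ ≤ K → ‖poch (a + n) m‖ ≤ (1 + m) ^ K * pochR (n + 1) m := by
    intro a ha
    refine (norm_poch_le_pochR (x := (n + 1 : ℝ) + K) ?_ m).trans
      (pochR_add_nat_le (by linarith) m K)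
    refine (norm_add_le _ _).trans ?_
    rw [Complex.norm_natCast]; linarith
  have hlow : pochR (2 * n + 1) m ≤ (1 + m) ^ (K + 1) * ‖poch (g + 2 * n) m‖ := by
    -- `Re (g + 2n) ≥ 2n - K`, and `K + 1` unit steps lead from there to `2n + 1`; `n ≥ K + 1` keeps
    -- the starting point at least `1`.
    have h1 := pochR_add_nat_le (x := 2 * n - K) (by linarith) m (K + 1)
    rw [show (2 * n - K + ((K + 1 : ℕ) : ℝ) : ℝ) = 2 * n + 1 by push_cast; ring] at h1
    refine h1.trans ?_
    gcongr
    refine pochR_le_norm_poch (by linarith) ?_ m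
    have := (abs_le.1 ((Complex.abs_re_le_norm g).trans hg)).1
    simp
    linarith
  have hP : 0 < pochR (2 * n + 1) m := pochR_pos (by positivity) m
  have hg0 : 0 < ‖poch (g + 2 * n) m‖ := by
    by_contra h
    nlinarith [pow_pos (by positivity : (0 : ℝ) < 1 + m) (K + 1)]
  have hm : (0 : ℝ) < m.factorial := by exact_mod_cast m.factorial_pos
  have hP1 := pochR_nonneg (by positivity : (0 : ℝ) ≤ n + 1) m
  rw [gaussCoeff, norm_div, norm_mul, norm_mul, Complex.norm_natCast, div_le_iff₀ (by positivity)]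
  calc _ ≤ ((1 + m) ^ K * pochR (n + 1) m) * ((1 + m) ^ K * pochR (n + 1) m) := by
        gcongr
        exacts [hup d hd, hup e he]
    _ = (1 + m) ^ (2 * K) * pochR (n + 1) m ^ 2 := by ring
    _ ≤ (1 + m) ^ (2 * K) * (4 ^ n *
        (((1 + m) ^ (K + 1) * ‖poch (g + 2 * n) m‖) * (m.factorial : ℝ))) := by
        gcongr
        refine (pochR_sq_le n m).trans ?_
        gcongr
    _ = _ := by ring

/-- The expansion of `(1 - x)^(-c)` in the functions `x^n ₂F₁(d + n, e + n; g + 2n; x)`. -/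
lemma hasSum_blockCoeff_mul {g d e : ℂ} (hg : NonPole g) (hd : NonPole d) (he : NonPole e) (c : ℂ)
    {x : ℝ} (hx : x ∈ Ioo (0 : ℝ) 1) :
    HasSum (fun n : ℕ => blockCoeff g c d e n *
      ((x : ℂ) ^ n * ₂F₁ (d + n) (e + n) (g + 2 * n) (x : ℂ))) ((1 - (x : ℂ)) ^ (-c)) := by
  obtain ⟨h0, h1⟩ := hx
  have hnx : ‖(x : ℂ)‖ = x := by simp [abs_of_pos h0]
  have hnx1 : ‖(x : ℂ)‖ < 1 := hnx.trans_lt h1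
  have hgn : ∀ n : ℕ, NonPole (g + 2 * n) := fun n => by
    have := hg.add_nat (2 * n); push_cast at this; exact this
  let f : ℕ → ℕ → ℂ := fun n m =>
    blockCoeff g c d e n * gaussCoeff (d + n) (e + n) (g + 2 * n) m * (x : ℂ) ^ (n + m)
  let S : ℕ → ℝ := fun n => ∑' m, ‖gaussCoeff (d + n) (e + n) (g + 2 * n) m‖ * x ^ m
  have hS : ∀ n : ℕ, HasSum (fun m => ‖gaussCoeff (d + n) (e + n) (g + 2 * n) m‖ * x ^ m) (S n) :=
    fun n => (summable_norm_gaussCoeff_mul_pow (hgn n) _ _ h0.le h1).hasSum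
  have hb : Summable fun n : ℕ => ‖blockCoeff g c d e n‖ * x ^ n * S n := by
    obtain ⟨K, hK⟩ := exists_nat_ge (max ‖g‖ (max ‖d‖ ‖e‖))
    have hgK := (le_max_left _ _).trans hK
    have hdK := ((le_max_left _ _).trans (le_max_right _ _)).trans hK
    have heK := ((le_max_right _ _).trans (le_max_right _ _)).trans hK
    have hT : Summable fun m : ℕ => ((m : ℝ) + 1) ^ (3 * K + 1) * x ^ m := by
      have := summable_rpow_mul_pow ((3 * K + 1 : ℕ) : ℝ) h0.le h1
      simpa only [Real.rpow_natCast] using this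
    -- Any `q` in `(1, 1/x)` works: the coefficient is `O((q/4)^n)` and the Gauss function is
    -- `O(4^n)`, so the `n`-th row is `O((q x)^n)`.
    obtain ⟨q, hq1, hq2⟩ := exists_between ((one_lt_div h0).2 h1)
    rw [lt_div_iff₀ h0] at hq2
    obtain ⟨C, hC0, hC⟩ := exists_norm_blockCoeff_le (c := c) hg hd he hq1
    refine Summable.of_norm_bounded_eventually_nat
      (g := fun n => C * (∑' m : ℕ, ((m : ℝ) + 1) ^ (3 * K + 1) * x ^ m) * (q * x) ^ n)
      ((summable_geometric_of_lt_one (by positivity) hq2).mul_left _) ?_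
    filter_upwards [hC, eventually_ge_atTop (K + 1)] with n hn hnK
    have hSn : S n ≤ 4 ^ n * ∑' m : ℕ, ((m : ℝ) + 1) ^ (3 * K + 1) * x ^ m := by
      refine hasSum_le (fun m => ?_) (hS n) (hT.hasSum.mul_left (4 ^ n))
      calc _ ≤ (m + 1) ^ (3 * K + 1) * 4 ^ n * x ^ m := by
            gcongr; exact norm_gaussCoeff_shift_le hgK hdK heK hnK m
        _ = _ := by ring
    have hS0 : 0 ≤ S n := tsum_nonneg fun m => by positivity
    rw [Real.norm_of_nonneg (by positivity)]
    calc _ ≤ C * (q / 4) ^ n * x ^ n *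
          (4 ^ n * ∑' m : ℕ, ((m : ℝ) + 1) ^ (3 * K + 1) * x ^ m) := by gcongr
      _ = _ := by rw [div_pow, mul_pow]; field_simp
  have hf : Summable fun p : ℕ × ℕ => f p.1 p.2 := by
    refine summable_prod_of_bound (B := fun n m => ‖blockCoeff g c d e n‖ * x ^ n *
      (‖gaussCoeff (d + n) (e + n) (g + 2 * n) m‖ * x ^ m)) (fun n m => le_of_eq ?_)
      (fun n => (hS n).mul_left _) hb
    simp only [f, norm_mul, norm_pow, hnx, pow_add]
    ring
  have hrow : ∀ n : ℕ, HasSum (f n) (blockCoeff g c d e n *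
      ((x : ℂ) ^ n * ₂F₁ (d + n) (e + n) (g + 2 * n) (x : ℂ))) := by
    intro n
    refine (((hasSum_gaussCoeff (hgn n) (d + n) (e + n) hnx1).mul_left ((x : ℂ) ^ n)).mul_left
      (blockCoeff g c d e n)).congr_fun fun m => ?_
    simp only [f, pow_add]; ring
  refine (hasSum_rows hf hrow).congr_val ?_
  refine (hasSum_antidiagonals hf).unique ((hasSum_binomial c hnx1).congr_fun fun N => ?_)
  rw [← sum_blockCoeff_mul_gaussCoeff hg hd he N, Finset.sum_mul]
  refine Finset.sum_congr rfl fun n hn => ?_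
  have : n + (N - n) = N := by rw [Finset.mem_range] at hn; omega
  simp only [f, this]

lemma coeffY_eq_blockCoeff (p q l₁ l₂ : ℂ) (n : ℕ) :
    coeffY p q l₁ l₂ n = blockCoeff (2 * l₁ - p - q) l₂ l₁ (l₁ - q) n := by
  have e : 2 * l₁ - 1 - p - q = 2 * l₁ - p - q - 1 := by ring
  rw [coeffY, blockCoeff, e]

lemma gaussF_ofReal (a b c : ℂ) {x : ℝ} (hx : x ∈ Ioo (0 : ℝ) 1) :
    gaussF a b c (x : ℂ) = ₂F₁ a b c (x : ℂ) := by
  rw [gaussF, if_pos]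
  simpa [abs_of_pos hx.1] using hx.2

lemma bulk_expansion {d D₁ D₂ l₁ l₂ : ℂ} {ρ : ℝ} (hρ : ρ ∈ Ioo (0 : ℝ) 1)
    (h1 : NonPole (l₁ + deltaMinus D₁ D₂)) (h2 : NonPole (l₁ + deltaMinus D₁ D₂ + 1 - d / 2))
    (h3 : NonPole (2 * l₁ + 1 - d / 2)) :
    HasSum (fun n : ℕ => coeffY (2 * deltaMinus D₁ D₂) (d / 2 - 1) (l₁ + deltaMinus D₁ D₂)
      (l₂ + deltaMinus D₁ D₂) n * blockBulk d D₁ D₂ (2 * l₁ + 2 * n) ρ) (powerLaw l₁ l₂ ρ) := by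
  set δ := deltaMinus D₁ D₂ with hδ
  have g0 := ofReal_ne_zero_of_pos hρ.1
  have g1 := one_sub_ne_zero hρ.2
  have key := (hasSum_blockCoeff_mul h3 h1 h2 (l₂ + δ) hρ).mul_left
    ((ρ : ℂ) ^ l₁ * (1 - (ρ : ℂ)) ^ δ)
  refine (key.congr_val ?_).congr_fun fun n => ?_
  · rw [powerLaw, div_eq_mul_inv, ← Complex.cpow_neg, mul_assoc, ← Complex.cpow_add _ _ g1]
    congr 2; ring
  · rw [coeffY_eq_blockCoeff, blockBulk, gaussF_ofReal _ _ _ hρ, ← hδ]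
    rw [show 2 * (l₁ + δ) - 2 * δ - (d / 2 - 1) = 2 * l₁ + 1 - d / 2 by ring,
      show l₁ + δ - (d / 2 - 1) = l₁ + δ + 1 - d / 2 by ring,
      show (2 * l₁ + 2 * (n : ℂ)) / 2 = l₁ + n by ring, Complex.cpow_add _ _ g0,
      Complex.cpow_natCast, show l₁ + (n : ℂ) + δ = l₁ + δ + n by ring,
      show l₁ + (n : ℂ) + 1 - d / 2 + δ = l₁ + δ + 1 - d / 2 + n by ring,
      show 2 * l₁ + 2 * (n : ℂ) + 1 - d / 2 = 2 * l₁ + 1 - d / 2 + 2 * n by ring]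
    ring

lemma crosscap_expansion {d D₁ D₂ l₁ l₂ : ℂ} {η : ℝ} (hη : η ∈ Ioo (0 : ℝ) 1)
    (h1 : NonPole (l₁ + deltaMinus D₁ D₂)) (h2 : NonPole (l₁ - deltaMinus D₁ D₂))
    (h3 : NonPole (2 * l₁ + 1 - d / 2)) :
    HasSum (fun n : ℕ => coeffY (d / 2 - 1) (2 * deltaMinus D₁ D₂) (l₁ + deltaMinus D₁ D₂) l₂ n *
      blockProj d D₁ D₂ (2 * l₁ + 2 * n) η) (powerLaw l₁ l₂ η) := by
  set δ := deltaMinus D₁ D₂ with hδ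
  have g0 := ofReal_ne_zero_of_pos hη.1
  have key := (hasSum_blockCoeff_mul h3 h1 h2 l₂ hη).mul_left ((η : ℂ) ^ l₁)
  refine (key.congr_val ?_).congr_fun fun n => ?_
  · rw [powerLaw, div_eq_mul_inv, ← Complex.cpow_neg]
  · rw [coeffY_eq_blockCoeff, blockProj, gaussF_ofReal _ _ _ hη, ← hδ]
    rw [show 2 * (l₁ + δ) - (d / 2 - 1) - 2 * δ = 2 * l₁ + 1 - d / 2 by ring,
      show l₁ + δ - 2 * δ = l₁ - δ by ring,
      show (2 * l₁ + 2 * (n : ℂ)) / 2 = l₁ + n by ring, Complex.cpow_add _ _ g0,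
      Complex.cpow_natCast, show l₁ + (n : ℂ) + δ = l₁ + δ + n by ring,
      show l₁ + (n : ℂ) - δ = l₁ - δ + n by ring,
      show 2 * l₁ + 2 * (n : ℂ) + 1 - d / 2 = 2 * l₁ + 1 - d / 2 + 2 * n by ring]
    ring

lemma boundary_expansion {d l₁ l₂ : ℂ} {ρ : ℝ} (hρ : ρ ∈ Ioo (0 : ℝ) 1)
    (h1 : NonPole (-l₂)) (h2 : NonPole (-l₂ + 1 - d / 2)) (h3 : NonPole (-2 * l₂ + 2 - d)) :
    HasSum (fun n : ℕ => coeffY (d / 2 - 1) (d / 2 - 1) (-l₂) (-l₁) n * blockBdy d (-l₂ + n) ρ)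
      (powerLaw l₁ l₂ ρ) := by
  have g1 := one_sub_ne_zero hρ.2
  have hρ' : 1 - ρ ∈ Ioo (0 : ℝ) 1 := ⟨by linarith [hρ.2], by linarith [hρ.1]⟩
  have key := (hasSum_blockCoeff_mul h3 h1 h2 (-l₁) hρ').mul_left ((1 - (ρ : ℂ)) ^ (-l₂))
  have hc : ((1 - ρ : ℝ) : ℂ) = 1 - (ρ : ℂ) := by push_cast; rfl
  refine (key.congr_val ?_).congr_fun fun n => ?_
  · rw [powerLaw, div_eq_mul_inv, ← Complex.cpow_neg, hc, sub_sub_cancel, neg_neg, mul_comm]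
  · rw [coeffY_eq_blockCoeff, blockBdy, ← hc, gaussF_ofReal _ _ _ hρ', hc]
    rw [show 2 * -l₂ - (d / 2 - 1) - (d / 2 - 1) = -2 * l₂ + 2 - d by ring,
      show -l₂ - (d / 2 - 1) = -l₂ + 1 - d / 2 by ring, Complex.cpow_add _ _ g1,
      Complex.cpow_natCast, show -l₂ + (n : ℂ) + 1 - d / 2 = -l₂ + 1 - d / 2 + n by ring,
      show 2 * (-l₂ + (n : ℂ)) + 2 - d = -2 * l₂ + 2 - d + 2 * n by ring]
    ring

end AlphaSpace

end

theorem mainTheorem9 :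
    -- The Jacobi transform `𝒴 p q α l₁ l₂` of the double power law.
    (∃ 𝒴 : ℂ → ℂ → ℂ → ℂ → ℂ → ℂ,
      -- Where the defining integral converges, `𝒴` is that integral.
      (∀ p q α l₁ l₂ : ℂ, AlphaSpace.NonPole (1 + p) → AlphaSpace.ConvergesAtZero p q α l₁ →
        (IntegrableOn (AlphaSpace.jacobiIntegrand p q α l₁ l₂) (Ioo 0 1) ↔
          0 < (1 + p - l₂).re) ∧
        (0 < (1 + p - l₂).re →
          𝒴 p q α l₁ l₂ = ∫ x in Ioo (0 : ℝ) 1, AlphaSpace.jacobiIntegrand p q α l₁ l₂ x)) ∧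
      -- The explicit formula.
      (∀ p q α l₁ l₂ : ℂ, AlphaSpace.Generic p q α l₁ l₂ → 0 < (1 + p - l₂).re →
        Summable (AlphaSpace.threeFTwoTerm (l₁ - (1 + p + q) / 2 + α)
          (l₁ - (1 + p + q) / 2 - α) l₂ l₁ (l₁ - q)) ∧
        𝒴 p q α l₁ l₂ = AlphaSpace.closedForm p q α l₁ l₂) ∧
      -- Analytic continuation to generic parameters, and the reflection `q → -q`.
      (∀ p q α l₁ l₂ : ℂ, AlphaSpace.Generic p q α l₁ l₂ →
        AnalyticAt ℂ (fun a => 𝒴 p q a l₁ l₂) α ∧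
        AnalyticAt ℂ (fun l => 𝒴 p q α l l₂) l₁ ∧
        AnalyticAt ℂ (fun l => 𝒴 p q α l₁ l) l₂ ∧
        𝒴 p q α l₁ l₂ = 𝒴 p (-q) α (l₁ - q) l₂) ∧
      -- The coefficients `Y_n` as residues.
      (∀ (p q l₁ l₂ : ℂ) (n : ℕ), AlphaSpace.NonPole (1 + p) → AlphaSpace.NonPole l₁ →
        AlphaSpace.NonPole (l₁ - q) → AlphaSpace.NonPole (1 + p - l₂) →
        AlphaSpace.NonPole (2 * l₁ - 1 - p - q + n) →
        AlphaSpace.HasResidue (fun α => 2 / AlphaSpace.jacobiQ p q (-α) * 𝒴 p q α l₁ l₂)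
          (l₁ - (1 + p + q) / 2 + n) (-AlphaSpace.coeffY p q l₁ l₂ n)) ∧
      -- The bulk transform.
      (∀ d D₁ D₂ α l₁ l₂ : ℂ, AlphaSpace.NonPole (1 + 2 * AlphaSpace.deltaMinus D₁ D₂) →
        0 < (l₁ - d / 4 + α).re → 0 < (l₁ - d / 4 - α).re →
        0 < (1 + AlphaSpace.deltaMinus D₁ D₂ - l₂).re →
        IntegrableOn (fun ρ : ℝ => AlphaSpace.weightBulk d ρ * AlphaSpace.powerLaw l₁ l₂ ρ *
          AlphaSpace.waveBulk d D₁ D₂ α ρ) (Ioo 0 1) ∧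
        ∫ ρ in Ioo (0 : ℝ) 1, AlphaSpace.weightBulk d ρ * AlphaSpace.powerLaw l₁ l₂ ρ *
          AlphaSpace.waveBulk d D₁ D₂ α ρ =
          𝒴 (2 * AlphaSpace.deltaMinus D₁ D₂) (d / 2 - 1) α
            (l₁ + AlphaSpace.deltaMinus D₁ D₂) (l₂ + AlphaSpace.deltaMinus D₁ D₂)) ∧
      -- The boundary transform.
      (∀ d ν l₁ l₂ : ℂ, AlphaSpace.NonPole (d / 2) →
        0 < (-l₂ + 1 / 2 - d / 2 + ν).re → 0 < (-l₂ + 1 / 2 - d / 2 - ν).re →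
        0 < (d / 2 + l₁).re →
        IntegrableOn (fun ρ : ℝ => AlphaSpace.weightBdy d ρ * AlphaSpace.powerLaw l₁ l₂ ρ *
          AlphaSpace.waveBdy d ν ρ) (Ioo 0 1) ∧
        ∫ ρ in Ioo (0 : ℝ) 1, AlphaSpace.weightBdy d ρ * AlphaSpace.powerLaw l₁ l₂ ρ *
          AlphaSpace.waveBdy d ν ρ =
          𝒴 (d / 2 - 1) (d / 2 - 1) ν (-l₂) (-l₁)) ∧
      -- The crosscap transform.
      (∀ d D₁ D₂ α l₁ l₂ : ℂ, AlphaSpace.NonPole (d / 2) →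
        0 < (l₁ - d / 4 + α).re → 0 < (l₁ - d / 4 - α).re → 0 < (d / 2 - l₂).re →
        IntegrableOn (fun η : ℝ => AlphaSpace.weightProj d η * AlphaSpace.powerLaw l₁ l₂ η *
          AlphaSpace.waveProj d D₁ D₂ α η) (Ioo 0 1) ∧
        ∫ η in Ioo (0 : ℝ) 1, AlphaSpace.weightProj d η * AlphaSpace.powerLaw l₁ l₂ η *
          AlphaSpace.waveProj d D₁ D₂ α η =
          𝒴 (d / 2 - 1) (2 * AlphaSpace.deltaMinus D₁ D₂) α
            (l₁ + AlphaSpace.deltaMinus D₁ D₂) l₂)) ∧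
    -- Expansion of the power law in bulk blocks.
    (∀ (d D₁ D₂ l₁ l₂ : ℂ) (ρ : ℝ), ρ ∈ Ioo (0 : ℝ) 1 →
      AlphaSpace.NonPole (l₁ + AlphaSpace.deltaMinus D₁ D₂) →
      AlphaSpace.NonPole (l₁ + AlphaSpace.deltaMinus D₁ D₂ + 1 - d / 2) →
      AlphaSpace.NonPole (2 * l₁ + 1 - d / 2) →
      HasSum (fun n : ℕ => AlphaSpace.coeffY (2 * AlphaSpace.deltaMinus D₁ D₂) (d / 2 - 1)
          (l₁ + AlphaSpace.deltaMinus D₁ D₂) (l₂ + AlphaSpace.deltaMinus D₁ D₂) n *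
          AlphaSpace.blockBulk d D₁ D₂ (2 * l₁ + 2 * n) ρ)
        (AlphaSpace.powerLaw l₁ l₂ ρ)) ∧
    -- Expansion of the power law in boundary blocks.
    (∀ (d l₁ l₂ : ℂ) (ρ : ℝ), ρ ∈ Ioo (0 : ℝ) 1 →
      AlphaSpace.NonPole (-l₂) → AlphaSpace.NonPole (-l₂ + 1 - d / 2) →
      AlphaSpace.NonPole (-2 * l₂ + 2 - d) →
      HasSum (fun n : ℕ => AlphaSpace.coeffY (d / 2 - 1) (d / 2 - 1) (-l₂) (-l₁) n *
          AlphaSpace.blockBdy d (-l₂ + n) ρ)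
        (AlphaSpace.powerLaw l₁ l₂ ρ)) ∧
    -- Expansion of the power law in crosscap blocks.
    (∀ (d D₁ D₂ l₁ l₂ : ℂ) (η : ℝ), η ∈ Ioo (0 : ℝ) 1 →
      AlphaSpace.NonPole (l₁ + AlphaSpace.deltaMinus D₁ D₂) →
      AlphaSpace.NonPole (l₁ - AlphaSpace.deltaMinus D₁ D₂) →
      AlphaSpace.NonPole (2 * l₁ + 1 - d / 2) →
      HasSum (fun n : ℕ => AlphaSpace.coeffY (d / 2 - 1) (2 * AlphaSpace.deltaMinus D₁ D₂)
          (l₁ + AlphaSpace.deltaMinus D₁ D₂) l₂ n *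
          AlphaSpace.blockProj d D₁ D₂ (2 * l₁ + 2 * n) η)
        (AlphaSpace.powerLaw l₁ l₂ η)) := by
  refine ⟨⟨AlphaSpace.jacobiTransform,
    fun p q α l₁ l₂ hp h => ⟨AlphaSpace.integrableOn_jacobiIntegrand_iff hp h,
      fun hs => (AlphaSpace.integral_jacobiIntegrand hp h hs).2.symm⟩,
    fun p q α l₁ l₂ h hs => AlphaSpace.summable_threeFTwoTerm_and_eq_closedForm h hs,
    fun p q α l₁ l₂ h => ⟨?_, ?_, ?_, AlphaSpace.jacobiTransform_neg p q α l₁ l₂⟩,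
    fun p q l₁ l₂ n hp h1 h2 h3 h4 => AlphaSpace.hasResidue_jacobiTransform n hp h1 h2 h3 h4,
    fun d D₁ D₂ α l₁ l₂ hp h1 h2 h3 => AlphaSpace.bulk_transform hp h1 h2 h3,
    fun d ν l₁ l₂ hp h1 h2 h3 => AlphaSpace.boundary_transform hp h1 h2 h3,
    fun d D₁ D₂ α l₁ l₂ hp h1 h2 h3 => AlphaSpace.crosscap_transform hp h1 h2 h3⟩,
    fun d D₁ D₂ l₁ l₂ ρ hρ h1 h2 h3 => AlphaSpace.bulk_expansion hρ h1 h2 h3,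
    fun d l₁ l₂ ρ hρ h1 h2 h3 => AlphaSpace.boundary_expansion hρ h1 h2 h3,
    fun d D₁ D₂ l₁ l₂ η hη h1 h2 h3 => AlphaSpace.crosscap_expansion hη h1 h2 h3⟩
  · exact AlphaSpace.analyticAt_jacobiTransform (α := fun a => a) (l₁ := fun _ => l₁)
      (l₂ := fun _ => l₂) analyticAt_id analyticAt_const analyticAt_const h
  · exact AlphaSpace.analyticAt_jacobiTransform (α := fun _ => α) (l₁ := fun l => l)
      (l₂ := fun _ => l₂) analyticAt_const analyticAt_id analyticAt_const h
  · exact AlphaSpace.analyticAt_jacobiTransform (α := fun _ => α) (l₁ := fun _ => l₁)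
      (l₂ := fun l => l) analyticAt_const analyticAt_const analyticAt_id h
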